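/- **Setting.** Let $\mathcal X$ be a Grothendieck site with a set $X$ of enough points (points $x$ whose stalk functors jointly reflect isomorphisms of sheaves of sets). Let $\mathcal D$ be a symmetric monoidal category which is a *monoidal descent category*: it has finite products, a saturated class $\mathrm E$ of morphisms closed under finite products, a simple functor $\mathbf s:\Delta\mathcal D\to\mathcal D$ on cosimplicial objects, and natural transformations $\mu:\mathbf s\mathbf s\to\mathbf s\,\mathrm{diag}$ and $\lambda:\mathrm{id}\to\mathbf s\,c$ (with $c$ the constant cosimplicial object), such that the morphisms $\mathbf s(Y\times Z)\to\mathbf sY\times\mathbf sZ$, $\mu_Z$ and $\lambda_A$ lie in $\mathrm E$; the two composites $\mathbf sY\to\mathbf s\mathbf s(\cdot)\to\mathbf sY$ of $\lambda$ and $\mu$ are identities; $\mathbf s$ maps degreewise $\mathrm E$-morphisms into $\mathrm E$ and $A^{d^0}:A^{\Delta[1]}\to A^{\Delta[0]}$ into $\mathrm E$; $\mathbf s$ is lax symmetric monoidal and $\lambda,\mu$ are monoidal. Assume - (G1) $\mathcal D$ has filtered colimits and arbitrary products; - (G2) filtered colimits and arbitrary products of morphisms of $\mathrm E$ are in $\mathrm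 E$; - (G3) $A\otimes-$ preserves filtered colimits for every $A\in\mathcal D$. No associated sheaf functor is assumed. For a presheaf $F$ on $\mathcal X$ with values in $\mathcal D$ let $F_x$ be its stalk at $x$, let $TF(U)=\prod_{x\in X}\prod_{u\in x^*(U)}F_x$ be the Godement triple, $G^pF=T^{p+1}F$ the Godement cosimplicial resolution, $\mathbb H_{\mathcal X}(F)(U)=\mathbf s(G^\bullet F(U))$, and let $\rho_F:F\to\mathbb H_{\mathcal X}(F)$ be $\lambda$ followed by the simple of the coaugmentation $F\to G^\bullet F$. It is assumed that $\mathbb H_{\mathcal X}(F)$ is a sheaf for every sheaf $F$. For a category with two classes of morphisms $\mathcal S\subset\mathcal W$ (strong and weak equivalences), each containing the isomorphisms and closed under composition, an object $M$ is *CE-fibrant* if every $w:Y\to Z$ in $\mathcal W$ induces a bijection $\mathcal C[\mathcal S^{-1}](Z,M)\to\mathcal C[\mathcal S^{-1}](Y,M)$; a *CE-fibrant model* of $Y$ is a morphism $Y\to M$ of $\mathcal C[\mathcal S^{-1}]$ with $M$ CE-fibrant which becomes an isomorphism in $\mathcal C[\mathcal W^{-1}]$; and $(\mathcal C,\mathcal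 S,\mathcal W)$ is a *(right) Cartan–Eilenberg category* if every object has a CE-fibrant model. For sheaves with values in $\mathcal D$, let $\mathcal S$ be the class of *global equivalences* ($f(U)\in\mathrm E$ for every object $U$) and $\mathcal W$ the class of *local equivalences* ($f_x\in\mathrm E$ for every $x\in X$). The pair $(\mathcal X,\mathcal D)$ is *compatible* if $(\mathrm{Sh}(\mathcal X,\mathcal D),\mathcal S,\mathcal W)$ is a Cartan–Eilenberg category and $\rho_F:F\to\mathbb H_{\mathcal X}(F)$ is a CE-fibrant model for every sheaf $F$. Let $\mathcal P$ be a sheaf on $\mathcal X$ with values in the category of (symmetric, unital) operads in $\mathcal D$, with or without operations of arity $0$. A *sheaf of $\mathcal P$-algebras* is a sheaf $A$ with values in $\mathcal D$ with morphisms $\mathcal P(l)(U)\otimes A(U)^{\otimes l}\to A(U)$, natural in $U$, making each $A(U)$ a $\mathcal P(U)$-algebra; morphisms are the morphisms of sheaves commuting with these. A morphism of sheaves of $\mathcal P$-algebras is a global (local) equivalence if the underlying morphism of sheaves is. **Theorem.** Let $(\mathcal X,\mathcal D)$ be a compatible pair as above and $\mathcal P$ any sheaf of operads. Then 1. for every sheaf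 of $\mathcal P$-algebras $A$, the sheaf $\mathbb H_{\mathcal X}(A)$, with the structure morphisms $$\mathcal P(l)\otimes\mathbb H_{\mathcal X}(A)^{\otimes l}\longrightarrow\mathbb H_{\mathcal X}(\mathcal P(l))\otimes\mathbb H_{\mathcal X}(A)^{\otimes l}\longrightarrow\mathbb H_{\mathcal X}(\mathcal P(l)\otimes A^{\otimes l})\longrightarrow\mathbb H_{\mathcal X}(A)$$ given objectwise by $\rho_{\mathcal P(l)}$, the Künneth morphisms of filtered colimits, products and $\mathbf s$, and the structure of $A$, is a sheaf of $\mathcal P$-algebras, and $\rho_A:A\to\mathbb H_{\mathcal X}(A)$ is a morphism of $\mathcal P$-algebras; 2. the category of sheaves of $\mathcal P$-algebras, with the global and the local equivalences, is a (right) Cartan–Eilenberg category; 3. for every sheaf of $\mathcal P$-algebras $A$, $\rho_A:A\to\mathbb H_{\mathcal X}(A)$ is a CE-fibrant model. -/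

import Mathlib

open CategoryTheory Limits MonoidalCategory Opposite

universe w v u v' u'

namespace GodementOperads

/-! ## Cartan-Eilenberg categories -/

section CartanEilenberg

variable {C : Type u} [Category.{v} C]

/-- A class of morphisms is saturated if it contains every morphism that becomes invertible
in the localized category. -/
def IsSaturated (W : MorphismProperty C) : Prop :=
  ∀ ⦃X Y : C⦄ (f : X ⟶ Y), IsIso (W.Q.map f) → W f

/-- An object `M` is CE-fibrant for strong equivalences `S` and weak equivalences `W` if every
weak equivalence `w : X ⟶ Y` induces a bijection `C[S⁻¹](Y, M) → C[S⁻¹](X, M)`. -/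
def IsCEFibrant (S W : MorphismProperty C) (M : C) : Prop :=
  ∀ ⦃X Y : C⦄ (w : X ⟶ Y), W w →
    Function.Bijective (fun g : S.Q.obj Y ⟶ S.Q.obj M => S.Q.map w ≫ g)

/-- A CE-fibrant model of `X` is a morphism `φ : X ⟶ M` of `C[S⁻¹]` with `M` CE-fibrant, which
becomes an isomorphism in `C[W⁻¹]`. -/
def IsCEFibrantModel (S W : MorphismProperty C) {X M : C} (φ : S.Q.obj X ⟶ S.Q.obj M) : Prop :=
  IsCEFibrant S W M ∧
    ∃ h : S.IsInvertedBy W.Q, IsIso ((Localization.Construction.lift W.Q h).map φ)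

/-- Right Cartan-Eilenberg categories: two classes `S ⊆ W` of morphisms, each containing the
isomorphisms and closed under composition, such that every object has a CE-fibrant model. -/
structure IsRightCartanEilenberg (S W : MorphismProperty C) : Prop where
  isomorphisms_le : MorphismProperty.isomorphisms C ≤ S
  strong_comp : S.IsStableUnderComposition
  weak_comp : W.IsStableUnderComposition
  strong_le_weak : S ≤ W
  exists_model (X : C) : ∃ (M : C) (φ : S.Q.obj X ⟶ S.Q.obj M), IsCEFibrantModel S W φ

end CartanEilenberg

/-! ## Descent categories -/

section Descent

variable {D : Type u'} [Category.{v'} D]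

/-- The diagonal cosimplicial object of a bicosimplicial object. -/
@[simps]
def diagonal : (SimplexCategory ⥤ SimplexCategory ⥤ D) ⥤ (SimplexCategory ⥤ D) where
  obj Z :=
    { obj := fun n => (Z.obj n).obj n
      map := fun {n m} f => (Z.map f).app n ≫ (Z.obj m).map f
      map_id := fun n => by simp
      map_comp := fun f g => by simp }
  map τ :=
    { app := fun n => (τ.app n).app n
      naturality := fun n m f => by
        have h := congrArg (fun t => t.app n) (τ.naturality f)
        simp only [NatTrans.comp_app] at h
        simp [reassoc_of% h] }
  map_id Z := by ext; simp
  map_comp σ τ := by ext; simp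

/-- The constant cosimplicial object functor. -/
abbrev const : D ⥤ (SimplexCategory ⥤ D) := Functor.const SimplexCategory

/-- The diagonal of the bicosimplicial object `(n, m) ↦ X^m` is `X`. -/
def diagonalConst (X : SimplexCategory ⥤ D) :
    diagonal.obj ((Functor.const SimplexCategory).obj X) ≅ X :=
  NatIso.ofComponents (fun _ => Iso.refl _) (fun f => by
    simp only [diagonal, Functor.const_obj_map, Functor.const_obj_obj, NatTrans.id_app,
      Category.id_comp, Iso.refl_hom]
    exact Category.comp_id (X.map f))

/-- The diagonal of the bicosimplicial object `(n, m) ↦ X^n` is `X`. -/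
def diagonalCompConst (X : SimplexCategory ⥤ D) : diagonal.obj (X ⋙ const) ≅ X :=
  NatIso.ofComponents (fun _ => Iso.refl _) (fun f => by
    simp only [diagonal, Functor.const_obj_map, Functor.const_obj_obj, Functor.comp_map,
      Functor.comp_obj, Category.id_comp, Iso.refl_hom, Functor.const_map_app, Category.comp_id])

/-- The iterated simple `Z ↦ s (n ↦ s (Z^{n, •}))` of a bicosimplicial object. -/
abbrev iteratedSimple (s : (SimplexCategory ⥤ D) ⥤ D) :
    (SimplexCategory ⥤ SimplexCategory ⥤ D) ⥤ D :=
  (Functor.whiskeringRight SimplexCategory _ _).obj s ⋙ s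

instance (n m : SimplexCategory) : Finite (n ⟶ m) :=
  Finite.of_injective (fun f => (f.toOrderHom : Fin (n.len + 1) → Fin (m.len + 1)))
    (fun _ _ h => SimplexCategory.Hom.ext _ _ (OrderHom.ext _ _ h))

variable [HasFiniteProducts D]

/-- The cosimplicial object `A^{Δ[k]}`, equal to the product of copies of `A` indexed by the
`n`-simplices of `Δ[k]` in degree `n`. -/
@[simps]
noncomputable def simplexPower (A : D) (k : SimplexCategory) : SimplexCategory ⥤ D where
  obj n := ∏ᶜ fun _ : n ⟶ k => A
  map f := Pi.lift fun g => Pi.π (fun _ => A) (f ≫ g)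

/-- The morphism `A^{Δ[k']} ⟶ A^{Δ[k]}` induced by `ψ : [k] ⟶ [k']`. -/
@[simps]
noncomputable def simplexPowerMap (A : D) {k k' : SimplexCategory} (ψ : k ⟶ k') :
    simplexPower A k' ⟶ simplexPower A k where
  app n := Pi.lift fun g => Pi.π (fun _ => A) (g ≫ ψ)
  naturality n m f := by
    refine Pi.hom_ext _ _ fun g => ?_
    simp [simplexPower]

variable (D) in
/-- A (cosimplicial) descent category structure `(E, s, μ, λ)` on a category with finite
products: a saturated class `E` of equivalences closed under finite products, a simple functor
`s` from cosimplicial objects, and natural transformations `μ : s s ⟶ s diag`,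
`λ : id ⟶ s const`. -/
structure DescentStructure where
  /-- the equivalences -/
  E : MorphismProperty D
  /-- the simple functor -/
  s : (SimplexCategory ⥤ D) ⥤ D
  /-- the transformation from the iterated simple to the simple of the diagonal -/
  mu : iteratedSimple s ⟶ diagonal ⋙ s
  /-- the transformation from an object to the simple of its constant cosimplicial object -/
  lam : 𝟭 D ⟶ const ⋙ s
  saturated : IsSaturated E
  prod_mem {A B A' B' : D} (f : A ⟶ A') (g : B ⟶ B') : E f → E g → E (Limits.prod.map f g)
  simple_prod (X Y : SimplexCategory ⥤ D) : E (prodComparison s X Y)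
  mu_mem (Z : SimplexCategory ⥤ SimplexCategory ⥤ D) : E (mu.app Z)
  lam_mem (A : D) : E (lam.app A)
  lam_mu_left (X : SimplexCategory ⥤ D) :
    lam.app (s.obj X) ≫ s.map (Functor.constComp SimplexCategory X s).inv ≫
      mu.app ((Functor.const SimplexCategory).obj X) ≫ s.map (diagonalConst X).hom = 𝟙 _
  lam_mu_right (X : SimplexCategory ⥤ D) :
    s.map (Functor.whiskerLeft X lam) ≫ mu.app (X ⋙ const) ≫
      s.map (diagonalCompConst X).hom = 𝟙 _
  simple_mem {X Y : SimplexCategory ⥤ D} (f : X ⟶ Y) : (∀ n, E (f.app n)) → E (s.map f)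
  simple_path (A : D) :
    E (s.map (simplexPowerMap A (SimplexCategory.δ (0 : Fin 2))))

/-- Filtered colimits and arbitrary products preserve the class `E`. -/
structure IsExact (E : MorphismProperty D) [HasFilteredColimitsOfSize.{w, w} D]
    [HasProducts.{w} D] : Prop where
  colim (I : Type w) [SmallCategory I] [IsFiltered I] (F G : I ⥤ D) (φ : F ⟶ G) :
    (∀ i, E (φ.app i)) → E (colimMap φ)
  prod (I : Type w) (A B : I → D) (f : ∀ i, A i ⟶ B i) : (∀ i, E (f i)) → E (Limits.Pi.map f)

variable [MonoidalCategory D]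

instance : (diagonal (D := D)).LaxMonoidal where
  ε := { app := fun _ => 𝟙 _ }
  μ Z Z' :=
    { app := fun _ => 𝟙 _
      naturality := fun n m f => by
        refine (Category.comp_id _).trans (Eq.trans ?_ (Category.id_comp _).symm)
        exact (tensorHom_comp_tensorHom _ _ _ _).symm }
  μ_natural_left f Z := by
    refine NatTrans.ext (funext fun n => ?_)
    exact (Category.comp_id _).trans (Category.id_comp _).symm
  μ_natural_right Z f := by
    refine NatTrans.ext (funext fun n => ?_)
    exact (Category.comp_id _).trans (Category.id_comp _).symm
  associativity X Y Z := by
    refine NatTrans.ext (funext fun n => ?_)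
    change 𝟙 ((X.obj n).obj n ⊗ (Y.obj n).obj n) ▷ (Z.obj n).obj n ≫ 𝟙 _ ≫
        (α_ ((X.obj n).obj n) ((Y.obj n).obj n) ((Z.obj n).obj n)).hom =
      (α_ ((X.obj n).obj n) ((Y.obj n).obj n) ((Z.obj n).obj n)).hom ≫
        (X.obj n).obj n ◁ 𝟙 ((Y.obj n).obj n ⊗ (Z.obj n).obj n) ≫ 𝟙 _
    simp
  left_unitality X := by
    refine NatTrans.ext (funext fun n => ?_)
    change (λ_ ((X.obj n).obj n)).hom =
      𝟙 (𝟙_ D) ▷ (X.obj n).obj n ≫ 𝟙 _ ≫ (λ_ ((X.obj n).obj n)).hom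
    simp
  right_unitality X := by
    refine NatTrans.ext (funext fun n => ?_)
    change (ρ_ ((X.obj n).obj n)).hom =
      (X.obj n).obj n ◁ 𝟙 (𝟙_ D) ≫ 𝟙 _ ≫ (ρ_ ((X.obj n).obj n)).hom
    simp

instance : (const (D := D)).LaxMonoidal where
  ε := { app := fun _ => 𝟙 _ }
  μ A B := { app := fun _ => 𝟙 _ }

variable (D) in
/-- A monoidal descent category structure: the simple functor is lax symmetric monoidal, and
`μ` and `λ` are monoidal transformations. Cosimplicial objects are tensored degreewise. -/
structure MonoidalDescentStructure [SymmetricCategory D] extends DescentStructure D where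
  /-- the Künneth and unit morphisms of the simple functor -/
  laxBraided : s.LaxBraided
  mu_isMonoidal : NatTrans.IsMonoidal mu
  lam_isMonoidal : NatTrans.IsMonoidal lam

attribute [instance] MonoidalDescentStructure.laxBraided
  MonoidalDescentStructure.mu_isMonoidal MonoidalDescentStructure.lam_isMonoidal

end Descent

/-! ## Finite tensor products -/

section Tensor

variable {V : Type u} [Category.{v} V] [MonoidalCategory V]

/-- The tensor product `A 0 ⊗ ⋯ ⊗ A (n - 1)`, bracketed to the left. -/
def tens : (n : ℕ) → (Fin n → V) → V
  | 0, _ => 𝟙_ V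
  | n + 1, A => tens n (fun i => A i.castSucc) ⊗ A (Fin.last n)

/-- The tensor product of a finite family of morphisms. -/
def tensMap : (n : ℕ) → {A B : Fin n → V} → (∀ i, A i ⟶ B i) → (tens n A ⟶ tens n B)
  | 0, _, _, _ => 𝟙 (𝟙_ V)
  | n + 1, _, _, f => tensMap n (fun i => f i.castSucc) ⊗ₘ f (Fin.last n)

lemma tensMap_id : ∀ (n : ℕ) (A : Fin n → V), tensMap n (fun i => 𝟙 (A i)) = 𝟙 (tens n A)
  | 0, _ => rfl
  | n + 1, A => by
    simp only [tensMap, tensMap_id n, id_tensorHom_id]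
    rfl

lemma tensMap_comp : ∀ (n : ℕ) {A B C : Fin n → V} (f : ∀ i, A i ⟶ B i) (g : ∀ i, B i ⟶ C i),
    tensMap n (fun i => f i ≫ g i) = tensMap n f ≫ tensMap n g
  | 0, _, _, _, _, _ => (Category.comp_id _).symm
  | n + 1, _, _, _, f, g => by
    simp only [tensMap, tensMap_comp n]
    exact (tensorHom_comp_tensorHom _ _ _ _).symm

/-- The morphism between the tensor products of two equal families. -/
def tensCongr (n : ℕ) {A B : Fin n → V} (h : ∀ i, A i = B i) : tens n A ⟶ tens n B :=
  tensMap n (fun i => eqToHom (h i))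

/-- Reindexing a tensor product along an equality of lengths. -/
def tensCast {a b : ℕ} (h : a = b) (A : Fin b → V) :
    tens b A ⟶ tens a (fun i => A (Fin.cast h i)) :=
  eqToHom (by subst h; rfl)

/-- The associativity morphism splitting a tensor product into its first `a` and its last `b`
factors. -/
def tensAppend (a : ℕ) : (b : ℕ) → (A : Fin (a + b) → V) →
    (tens (a + b) A ⟶ tens a (fun i => A (Fin.castAdd b i)) ⊗ tens b (fun j => A (Fin.natAdd a j)))
  | 0, _ => (ρ_ _).inv
  | b + 1, A => tensAppend a b (fun i => A i.castSucc) ▷ A (Fin.last (a + b)) ≫ (α_ _ _ _).hom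

/-- The associativity morphism splitting a tensor product into consecutive blocks of lengths
`m 0, …, m (n - 1)`. -/
def tensSplit : (n : ℕ) → (m : Fin n → ℕ) → (A : Fin (∑ i, m i) → V) →
    (tens (∑ i, m i) A ⟶ tens n (fun i => tens (m i) (fun j => A (finSigmaFinEquiv ⟨i, j⟩))))
  | 0, m, A => tensCast (a := 0) (b := ∑ i, m i) (by simp) A
  | n + 1, m, A =>
    tensCast (Fin.sum_univ_castSucc m).symm A ≫
      tensAppend (∑ i : Fin n, m i.castSucc) (m (Fin.last n)) _ ≫
        ((tensSplit n (fun i => m i.castSucc) _ ≫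
            tensMap n (fun i => tensCongr (m i.castSucc) (fun j => congrArg A (by
              apply Fin.ext
              simp [finSigmaFinEquiv_apply])))) ⊗ₘ
          tensCongr (m (Fin.last n)) (fun j => congrArg A (by
              apply Fin.ext
              simp [finSigmaFinEquiv_apply]
              rfl)))

/-- The interchange `(A 0 ⊗ ⋯) ⊗ (B 0 ⊗ ⋯) ⟶ (A 0 ⊗ B 0) ⊗ ⋯`. -/
def tensZip [BraidedCategory V] : (n : ℕ) → (A B : Fin n → V) →
    (tens n A ⊗ tens n B ⟶ tens n (fun i => A i ⊗ B i))
  | 0, _, _ => (λ_ (𝟙_ V)).hom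
  | n + 1, A, B => tensorμ _ _ _ _ ≫ tensZip n _ _ ▷ (A (Fin.last n) ⊗ B (Fin.last n))

/-- The shuffle `(X ⊗ ⨂ᵢ B i) ⊗ ⨂ₖ A k ⟶ X ⊗ ⨂ᵢ (B i ⊗ ⨂ⱼ A (i, j))`, where the index `k` runs
through the consecutive blocks of indices `(i, j)` with `j < m i`. -/
def tensShuffle [BraidedCategory V] (X : V) (n : ℕ) (B : Fin n → V) (m : Fin n → ℕ)
    (A : Fin (∑ i, m i) → V) :
    (X ⊗ tens n B) ⊗ tens (∑ i, m i) A ⟶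
      X ⊗ tens n (fun i => B i ⊗ tens (m i) (fun j => A (finSigmaFinEquiv ⟨i, j⟩))) :=
  (α_ _ _ _).hom ≫ X ◁ (tens n B ◁ tensSplit n m A ≫ tensZip n _ _)

/-- The symmetry moving the `k`-th factor of a tensor product to the last position. -/
def tensExtract [BraidedCategory V] : (n : ℕ) → (A : Fin (n + 1) → V) → (k : Fin (n + 1)) →
    (tens (n + 1) A ⟶ tens n (fun j => A (k.succAbove j)) ⊗ A k)
  | 0, A, k => 𝟙_ V ◁ eqToHom (congrArg A (Subsingleton.elim (α := Fin 1) _ _))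
  | n + 1, A, k =>
    if h : k = Fin.last (n + 1) then
      tensCongr (n + 1) (fun j => congrArg A (by rw [h, Fin.succAbove_last])) ⊗ₘ
        eqToHom (congrArg A h.symm)
    else
      tensExtract n (fun j => A j.castSucc) (k.castPred h) ▷ A (Fin.last (n + 1)) ≫
        (α_ _ _ _).hom ≫ _ ◁ (β_ _ _).hom ≫ (α_ _ _ _).inv ≫
          ((tensCongr n (fun j => congrArg A (by
              rw [← Fin.castSucc_succAbove_castSucc, Fin.castSucc_castPred])) ⊗ₘ
            eqToHom (congrArg A (by
              apply Fin.ext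
              have hk : k.1 < n + 1 := Fin.val_lt_last h
              simp [Fin.succAbove, Fin.lt_def, Nat.not_lt.2 (Nat.lt_succ_iff.1 hk)]))) ⊗ₘ
            eqToHom (congrArg A (Fin.castSucc_castPred k h)))

/-- The bijection obtained from `e` by removing the last element and its image. -/
def removeLast {a b : ℕ} (e : Fin (a + 1) ≃ Fin (b + 1)) : Fin a ≃ Fin b :=
  (finSuccAboveEquiv (Fin.last a)).trans
    ((e.subtypeEquiv (fun i => by simp)).trans
      (finSuccAboveEquiv (e (Fin.last a))).symm)

lemma succAbove_removeLast {a b : ℕ} (e : Fin (a + 1) ≃ Fin (b + 1)) (j : Fin a) :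
    (e (Fin.last a)).succAbove (removeLast e j) = e j.castSucc := by
  have h := (finSuccAboveEquiv (e (Fin.last a))).apply_symm_apply
    ((e.subtypeEquiv (p := fun i => i ≠ Fin.last a) (q := fun i => i ≠ e (Fin.last a))
      (fun i => by simp)) (finSuccAboveEquiv (Fin.last a) j))
  have h' := congrArg Subtype.val h
  exact h'.trans (congrArg e (Fin.succAbove_last_apply j))

/-- The symmetry `⨂ᵢ A i ⟶ ⨂ᵢ A (e i)` induced by a bijection `e`. -/
def tensPerm [BraidedCategory V] : {a b : ℕ} → (e : Fin a ≃ Fin b) → (A : Fin b → V) →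
    (tens b A ⟶ tens a (fun i => A (e i)))
  | 0, 0, _, _ => 𝟙 (𝟙_ V)
  | 0, _ + 1, e, _ => (e.symm 0).elim0
  | _ + 1, 0, e, _ => (e 0).elim0
  | a + 1, b + 1, e, A =>
    tensExtract b A (e (Fin.last a)) ≫
      (tensPerm (removeLast e) (fun j => A ((e (Fin.last a)).succAbove j)) ≫
        tensCongr a (fun j => congrArg A (succAbove_removeLast e j))) ▷ A (e (Fin.last a))

/-- The morphism `𝟙 ⟶ U ⊗ ⋯ ⊗ U` induced by `u : 𝟙 ⟶ U`. -/
def tensUnit {U : V} (u : 𝟙_ V ⟶ U) : (n : ℕ) → (𝟙_ V ⟶ tens n (fun _ => U))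
  | 0 => 𝟙 (𝟙_ V)
  | n + 1 => (λ_ (𝟙_ V)).inv ≫ (tensUnit u n ⊗ₘ u)

/-- The identification of an object with a tensor product of length one. -/
def tensOne (A : V) : A ⟶ tens 1 (fun _ => A) := (λ_ A).inv

end Tensor

/-! ## Operads and their algebras -/

section Operad

/-- The arities of an operad: all natural numbers if `z` holds, and the positive ones otherwise. -/
abbrev Arity (z : Prop) : Type := {l : ℕ // z ∨ 0 < l}

/-- The arity `1`. -/
def Arity.one (z : Prop) : Arity z := ⟨1, Or.inr Nat.one_pos⟩

/-- The sum `m 0 + ⋯ + m (l - 1)`. -/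
def Arity.sum {z : Prop} (l : Arity z) (m : Fin l.1 → Arity z) : Arity z :=
  ⟨∑ i, (m i).1, by
    by_cases hz : z
    · exact Or.inl hz
    · have hl : 0 < l.1 := l.2.resolve_left hz
      exact Or.inr (Finset.sum_pos (fun i _ => (m i).2.resolve_left hz) ⟨⟨0, hl⟩, Finset.mem_univ _⟩)⟩

/-- The block sum of the bijections `e i`. -/
def blockSum {n : ℕ} {m m' : Fin n → ℕ} (e : ∀ i, Fin (m' i) ≃ Fin (m i)) :
    Fin (∑ i, m' i) ≃ Fin (∑ i, m i) :=
  finSigmaFinEquiv.symm.trans ((Equiv.sigmaCongrRight e).trans finSigmaFinEquiv)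

/-- The bijection permuting blocks of lengths `m i` in the same way as `σ` permutes the indices. -/
def blockPerm {n n' : ℕ} (σ : Fin n' ≃ Fin n) (m : Fin n → ℕ) :
    Fin (∑ i, m (σ i)) ≃ Fin (∑ i, m i) :=
  finSigmaFinEquiv.symm.trans
    ((Equiv.sigmaCongrLeft (β := fun i => Fin (m i)) σ).trans finSigmaFinEquiv)

lemma sum_blocks {n : ℕ} (m : Fin n → ℕ) (k : Fin (∑ i, m i) → ℕ) :
    ∑ t, k t = ∑ i, ∑ j, k (finSigmaFinEquiv ⟨i, j⟩) := by
  rw [← Equiv.sum_comp finSigmaFinEquiv, Fintype.sum_sigma]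

variable (V : Type u) [Category.{v} V] [MonoidalCategory V] [SymmetricCategory V]

/-- A (unital, symmetric) operad in a symmetric monoidal category. The underlying symmetric
sequence is a contravariant functor on the groupoid of the finite sets `{0, …, l - 1}` and
bijections, so that the symmetric group acts on `P(l)` from the right. -/
structure Operad (z : Prop) where
  /-- the object of operations of arity `l` -/
  obj : Arity z → V
  /-- the action of bijections -/
  map {a b : Arity z} (e : Fin a.1 ≃ Fin b.1) : obj b ⟶ obj a
  /-- the unit -/
  one : 𝟙_ V ⟶ obj (Arity.one z)
  /-- the structure morphism `P(l) ⊗ P(m₁) ⊗ ⋯ ⊗ P(m_l) ⟶ P(m₁ + ⋯ + m_l)` -/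
  comp (l : Arity z) (m : Fin l.1 → Arity z) :
    obj l ⊗ tens l.1 (fun i => obj (m i)) ⟶ obj (Arity.sum l m)
  map_refl (a : Arity z) : map (Equiv.refl (Fin a.1)) = 𝟙 (obj a)
  map_trans {a b c : Arity z} (e : Fin a.1 ≃ Fin b.1) (f : Fin b.1 ≃ Fin c.1) :
    map (a := a) (b := c) (e.trans f) = map f ≫ map e
  comp_map_right (l : Arity z) {m m' : Fin l.1 → Arity z}
    (e : ∀ i, Fin (m' i).1 ≃ Fin (m i).1) :
    obj l ◁ tensMap l.1 (fun i => map (e i)) ≫ comp l m' =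
      comp l m ≫ map (a := Arity.sum l m') (b := Arity.sum l m) (blockSum e)
  comp_map_left {l l' : Arity z} (σ : Fin l'.1 ≃ Fin l.1) (m : Fin l.1 → Arity z) :
    (map σ ⊗ₘ tensPerm σ (fun i => obj (m i))) ≫ comp l' (fun i => m (σ i)) =
      comp l m ≫ map (a := Arity.sum l' (fun i => m (σ i))) (b := Arity.sum l m)
        (blockPerm σ (fun i => (m i).1))
  one_comp (l : Arity z) :
    (λ_ (obj l)).inv ≫ (one ⊗ₘ tensOne (obj l)) ≫ comp (Arity.one z) (fun _ => l) ≫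
      map (a := l) (b := Arity.sum (Arity.one z) (fun _ => l))
        (finCongr (Fin.sum_univ_one (fun _ => l.1)).symm) = 𝟙 (obj l)
  comp_one (l : Arity z) :
    (ρ_ (obj l)).inv ≫ obj l ◁ tensUnit one l.1 ≫ comp l (fun _ => Arity.one z) ≫
      map (a := l) (b := Arity.sum l (fun _ => Arity.one z))
        (finCongr (by simp [Arity.sum, Arity.one])) = 𝟙 (obj l)
  assoc (l : Arity z) (m : Fin l.1 → Arity z) (k : Fin (Arity.sum l m).1 → Arity z) :
    comp l m ▷ tens (Arity.sum l m).1 (fun t => obj (k t)) ≫ comp (Arity.sum l m) k =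
      tensShuffle (obj l) l.1 (fun i => obj (m i)) (fun i => (m i).1) (fun t => obj (k t)) ≫
        obj l ◁ tensMap l.1 (fun i => comp (m i) (fun j => k (finSigmaFinEquiv ⟨i, j⟩))) ≫
          comp l (fun i => Arity.sum (m i) (fun j => k (finSigmaFinEquiv ⟨i, j⟩))) ≫
            map (a := Arity.sum (Arity.sum l m) k)
              (b := Arity.sum l fun i => Arity.sum (m i) (fun j => k (finSigmaFinEquiv ⟨i, j⟩)))
              (finCongr (sum_blocks (fun i => (m i).1) (fun t => (k t).1)))

variable {V} {z : Prop}

namespace Operad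

/-- Morphisms of operads. -/
@[ext]
structure Hom (P Q : Operad V z) where
  /-- the component of arity `l` -/
  app (l : Arity z) : P.obj l ⟶ Q.obj l
  map_app {a b : Arity z} (e : Fin a.1 ≃ Fin b.1) : P.map e ≫ app a = app b ≫ Q.map e
  one_app : P.one ≫ app (Arity.one z) = Q.one
  comp_app (l : Arity z) (m : Fin l.1 → Arity z) :
    P.comp l m ≫ app (Arity.sum l m) =
      (app l ⊗ₘ tensMap l.1 (fun i => app (m i))) ≫ Q.comp l m

instance : Category (Operad V z) where
  Hom := Hom
  id P :=
    { app := fun l => 𝟙 (P.obj l)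
      map_app := fun e => (Category.comp_id _).trans (Category.id_comp _).symm
      one_app := Category.comp_id _
      comp_app := fun l m => by simp [tensMap_id] }
  comp f g :=
    { app := fun l => f.app l ≫ g.app l
      map_app := fun e => by rw [← Category.assoc, f.map_app, Category.assoc, g.map_app,
        Category.assoc]
      one_app := by rw [← Category.assoc, f.one_app, g.one_app]
      comp_app := fun l m => by
        rw [← Category.assoc, f.comp_app, Category.assoc, g.comp_app, tensMap_comp,
          ← tensorHom_comp_tensorHom, Category.assoc] }

variable (V z) in
/-- The functor sending an operad to its object of operations of arity `l`. -/
@[simps]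
def arityFunctor (l : Arity z) : Operad V z ⥤ V where
  obj P := P.obj l
  map f := Hom.app f l

/-- The axioms of an algebra over the operad `P`, for an object `A` with structure morphisms
`act l : P(l) ⊗ A ⊗ ⋯ ⊗ A ⟶ A`: equivariance, unit and associativity. -/
structure IsAlgebra (P : Operad V z) (A : V)
    (act : ∀ l : Arity z, P.obj l ⊗ tens l.1 (fun _ => A) ⟶ A) : Prop where
  equivariant {a b : Arity z} (e : Fin a.1 ≃ Fin b.1) :
    (P.map e ⊗ₘ tensPerm e (fun _ => A)) ≫ act a = act b
  unit : (λ_ A).inv ≫ (P.one ⊗ₘ tensOne A) ≫ act (Arity.one z) = 𝟙 A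
  assoc (l : Arity z) (m : Fin l.1 → Arity z) :
    P.comp l m ▷ tens (Arity.sum l m).1 (fun _ => A) ≫ act (Arity.sum l m) =
      tensShuffle (P.obj l) l.1 (fun i => P.obj (m i)) (fun i => (m i).1) (fun _ => A) ≫
        P.obj l ◁ tensMap l.1 (fun i => act (m i)) ≫ act l

end Operad

end Operad

/-! ## Tensor products of presheaves -/

section Presheaf

variable {C : Type u} [Category.{v} C] {D : Type u'} [Category.{v'} D] [MonoidalCategory D]

/-- The tensor product `F(U) ⊗ G(U) ⟶ A ⊗ B` of two morphisms, with source a value of the presheaf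
`F ⊗ G`. -/
def pair {F G : C ⥤ D} {U : C} {A B : D} (a : F.obj U ⟶ A) (b : G.obj U ⟶ B) :
    (F ⊗ G).obj U ⟶ A ⊗ B := a ⊗ₘ b

lemma pair_comp {F G : C ⥤ D} {U : C} {A B A' B' : D} (a : F.obj U ⟶ A) (b : G.obj U ⟶ B)
    (c : A ⟶ A') (d : B ⟶ B') : pair a b ≫ (c ⊗ₘ d) = pair (a ≫ c) (b ≫ d) :=
  tensorHom_comp_tensorHom _ _ _ _

lemma pair_comp_assoc {F G : C ⥤ D} {U : C} {A B A' B' E : D} (a : F.obj U ⟶ A)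
    (b : G.obj U ⟶ B) (c : A ⟶ A') (d : B ⟶ B') (h : A' ⊗ B' ⟶ E) :
    pair a b ≫ (c ⊗ₘ d) ≫ h = pair (a ≫ c) (b ≫ d) ≫ h := by
  rw [← Category.assoc, pair_comp]

lemma app_pair {F G F' G' : C ⥤ D} (φ : F ⟶ F') (ψ : G ⟶ G') {U : C} {A B : D}
    (a : F'.obj U ⟶ A) (b : G'.obj U ⟶ B) :
    (φ ⊗ₘ ψ).app U ≫ pair a b = pair (φ.app U ≫ a) (ψ.app U ≫ b) :=
  tensorHom_comp_tensorHom _ _ _ _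

lemma app_pair_assoc {F G F' G' : C ⥤ D} (φ : F ⟶ F') (ψ : G ⟶ G') {U : C} {A B E : D}
    (a : F'.obj U ⟶ A) (b : G'.obj U ⟶ B) (h : A ⊗ B ⟶ E) :
    (φ ⊗ₘ ψ).app U ≫ pair a b ≫ h = pair (φ.app U ≫ a) (ψ.app U ≫ b) ≫ h := by
  rw [← Category.assoc, app_pair]

lemma map_pair {F G : C ⥤ D} {U V : C} (f : U ⟶ V) {A B : D} (a : F.obj V ⟶ A)
    (b : G.obj V ⟶ B) : (F ⊗ G).map f ≫ pair a b = pair (F.map f ≫ a) (G.map f ≫ b) :=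
  tensorHom_comp_tensorHom _ _ _ _

lemma map_pair_assoc {F G : C ⥤ D} {U V : C} (f : U ⟶ V) {A B E : D} (a : F.obj V ⟶ A)
    (b : G.obj V ⟶ B) (h : A ⊗ B ⟶ E) :
    (F ⊗ G).map f ≫ pair a b ≫ h = pair (F.map f ≫ a) (G.map f ≫ b) ≫ h := by
  rw [← Category.assoc, map_pair]

end Presheaf

/-! ## Stalks -/

section Stalk

variable {C : Type u} [Category.{v} C] [LocallySmall.{w} C] {J : GrothendieckTopology C}
  (Φ : GrothendieckTopology.Point.{w} J)
  {D : Type u'} [Category.{v'} D] [HasFilteredColimitsOfSize.{w, w} D]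

instance : HasColimitsOfShape Φ.fiber.Elementsᵒᵖ D :=
  Functor.Final.hasColimitsOfShape_of_final (FinallySmall.fromFilteredFinalModel.{w} _)

/-- The stalk of presheaves at a point: the filtered colimit of `F(U)` over the neighbourhoods
`(U, u)` of the point. -/
noncomputable def stalk : (Cᵒᵖ ⥤ D) ⥤ D :=
  (Functor.whiskeringLeft _ _ _).obj (CategoryOfElements.π Φ.fiber).op ⋙ colim

/-- The canonical morphism `F(U) ⟶ F_Φ` attached to a neighbourhood `(U, u)`. -/
noncomputable def germ (F : Cᵒᵖ ⥤ D) (U : Cᵒᵖ) (u : Φ.fiber.obj U.unop) :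
    F.obj U ⟶ (stalk Φ).obj F :=
  colimit.ι ((CategoryOfElements.π Φ.fiber).op ⋙ F) (op ⟨U.unop, u⟩)

variable {Φ} in
lemma stalk_hom_ext {F : Cᵒᵖ ⥤ D} {T : D} {f g : (stalk Φ).obj F ⟶ T}
    (h : ∀ (U : Cᵒᵖ) (u : Φ.fiber.obj U.unop), germ Φ F U u ≫ f = germ Φ F U u ≫ g) : f = g :=
  colimit.hom_ext (by rintro ⟨⟨U, u⟩⟩; exact h (op U) u)

lemma germ_res (F : Cᵒᵖ ⥤ D) {U V : Cᵒᵖ} (f : U ⟶ V) (v : Φ.fiber.obj V.unop) :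
    F.map f ≫ germ Φ F V v = germ Φ F U (Φ.fiber.map f.unop v) :=
  colimit.w ((CategoryOfElements.π Φ.fiber).op ⋙ F)
    (CategoryOfElements.homMk ⟨V.unop, v⟩ ⟨U.unop, Φ.fiber.map f.unop v⟩ f.unop rfl).op

lemma germ_stalk_map {F G : Cᵒᵖ ⥤ D} (g : F ⟶ G) (U : Cᵒᵖ) (u : Φ.fiber.obj U.unop) :
    germ Φ F U u ≫ (stalk Φ).map g = g.app U ≫ germ Φ G U u :=
  ι_colimMap (Functor.whiskerLeft (CategoryOfElements.π Φ.fiber).op g) _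

lemma germ_stalk_map_assoc {F G : Cᵒᵖ ⥤ D} (g : F ⟶ G) (U : Cᵒᵖ) (u : Φ.fiber.obj U.unop)
    {T : D} (h : (stalk Φ).obj G ⟶ T) :
    germ Φ F U u ≫ (stalk Φ).map g ≫ h = g.app U ≫ germ Φ G U u ≫ h := by
  rw [← Category.assoc, germ_stalk_map, Category.assoc]

/-- The universal property of the stalk. -/
noncomputable def stalkDesc {F : Cᵒᵖ ⥤ D} {T : D}
    (φ : ∀ (U : Cᵒᵖ) (_ : Φ.fiber.obj U.unop), F.obj U ⟶ T)
    (hφ : ∀ ⦃U V : Cᵒᵖ⦄ (f : U ⟶ V) (v : Φ.fiber.obj V.unop),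
      F.map f ≫ φ V v = φ U (Φ.fiber.map f.unop v)) :
    (stalk Φ).obj F ⟶ T :=
  colimit.desc ((CategoryOfElements.π Φ.fiber).op ⋙ F)
    { pt := T
      ι :=
        { app := fun a => φ (op a.unop.1) a.unop.2
          naturality := fun a b f => by
            have h := hφ f.unop.1.op b.unop.2
            have e : Φ.fiber.map f.unop.1.op.unop b.unop.2 = a.unop.2 := f.unop.2
            rw [e] at h
            exact h.trans (Category.comp_id _).symm } }

lemma germ_stalkDesc {F : Cᵒᵖ ⥤ D} {T : D}
    (φ : ∀ (U : Cᵒᵖ) (_ : Φ.fiber.obj U.unop), F.obj U ⟶ T)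
    (hφ : ∀ ⦃U V : Cᵒᵖ⦄ (f : U ⟶ V) (v : Φ.fiber.obj V.unop),
      F.map f ≫ φ V v = φ U (Φ.fiber.map f.unop v)) (U : Cᵒᵖ) (u : Φ.fiber.obj U.unop) :
    germ Φ F U u ≫ stalkDesc Φ φ hφ = φ U u :=
  colimit.ι_desc _ _

variable [MonoidalCategory D] [∀ A : D, PreservesFilteredColimitsOfSize.{w, w} (tensorLeft A)]

instance (M : D) : PreservesColimitsOfShape Φ.fiber.Elementsᵒᵖ ((curriedTensor D).obj M) :=
  haveI : PreservesFilteredColimitsOfSize.{w, w} ((curriedTensor D).obj M) :=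
    inferInstanceAs (PreservesFilteredColimitsOfSize.{w, w} (tensorLeft M))
  Functor.Final.preservesColimitsOfShape_of_final (FinallySmall.fromFilteredFinalModel.{w} _) _

variable [SymmetricCategory D]

instance (M : D) : PreservesColimitsOfShape Φ.fiber.Elementsᵒᵖ ((curriedTensor D).flip.obj M) :=
  preservesColimitsOfShape_of_natIso (BraidedCategory.tensorLeftIsoTensorRight M)

/-- The tensor product of two stalks as the colimit of the tensor products of the sections. -/
noncomputable def stalkTensorIsColimit (F G : Cᵒᵖ ⥤ D) :
    IsColimit ((colimit.cocone ((CategoryOfElements.π Φ.fiber).op ⋙ F)).tensor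
      (colimit.cocone ((CategoryOfElements.π Φ.fiber).op ⋙ G))) :=
  (colimit.isColimit _).tensor (colimit.isColimit _)

/-- The Künneth morphism `F_Φ ⊗ G_Φ ⟶ (F ⊗ G)_Φ`. -/
noncomputable def stalkTensor (F G : Cᵒᵖ ⥤ D) :
    (stalk Φ).obj F ⊗ (stalk Φ).obj G ⟶ (stalk Φ).obj (F ⊗ G) :=
  (stalkTensorIsColimit Φ F G).desc
    (colimit.cocone ((CategoryOfElements.π Φ.fiber).op ⋙ (F ⊗ G)))

lemma germ_stalkTensor (F G : Cᵒᵖ ⥤ D) (U : Cᵒᵖ) (u : Φ.fiber.obj U.unop) :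
    pair (germ Φ F U u) (germ Φ G U u) ≫ stalkTensor Φ F G = germ Φ (F ⊗ G) U u :=
  (stalkTensorIsColimit Φ F G).fac _ (op ⟨U.unop, u⟩)

lemma germ_stalkTensor_assoc (F G : Cᵒᵖ ⥤ D) (U : Cᵒᵖ) (u : Φ.fiber.obj U.unop) {T : D}
    (h : (stalk Φ).obj (F ⊗ G) ⟶ T) :
    pair (germ Φ F U u) (germ Φ G U u) ≫ stalkTensor Φ F G ≫ h = germ Φ (F ⊗ G) U u ≫ h := by
  rw [← Category.assoc, germ_stalkTensor]

variable {Φ} in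
lemma stalk_tensor_hom_ext {F G : Cᵒᵖ ⥤ D} {T : D} {f g : (stalk Φ).obj F ⊗ (stalk Φ).obj G ⟶ T}
    (h : ∀ (U : Cᵒᵖ) (u : Φ.fiber.obj U.unop),
      pair (germ Φ F U u) (germ Φ G U u) ≫ f = pair (germ Φ F U u) (germ Φ G U u) ≫ g) : f = g :=
  (stalkTensorIsColimit Φ F G).hom_ext (by rintro ⟨⟨U, u⟩⟩; exact h (op U) u)

lemma stalkTensor_natural {F F' G G' : Cᵒᵖ ⥤ D} (φ : F ⟶ F') (ψ : G ⟶ G') :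
    ((stalk Φ).map φ ⊗ₘ (stalk Φ).map ψ) ≫ stalkTensor Φ F' G' =
      stalkTensor Φ F G ≫ (stalk Φ).map (φ ⊗ₘ ψ) := by
  refine stalk_tensor_hom_ext fun U u => ?_
  rw [pair_comp_assoc, germ_stalk_map, germ_stalk_map, ← app_pair_assoc, germ_stalkTensor,
    germ_stalkTensor_assoc, germ_stalk_map]

end Stalk

/-! ## The Godement triple -/

section Godement

variable {C : Type u} [Category.{v} C] [LocallySmall.{w} C] {J : GrothendieckTopology C}
  {X : Type w} (pt : X → GrothendieckTopology.Point.{w} J)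
  {D : Type u'} [Category.{v'} D] [HasFilteredColimitsOfSize.{w, w} D] [HasProducts.{w} D]

/-- The presheaf `T F = p_* p^* F`, with `(T F)(U) = ∏_{x ∈ X} ∏_{u ∈ x^*(U)} F_x`. -/
noncomputable def godementObj (F : Cᵒᵖ ⥤ D) : Cᵒᵖ ⥤ D where
  obj U := ∏ᶜ fun a : (Σ x : X, (pt x).fiber.obj U.unop) => (stalk (pt a.1)).obj F
  map {U V} f := Pi.lift fun a : (Σ x : X, (pt x).fiber.obj V.unop) =>
    Pi.π (fun a : (Σ x : X, (pt x).fiber.obj U.unop) => (stalk (pt a.1)).obj F)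
      ⟨a.1, (pt a.1).fiber.map f.unop a.2⟩
  map_id U := by
    refine Pi.hom_ext _ _ fun a => ?_
    rw [Pi.lift_π, unop_id, Functor.map_id_apply, Category.id_comp]
  map_comp f g := by
    refine Pi.hom_ext _ _ fun a => ?_
    rw [Pi.lift_π, Category.assoc, Pi.lift_π, Pi.lift_π, unop_comp, Functor.map_comp_apply]

/-- The projection of `∏_{x ∈ X} ∏_{u ∈ x^*(U)} F_x` to the factor with index `(x, u)`. -/
noncomputable def proj (F : Cᵒᵖ ⥤ D) (U : Cᵒᵖ) (x : X) (u : (pt x).fiber.obj U.unop) :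
    (godementObj pt F).obj U ⟶ (stalk (pt x)).obj F :=
  Pi.π (fun a : (Σ x : X, (pt x).fiber.obj U.unop) => (stalk (pt a.1)).obj F) ⟨x, u⟩

/-- The morphism to `∏_{x ∈ X} ∏_{u ∈ x^*(U)} F_x` with given components. -/
noncomputable def projLift {F : Cᵒᵖ ⥤ D} {U : Cᵒᵖ} {A : D}
    (f : ∀ (x : X) (_ : (pt x).fiber.obj U.unop), A ⟶ (stalk (pt x)).obj F) :
    A ⟶ (godementObj pt F).obj U :=
  Pi.lift fun a => f a.1 a.2

lemma projLift_proj {F : Cᵒᵖ ⥤ D} {U : Cᵒᵖ} {A : D}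
    (f : ∀ (x : X) (_ : (pt x).fiber.obj U.unop), A ⟶ (stalk (pt x)).obj F)
    (x : X) (u : (pt x).fiber.obj U.unop) : projLift pt f ≫ proj pt F U x u = f x u :=
  Pi.lift_π _ _

lemma projLift_proj_assoc {F : Cᵒᵖ ⥤ D} {U : Cᵒᵖ} {A B : D}
    (f : ∀ (x : X) (_ : (pt x).fiber.obj U.unop), A ⟶ (stalk (pt x)).obj F)
    (x : X) (u : (pt x).fiber.obj U.unop) (h : (stalk (pt x)).obj F ⟶ B) :
    projLift pt f ≫ proj pt F U x u ≫ h = f x u ≫ h := by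
  rw [← Category.assoc, projLift_proj]

variable {pt} in
lemma proj_hom_ext {F : Cᵒᵖ ⥤ D} {U : Cᵒᵖ} {A : D} {f g : A ⟶ (godementObj pt F).obj U}
    (h : ∀ (x : X) (u : (pt x).fiber.obj U.unop), f ≫ proj pt F U x u = g ≫ proj pt F U x u) :
    f = g :=
  Pi.hom_ext _ _ fun a => h a.1 a.2

lemma res_proj (F : Cᵒᵖ ⥤ D) {U V : Cᵒᵖ} (f : U ⟶ V) (x : X) (v : (pt x).fiber.obj V.unop) :
    (godementObj pt F).map f ≫ proj pt F V x v =
      proj pt F U x ((pt x).fiber.map f.unop v) :=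
  Pi.lift_π _ _

lemma res_proj_assoc (F : Cᵒᵖ ⥤ D) {U V : Cᵒᵖ} (f : U ⟶ V) (x : X) (v : (pt x).fiber.obj V.unop)
    {A : D} (h : (stalk (pt x)).obj F ⟶ A) :
    (godementObj pt F).map f ≫ proj pt F V x v ≫ h =
      proj pt F U x ((pt x).fiber.map f.unop v) ≫ h := by
  rw [← Category.assoc, res_proj]

/-- The morphism `T F ⟶ T G` induced by `φ : F ⟶ G`. -/
noncomputable def godementMap {F G : Cᵒᵖ ⥤ D} (φ : F ⟶ G) :
    godementObj pt F ⟶ godementObj pt G where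
  app U := projLift pt fun x u => proj pt F U x u ≫ (stalk (pt x)).map φ
  naturality U V f := proj_hom_ext fun x v => by
    rw [Category.assoc, Category.assoc, projLift_proj, res_proj, projLift_proj, res_proj_assoc]

lemma godementMap_proj {F G : Cᵒᵖ ⥤ D} (φ : F ⟶ G) (U : Cᵒᵖ) (x : X)
    (u : (pt x).fiber.obj U.unop) :
    (godementMap pt φ).app U ≫ proj pt G U x u = proj pt F U x u ≫ (stalk (pt x)).map φ := by
  rw [godementMap, projLift_proj]

lemma godementMap_proj_assoc {F G : Cᵒᵖ ⥤ D} (φ : F ⟶ G) (U : Cᵒᵖ) (x : X)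
    (u : (pt x).fiber.obj U.unop) {A : D} (h : (stalk (pt x)).obj G ⟶ A) :
    (godementMap pt φ).app U ≫ proj pt G U x u ≫ h =
      proj pt F U x u ≫ (stalk (pt x)).map φ ≫ h := by
  rw [← Category.assoc, godementMap_proj, Category.assoc]

/-- The unit of the triple. -/
noncomputable def godementUnit (F : Cᵒᵖ ⥤ D) : F ⟶ godementObj pt F where
  app U := projLift pt fun x u => germ (pt x) F U u
  naturality U V f := proj_hom_ext fun x v => by
    rw [Category.assoc, Category.assoc, projLift_proj, res_proj, projLift_proj, germ_res]

lemma godementUnit_proj (F : Cᵒᵖ ⥤ D) (U : Cᵒᵖ) (x : X) (u : (pt x).fiber.obj U.unop) :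
    (godementUnit pt F).app U ≫ proj pt F U x u = germ (pt x) F U u := by
  rw [godementUnit, projLift_proj]

lemma godementUnit_proj_assoc (F : Cᵒᵖ ⥤ D) (U : Cᵒᵖ) (x : X) (u : (pt x).fiber.obj U.unop)
    {A : D} (h : (stalk (pt x)).obj F ⟶ A) :
    (godementUnit pt F).app U ≫ proj pt F U x u ≫ h = germ (pt x) F U u ≫ h := by
  rw [← Category.assoc, godementUnit_proj]

/-- The counit `p^* p_* p^* F ⟶ p^* F` at `x ∈ X`. -/
noncomputable def stalkCounit (x : X) (F : Cᵒᵖ ⥤ D) :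
    (stalk (pt x)).obj (godementObj pt F) ⟶ (stalk (pt x)).obj F :=
  stalkDesc (pt x) (fun U u => proj pt F U x u) fun _ _ f u => res_proj pt F f x u

lemma germ_stalkCounit (x : X) (F : Cᵒᵖ ⥤ D) (U : Cᵒᵖ) (u : (pt x).fiber.obj U.unop) :
    germ (pt x) (godementObj pt F) U u ≫ stalkCounit pt x F = proj pt F U x u :=
  germ_stalkDesc (pt x) _ _ U u

lemma germ_stalkCounit_assoc (x : X) (F : Cᵒᵖ ⥤ D) (U : Cᵒᵖ) (u : (pt x).fiber.obj U.unop)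
    {A : D} (h : (stalk (pt x)).obj F ⟶ A) :
    germ (pt x) (godementObj pt F) U u ≫ stalkCounit pt x F ≫ h = proj pt F U x u ≫ h := by
  rw [← Category.assoc, germ_stalkCounit]

lemma stalkCounit_naturality (x : X) {F G : Cᵒᵖ ⥤ D} (φ : F ⟶ G) :
    (stalk (pt x)).map (godementMap pt φ) ≫ stalkCounit pt x G =
      stalkCounit pt x F ≫ (stalk (pt x)).map φ :=
  stalk_hom_ext fun U u => by
    rw [germ_stalk_map_assoc, germ_stalkCounit, germ_stalkCounit_assoc, godementMap_proj]

/-- The multiplication of the triple. -/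
noncomputable def godementMul (F : Cᵒᵖ ⥤ D) :
    godementObj pt (godementObj pt F) ⟶ godementObj pt F where
  app U := projLift pt fun x u => proj pt (godementObj pt F) U x u ≫ stalkCounit pt x F
  naturality U V f := proj_hom_ext fun x v => by
    rw [Category.assoc, Category.assoc, projLift_proj, res_proj, projLift_proj, res_proj_assoc]

lemma godementMul_proj (F : Cᵒᵖ ⥤ D) (U : Cᵒᵖ) (x : X) (u : (pt x).fiber.obj U.unop) :
    (godementMul pt F).app U ≫ proj pt F U x u =
      proj pt (godementObj pt F) U x u ≫ stalkCounit pt x F := by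
  rw [godementMul, projLift_proj]

lemma stalk_godementUnit (x : X) (F : Cᵒᵖ ⥤ D) :
    (stalk (pt x)).map (godementUnit pt F) ≫ stalkCounit pt x F = 𝟙 _ :=
  stalk_hom_ext fun U u => by
    rw [germ_stalk_map_assoc, germ_stalkCounit, godementUnit_proj, Category.comp_id]

lemma stalk_godementMul (x : X) (F : Cᵒᵖ ⥤ D) :
    (stalk (pt x)).map (godementMul pt F) ≫ stalkCounit pt x F =
      stalkCounit pt x (godementObj pt F) ≫ stalkCounit pt x F :=
  stalk_hom_ext fun U u => by
    rw [germ_stalk_map_assoc, germ_stalkCounit, germ_stalkCounit_assoc, godementMul_proj]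

/-- The Godement triple. -/
noncomputable def godementMonad : CategoryTheory.Monad (Cᵒᵖ ⥤ D) where
  obj F := godementObj pt F
  map φ := godementMap pt φ
  map_id F := by
    refine NatTrans.ext (funext fun U => proj_hom_ext fun x u => ?_)
    rw [godementMap_proj, CategoryTheory.Functor.map_id, Category.comp_id, NatTrans.id_app, Category.id_comp]
  map_comp φ ψ := by
    refine NatTrans.ext (funext fun U => proj_hom_ext fun x u => ?_)
    rw [godementMap_proj, CategoryTheory.Functor.map_comp, NatTrans.comp_app, Category.assoc, godementMap_proj,
      godementMap_proj_assoc]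
  η :=
    { app := fun F => godementUnit pt F
      naturality := fun F G φ => by
        refine NatTrans.ext (funext fun U => proj_hom_ext fun x u => ?_)
        change (φ.app U ≫ (godementUnit pt G).app U) ≫ proj pt G U x u =
          ((godementUnit pt F).app U ≫ (godementMap pt φ).app U) ≫ proj pt G U x u
        rw [Category.assoc, Category.assoc, godementUnit_proj, godementMap_proj,
          godementUnit_proj_assoc, germ_stalk_map] }
  μ :=
    { app := fun F => godementMul pt F
      naturality := fun F G φ => by
        refine NatTrans.ext (funext fun U => proj_hom_ext fun x u => ?_)
        change ((godementMap pt (godementMap pt φ)).app U ≫ (godementMul pt G).app U) ≫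
            proj pt G U x u =
          ((godementMul pt F).app U ≫ (godementMap pt φ).app U) ≫ proj pt G U x u
        rw [Category.assoc, Category.assoc, godementMul_proj, godementMap_proj,
          godementMap_proj_assoc, ← Category.assoc ((godementMul pt F).app U), godementMul_proj,
          stalkCounit_naturality, Category.assoc] }
  left_unit F := by
    refine NatTrans.ext (funext fun U => proj_hom_ext fun x u => ?_)
    change ((godementUnit pt (godementObj pt F)).app U ≫ (godementMul pt F).app U) ≫
      proj pt F U x u = 𝟙 _ ≫ proj pt F U x u
    rw [Category.assoc, godementMul_proj, godementUnit_proj_assoc, germ_stalkCounit,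
      Category.id_comp]
  right_unit F := by
    refine NatTrans.ext (funext fun U => proj_hom_ext fun x u => ?_)
    change ((godementMap pt (godementUnit pt F)).app U ≫ (godementMul pt F).app U) ≫
      proj pt F U x u = 𝟙 _ ≫ proj pt F U x u
    rw [Category.assoc, godementMul_proj, godementMap_proj_assoc, stalk_godementUnit,
      Category.id_comp, Category.comp_id]
  assoc F := by
    refine NatTrans.ext (funext fun U => proj_hom_ext fun x u => ?_)
    change ((godementMap pt (godementMul pt F)).app U ≫ (godementMul pt F).app U) ≫
      proj pt F U x u = ((godementMul pt (godementObj pt F)).app U ≫ (godementMul pt F).app U) ≫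
        proj pt F U x u
    rw [Category.assoc, Category.assoc, godementMul_proj, godementMap_proj_assoc,
      stalk_godementMul, ← Category.assoc ((godementMul pt (godementObj pt F)).app U),
      godementMul_proj, Category.assoc]

variable [MonoidalCategory D] [SymmetricCategory D]
  [∀ A : D, PreservesFilteredColimitsOfSize.{w, w} (tensorLeft A)]

/-- The Künneth morphism `T F ⊗ T G ⟶ T (F ⊗ G)`. -/
noncomputable def godementTensor (F G : Cᵒᵖ ⥤ D) :
    godementObj pt F ⊗ godementObj pt G ⟶ godementObj pt (F ⊗ G) where
  app U := projLift pt fun x u => pair (proj pt F U x u) (proj pt G U x u) ≫ stalkTensor (pt x) F G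
  naturality U V f := proj_hom_ext fun x v => by
    rw [Category.assoc, Category.assoc, projLift_proj, res_proj, projLift_proj, map_pair_assoc,
      res_proj, res_proj]

lemma godementTensor_proj (F G : Cᵒᵖ ⥤ D) (U : Cᵒᵖ) (x : X) (u : (pt x).fiber.obj U.unop) :
    (godementTensor pt F G).app U ≫ proj pt (F ⊗ G) U x u =
      pair (proj pt F U x u) (proj pt G U x u) ≫ stalkTensor (pt x) F G := by
  rw [godementTensor, projLift_proj]

lemma godementTensor_proj_assoc (F G : Cᵒᵖ ⥤ D) (U : Cᵒᵖ) (x : X) (u : (pt x).fiber.obj U.unop)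
    {A : D} (h : (stalk (pt x)).obj (F ⊗ G) ⟶ A) :
    (godementTensor pt F G).app U ≫ proj pt (F ⊗ G) U x u ≫ h =
      pair (proj pt F U x u) (proj pt G U x u) ≫ stalkTensor (pt x) F G ≫ h := by
  rw [← Category.assoc, godementTensor_proj, Category.assoc]

lemma stalkTensor_counit (F G : Cᵒᵖ ⥤ D) (x : X) :
    stalkTensor (pt x) (godementObj pt F) (godementObj pt G) ≫
        (stalk (pt x)).map (godementTensor pt F G) ≫ stalkCounit pt x (F ⊗ G) =
      (stalkCounit pt x F ⊗ₘ stalkCounit pt x G) ≫ stalkTensor (pt x) F G := by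
  refine stalk_tensor_hom_ext fun U u => ?_
  rw [germ_stalkTensor_assoc, germ_stalk_map_assoc, germ_stalkCounit, godementTensor_proj,
    pair_comp_assoc, germ_stalkCounit, germ_stalkCounit]

lemma godementTensor_natural {F F' G G' : Cᵒᵖ ⥤ D} (φ : F ⟶ F') (ψ : G ⟶ G') :
    (godementMap pt φ ⊗ₘ godementMap pt ψ) ≫ godementTensor pt F' G' =
      godementTensor pt F G ≫ godementMap pt (φ ⊗ₘ ψ) := by
  refine NatTrans.ext (funext fun U => proj_hom_ext fun x u => ?_)
  rw [NatTrans.comp_app, NatTrans.comp_app, Category.assoc, Category.assoc, godementTensor_proj,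
    godementMap_proj, app_pair_assoc, godementMap_proj, godementMap_proj, ← pair_comp_assoc,
    stalkTensor_natural, godementTensor_proj_assoc]

lemma godementUnit_tensor (F G : Cᵒᵖ ⥤ D) :
    (godementUnit pt F ⊗ₘ godementUnit pt G) ≫ godementTensor pt F G =
      godementUnit pt (F ⊗ G) := by
  refine NatTrans.ext (funext fun U => proj_hom_ext fun x u => ?_)
  rw [NatTrans.comp_app, Category.assoc, godementTensor_proj, app_pair_assoc, godementUnit_proj,
    godementUnit_proj, godementUnit_proj, germ_stalkTensor]

lemma godementMul_tensor (F G : Cᵒᵖ ⥤ D) :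
    (godementMul pt F ⊗ₘ godementMul pt G) ≫ godementTensor pt F G =
      godementTensor pt (godementObj pt F) (godementObj pt G) ≫
        godementMap pt (godementTensor pt F G) ≫ godementMul pt (F ⊗ G) := by
  refine NatTrans.ext (funext fun U => proj_hom_ext fun x u => ?_)
  rw [NatTrans.comp_app, NatTrans.comp_app, NatTrans.comp_app, Category.assoc, Category.assoc,
    Category.assoc, godementTensor_proj, godementMul_proj, app_pair_assoc, godementMul_proj,
    godementMul_proj, godementMap_proj_assoc, godementTensor_proj_assoc, ← pair_comp_assoc,
    ← stalkTensor_counit]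

end Godement

/-! ## The cosimplicial resolution of a triple -/

section Resolution

variable {E : Type u} [Category.{v} E] (T : CategoryTheory.Monad E)

/-- The iterates of a triple. -/
def iter : ℕ → (E ⥤ E)
  | 0 => 𝟭 E
  | n + 1 => iter n ⋙ T.toFunctor

/-- The monotone map `i ↦ f (i + 1)`. -/
def monoTail {a b : ℕ} (f : Fin (a + 1) →o Fin b) : Fin a →o Fin b where
  toFun i := f i.succ
  monotone' _ _ h := f.monotone (Fin.succ_le_succ_iff.2 h)

/-- The monotone map `i ↦ f i - 1`, for `f` not taking the value `0`. -/
def monoPred {a b : ℕ} (f : Fin a →o Fin (b + 1)) (h : ∀ i, f i ≠ 0) : Fin a →o Fin b where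
  toFun i := (f i).pred (h i)
  monotone' _ _ hij := Fin.pred_le_pred_iff.2 (f.monotone hij)

/-- Given the transformations `T^a ⟶ T^b` for monotone maps to `Fin b`, those for monotone maps to
`Fin (b + 1)`. -/
def iterMapAux (b : ℕ) (r : ∀ a : ℕ, (Fin a →o Fin b) → (iter T a ⟶ iter T b)) :
    ∀ a : ℕ, (Fin a →o Fin (b + 1)) → (iter T a ⟶ iter T (b + 1))
  | 0, f => r 0 (monoPred f fun i => i.elim0) ≫ Functor.whiskerLeft (iter T b) T.η
  | a + 1, f =>
    if h : ∀ i, f i ≠ 0 then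
      r (a + 1) (monoPred f h) ≫ Functor.whiskerLeft (iter T b) T.η
    else
      Functor.whiskerRight (iterMapAux b r a (monoTail f)) T.toFunctor ≫
        Functor.whiskerLeft (iter T b) T.μ

/-- The transformation `T^a ⟶ T^b` attached to a monotone map `f : Fin a → Fin b`: the copies of
`T` with indices in the fibre `f⁻¹ {j}` are multiplied to the copy with index `j`, and units are
inserted for empty fibres. The copy with index `0` is the outermost one. -/
def iterMap : ∀ b a : ℕ, (Fin a →o Fin b) → (iter T a ⟶ iter T b)
  | 0, 0, _ => 𝟙 _
  | 0, _ + 1, f => (f 0).elim0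
  | b + 1, a, f => iterMapAux T b (iterMap b) a f

/-- The morphism `h ≫ η`. -/
def raise {A : E} {b : ℕ} {Z : E} (h : A ⟶ (iter T b).obj Z) : A ⟶ (iter T (b + 1)).obj Z :=
  h ≫ T.η.app ((iter T b).obj Z)

/-- The morphism `T h ≫ μ`. -/
def extend {a b : ℕ} {Y Z : E} (h : (iter T a).obj Y ⟶ (iter T (b + 1)).obj Z) :
    (iter T (a + 1)).obj Y ⟶ (iter T (b + 1)).obj Z :=
  T.map h ≫ T.μ.app ((iter T b).obj Z)

lemma comp_raise {A B : E} {b : ℕ} {Z : E} (f : A ⟶ B) (h : B ⟶ (iter T b).obj Z) :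
    f ≫ raise T h = raise T (f ≫ h) := (Category.assoc _ _ _).symm

lemma unit_bind {A Y W : E} (f : A ⟶ Y) (h : Y ⟶ T.obj W) :
    (f ≫ T.η.app Y) ≫ T.map h ≫ T.μ.app W = f ≫ h := by
  have n : h ≫ T.η.app (T.obj W) = T.η.app Y ≫ T.map h := T.η.naturality h
  have u : T.η.app (T.obj W) ≫ T.μ.app W = 𝟙 (T.obj W) := T.left_unit W
  have e : T.η.app Y ≫ T.map h ≫ T.μ.app W = h :=
    (Category.assoc _ _ _).symm.trans ((congrArg (· ≫ T.μ.app W) n.symm).trans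
      ((Category.assoc _ _ _).trans ((congrArg (h ≫ ·) u).trans (Category.comp_id h))))
  exact (Category.assoc _ _ _).trans (congrArg (f ≫ ·) e)

lemma bind_bind {Y Z W : E} (h : Y ⟶ T.obj Z) (k : Z ⟶ T.obj W) :
    (T.map h ≫ T.μ.app Z) ≫ T.map k ≫ T.μ.app W =
      T.map (h ≫ T.map k ≫ T.μ.app W) ≫ T.μ.app W := by
  have n : T.map (T.map k) ≫ T.μ.app (T.obj W) = T.μ.app Z ≫ T.map k := T.μ.naturality k
  have s : T.map (T.μ.app W) ≫ T.μ.app W = T.μ.app (T.obj W) ≫ T.μ.app W := T.assoc W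
  have e : T.map (h ≫ T.map k ≫ T.μ.app W) = T.map h ≫ T.map (T.map k) ≫ T.map (T.μ.app W) :=
    (T.map_comp _ _).trans (congrArg _ (T.map_comp _ _))
  refine Eq.trans ?_ (congrArg (· ≫ T.μ.app W) e.symm)
  simp only [Category.assoc]
  refine congrArg (T.map h ≫ ·) ?_
  refine (Category.assoc _ _ _).symm.trans ((congrArg (· ≫ T.μ.app W) n.symm).trans ?_)
  exact (Category.assoc _ _ _).trans (congrArg (T.map (T.map k) ≫ ·) s.symm)

lemma raise_extend {A : E} {a b : ℕ} {Y Z : E} (f : A ⟶ (iter T a).obj Y)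
    (h : (iter T a).obj Y ⟶ (iter T (b + 1)).obj Z) : raise T f ≫ extend T h = f ≫ h :=
  unit_bind T f h

lemma extend_extend {a b c : ℕ} {Y Z W : E} (h : (iter T a).obj Y ⟶ (iter T (b + 1)).obj Z)
    (k : (iter T b).obj Z ⟶ (iter T (c + 1)).obj W) :
    extend T h ≫ extend T k = extend T (h ≫ extend T k) :=
  bind_bind T h k

lemma iterMap_pred {a b : ℕ} (f : Fin a →o Fin (b + 1)) (h : ∀ i, f i ≠ 0) (Z : E) :
    (iterMap T (b + 1) a f).app Z = raise T ((iterMap T b a (monoPred f h)).app Z) := by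
  cases a with
  | zero => rfl
  | succ a =>
    simp only [iterMap, iterMapAux]
    rw [dif_pos h]
    rfl

lemma iterMap_tail {a b : ℕ} (f : Fin (a + 1) →o Fin (b + 1)) (h : f 0 = 0) (Z : E) :
    (iterMap T (b + 1) (a + 1) f).app Z = extend T ((iterMap T (b + 1) a (monoTail f)).app Z) := by
  simp only [iterMap, iterMapAux]
  rw [dif_neg fun H => H 0 h]
  rfl

/-- A monotone map to `Fin (b + 1)` avoids `0` or sends `0` to `0`. -/
lemma avoids_or_hits {a b : ℕ} (f : Fin a →o Fin (b + 1)) :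
    (∀ i, f i ≠ 0) ∨ ∃ (a' : ℕ) (e : a = a' + 1), f (Fin.cast e.symm 0) = 0 := by
  cases a with
  | zero => exact Or.inl fun i => i.elim0
  | succ a =>
    by_cases h : f 0 = 0
    · exact Or.inr ⟨a, rfl, h⟩
    · exact Or.inl fun i hi => h (le_antisymm (hi ▸ f.monotone (Fin.zero_le i)) (Fin.zero_le _))

lemma iterMap_id : ∀ (a : ℕ) (Z : E), (iterMap T a a OrderHom.id).app Z = 𝟙 _
  | 0, Z => rfl
  | a + 1, Z => by
    rw [iterMap_tail T _ rfl, iterMap_pred T (monoTail OrderHom.id) fun i => Fin.succ_ne_zero i]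
    have e : monoPred (monoTail (OrderHom.id (α := Fin (a + 1)))) (fun i => Fin.succ_ne_zero i) =
        OrderHom.id := by
      ext i
      rfl
    rw [e, iterMap_id a]
    have h : raise T (𝟙 ((iter T a).obj Z)) = T.η.app ((iter T a).obj Z) := Category.id_comp _
    rw [h]
    exact T.right_unit _

lemma iterMap_comp : ∀ (c a b : ℕ) (f : Fin a →o Fin b) (g : Fin b →o Fin c) (Z : E),
    (iterMap T c a (g.comp f)).app Z = (iterMap T b a f).app Z ≫ (iterMap T c b g).app Z
  | 0, 0, 0, f, g, Z => (Category.id_comp _).symm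
  | 0, a, b + 1, f, g, Z => (g 0).elim0
  | 0, a + 1, 0, f, g, Z => (f 0).elim0
  | c + 1, a, b, f, g, Z => by
    obtain hg | ⟨b', rfl, hg⟩ := avoids_or_hits g
    · have hgf : ∀ i, (g.comp f) i ≠ 0 := fun i => hg (f i)
      have e : monoPred (g.comp f) hgf = (monoPred g hg).comp f := rfl
      rw [iterMap_pred T g hg, iterMap_pred T (g.comp f) hgf, e, iterMap_comp c a b, comp_raise]
    · obtain hf | ⟨a', rfl, hf⟩ := avoids_or_hits f
      · have e : g.comp f = (monoTail g).comp (monoPred f hf) := by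
          ext i
          exact congrArg (fun t => (g t).1) (Fin.succ_pred _ (hf i)).symm
        rw [iterMap_pred T f hf, iterMap_tail T g hg, raise_extend, e, iterMap_comp (c + 1) a b']
      · have h : (g.comp f) 0 = 0 := (congrArg g hf).trans hg
        have e : monoTail (g.comp f) = g.comp (monoTail f) := rfl
        rw [iterMap_tail T f hf, iterMap_tail T (g.comp f) h, e,
          iterMap_comp (c + 1) a' (b' + 1), iterMap_tail T g hg, extend_extend]
  termination_by c a b => (c, a + b)

/-- The cosimplicial resolution `n ↦ T^{n+1}` of a triple. -/
def resolution : SimplexCategory ⥤ E ⥤ E where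
  obj n := iter T (n.len + 1)
  map f := iterMap T _ _ f.toOrderHom
  map_id n := by
    refine NatTrans.ext (funext fun Z => ?_)
    exact iterMap_id T _ Z
  map_comp f g := by
    refine NatTrans.ext (funext fun Z => ?_)
    exact iterMap_comp T _ _ _ f.toOrderHom g.toOrderHom Z

/-- The coaugmentation `id ⟶ T^•`. -/
def coaugmentation (Z : E) : (Functor.const SimplexCategory).obj Z ⟶ (resolution T).flip.obj Z where
  app n := (iterMap T (n.len + 1) 0 ⟨Fin.elim0, fun i => i.elim0⟩).app Z
  naturality n m f := by
    refine (Category.id_comp _).trans ?_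
    have e : f.toOrderHom.comp ⟨Fin.elim0, fun i => i.elim0⟩ = ⟨Fin.elim0, fun i => i.elim0⟩ := by
      ext i
      exact i.elim0
    have h := iterMap_comp T _ _ _ ⟨Fin.elim0, fun i => i.elim0⟩ f.toOrderHom Z
    rw [e] at h
    exact h

variable [MonoidalCategory E] (κ : ∀ F G : E, T.obj F ⊗ T.obj G ⟶ T.obj (F ⊗ G))

/-- The Künneth morphisms of the iterates of a triple, for given Künneth morphisms of the triple. -/
def iterTensor : ∀ (n : ℕ) (F G : E), (iter T n).obj F ⊗ (iter T n).obj G ⟶ (iter T n).obj (F ⊗ G)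
  | 0, _, _ => 𝟙 _
  | n + 1, F, G => κ ((iter T n).obj F) ((iter T n).obj G) ≫ T.map (iterTensor n F G)

/-- Compatibility of the Künneth morphisms `κ` with morphisms and with the unit and the
multiplication of the triple `T`. -/
structure IsTensorCompatible : Prop where
  natural {F F' G G' : E} (φ : F ⟶ F') (ψ : G ⟶ G') :
    (T.map φ ⊗ₘ T.map ψ) ≫ κ F' G' = κ F G ≫ T.map (φ ⊗ₘ ψ)
  unit (F G : E) : (T.η.app F ⊗ₘ T.η.app G) ≫ κ F G = T.η.app (F ⊗ G)
  mul (F G : E) : (T.μ.app F ⊗ₘ T.μ.app G) ≫ κ F G =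
    κ (T.obj F) (T.obj G) ≫ T.map (κ F G) ≫ T.μ.app (F ⊗ G)

variable {T κ}

lemma raise_tensor (H : IsTensorCompatible T κ) {b : ℕ} {A B F G : E} (f : A ⟶ (iter T b).obj F)
    (g : B ⟶ (iter T b).obj G) :
    (raise T f ⊗ₘ raise T g) ≫ iterTensor T κ (b + 1) F G =
      raise T ((f ⊗ₘ g) ≫ iterTensor T κ b F G) := by
  have n : iterTensor T κ b F G ≫ T.η.app ((iter T b).obj (F ⊗ G)) =
    T.η.app ((iter T b).obj F ⊗ (iter T b).obj G) ≫ T.map (iterTensor T κ b F G) :=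
      T.η.naturality (iterTensor T κ b F G)
  change ((f ≫ T.η.app _) ⊗ₘ (g ≫ T.η.app _)) ≫ κ _ _ ≫ T.map _ = ((f ⊗ₘ g) ≫ _) ≫ T.η.app _
  rw [← tensorHom_comp_tensorHom, Category.assoc, Category.assoc, n, ← H.unit]
  exact congrArg _ (Category.assoc _ _ _).symm

lemma bind_tensor (H : IsTensorCompatible T κ) {Y Y' F G V W : E} (f : Y ⟶ T.obj F)
    (g : Y' ⟶ T.obj G) (t : F ⊗ G ⟶ W) (s : Y ⊗ Y' ⟶ V) (k : V ⟶ T.obj W)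
    (h : (f ⊗ₘ g) ≫ κ F G ≫ T.map t = s ≫ k) :
    ((T.map f ≫ T.μ.app F) ⊗ₘ (T.map g ≫ T.μ.app G)) ≫ κ F G ≫ T.map t =
      (κ Y Y' ≫ T.map s) ≫ T.map k ≫ T.μ.app W := by
  have n : T.map (T.map t) ≫ T.μ.app W = T.μ.app (F ⊗ G) ≫ T.map t := T.μ.naturality t
  have h' := congrArg T.map h
  rw [T.map_comp, T.map_comp, T.map_comp] at h'
  have m := H.mul F G
  calc
    _ = (T.map f ⊗ₘ T.map g) ≫ ((T.μ.app F ⊗ₘ T.μ.app G) ≫ κ F G) ≫ T.map t := by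
      rw [← tensorHom_comp_tensorHom, Category.assoc, Category.assoc]
    _ = (T.map f ⊗ₘ T.map g) ≫ (κ (T.obj F) (T.obj G) ≫ T.map (κ F G) ≫ T.μ.app (F ⊗ G)) ≫
        T.map t := congrArg (fun z => (T.map f ⊗ₘ T.map g) ≫ z ≫ T.map t) m
    _ = ((T.map f ⊗ₘ T.map g) ≫ κ (T.obj F) (T.obj G)) ≫ T.map (κ F G) ≫
        T.μ.app (F ⊗ G) ≫ T.map t := by simp only [Category.assoc]
    _ = (κ Y Y' ≫ T.map (f ⊗ₘ g)) ≫ T.map (κ F G) ≫ T.map (T.map t) ≫ T.μ.app W := by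
      rw [H.natural, n]
    _ = κ Y Y' ≫ (T.map (f ⊗ₘ g) ≫ T.map (κ F G) ≫ T.map (T.map t)) ≫ T.μ.app W := by
      simp only [Category.assoc]
    _ = κ Y Y' ≫ (T.map s ≫ T.map k) ≫ T.μ.app W :=
      congrArg (fun z => κ Y Y' ≫ z ≫ T.μ.app W) h'
    _ = _ := by simp only [Category.assoc]

lemma iterMap_tensor (H : IsTensorCompatible T κ) :
    ∀ (b a : ℕ) (f : Fin a →o Fin b) (F G : E),
      ((iterMap T b a f).app F ⊗ₘ (iterMap T b a f).app G) ≫ iterTensor T κ b F G =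
        iterTensor T κ a F G ≫ (iterMap T b a f).app (F ⊗ G)
  | 0, 0, f, F, G => by
    change (𝟙 F ⊗ₘ 𝟙 G) ≫ 𝟙 (F ⊗ G) = 𝟙 (F ⊗ G) ≫ 𝟙 (F ⊗ G)
    rw [id_tensorHom_id]
  | 0, a + 1, f, F, G => (f 0).elim0
  | b + 1, a, f, F, G => by
    obtain hf | ⟨a', rfl, hf⟩ := avoids_or_hits f
    · rw [iterMap_pred T f hf, iterMap_pred T f hf, iterMap_pred T f hf, raise_tensor H,
        iterMap_tensor H b a, comp_raise]
    · rw [iterMap_tail T f hf, iterMap_tail T f hf, iterMap_tail T f hf]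
      exact bind_tensor H _ _ _ _ _ (iterMap_tensor H (b + 1) a' _ F G)
  termination_by b a => (b, a)

end Resolution

/-! ## The hypercohomology of a presheaf -/

section Hypercohomology

variable {C : Type u} [Category.{v} C] [LocallySmall.{w} C] {J : GrothendieckTopology C}
  {X : Type w} (pt : X → GrothendieckTopology.Point.{w} J)
  {D : Type u'} [Category.{v'} D] [HasFilteredColimitsOfSize.{w, w} D] [HasProducts.{w} D]

/-- The Godement resolution `F ↦ (U ↦ (p ↦ (T^{p+1} F)(U)))`. -/
noncomputable def godementResolution : (Cᵒᵖ ⥤ D) ⥤ (Cᵒᵖ ⥤ SimplexCategory ⥤ D) :=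
  (resolution (godementMonad pt)).flip ⋙ flipFunctor _ _ _

/-- The coaugmentation `F(U) ⟶ (G^• F)(U)`. -/
noncomputable def godementCoaugmentation (F : Cᵒᵖ ⥤ D) :
    F ⋙ const ⟶ (godementResolution pt).obj F where
  app U :=
    { app := fun n => ((coaugmentation (godementMonad pt) F).app n).app U
      naturality := fun _ _ f =>
        congrArg (fun t => t.app U) ((coaugmentation (godementMonad pt) F).naturality f) }
  naturality _ _ f := NatTrans.ext (funext fun n =>
    ((coaugmentation (godementMonad pt) F).app n).naturality f)

section

variable (s : (SimplexCategory ⥤ D) ⥤ D)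

/-- The hypercohomology presheaf `(H_X F)(U) = s (G^• F)(U)`. -/
noncomputable def hyper : (Cᵒᵖ ⥤ D) ⥤ (Cᵒᵖ ⥤ D) :=
  godementResolution pt ⋙ (Functor.whiskeringRight _ _ _).obj s

/-- The morphism `ρ_F : F ⟶ H_X F`. -/
noncomputable def rho (lam : 𝟭 D ⟶ const ⋙ s) (F : Cᵒᵖ ⥤ D) : F ⟶ (hyper pt s).obj F :=
  Functor.whiskerLeft F lam ≫ Functor.whiskerRight (godementCoaugmentation pt F) s

end

variable [MonoidalCategory D] [SymmetricCategory D]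
  [∀ A : D, PreservesFilteredColimitsOfSize.{w, w} (tensorLeft A)]

lemma godement_isTensorCompatible :
    IsTensorCompatible (godementMonad (D := D) pt) (godementTensor pt) where
  natural φ ψ := godementTensor_natural pt φ ψ
  unit F G := godementUnit_tensor pt F G
  mul F G := godementMul_tensor pt F G

/-- The Künneth morphism `T^n F ⊗ T^n G ⟶ T^n (F ⊗ G)`. -/
noncomputable def godementIterTensor (n : ℕ) (F G : Cᵒᵖ ⥤ D) :
    (iter (godementMonad pt) n).obj F ⊗ (iter (godementMonad pt) n).obj G ⟶
      (iter (godementMonad pt) n).obj (F ⊗ G) :=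
  iterTensor (godementMonad pt) (godementTensor pt) n F G

/-- The Künneth morphism `(G^• F)(U) ⊗ (G^• G)(U) ⟶ (G^• (F ⊗ G))(U)`. -/
noncomputable def resolutionTensor (F G : Cᵒᵖ ⥤ D) :
    (godementResolution pt).obj F ⊗ (godementResolution pt).obj G ⟶
      (godementResolution pt).obj (F ⊗ G) where
  app U :=
    { app := fun n => (godementIterTensor pt (n.len + 1) F G).app U
      naturality := fun _ _ f => congrArg (fun t => t.app U)
        (iterMap_tensor (godement_isTensorCompatible pt) _ _ f.toOrderHom F G) }
  naturality _ _ f := NatTrans.ext (funext fun n =>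
    (godementIterTensor pt (n.len + 1) F G).naturality f)

/-- The Künneth morphism `H_X F ⊗ H_X G ⟶ H_X (F ⊗ G)`. -/
noncomputable def hyperTensor (s : (SimplexCategory ⥤ D) ⥤ D) [s.LaxMonoidal] (F G : Cᵒᵖ ⥤ D) :
    (hyper pt s).obj F ⊗ (hyper pt s).obj G ⟶ (hyper pt s).obj (F ⊗ G) where
  app U := Functor.LaxMonoidal.μ s _ _ ≫ s.map ((resolutionTensor pt F G).app U)
  naturality U V f := by
    have h := congrArg s.map ((resolutionTensor pt F G).naturality f)
    rw [s.map_comp, s.map_comp] at h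
    have m := Functor.LaxMonoidal.μ_natural s (((godementResolution pt).obj F).map f)
      (((godementResolution pt).obj G).map f)
    refine (Category.assoc _ _ _).symm.trans ((congrArg (· ≫ _) m).trans ?_)
    refine (Category.assoc _ _ _).trans (Eq.trans ?_ (Category.assoc _ _ _).symm)
    exact congrArg _ h

end Hypercohomology

/-! ## Sheaves of algebras over a sheaf of operads -/

section Algebras

variable {C : Type u} [Category.{v} C] {J : GrothendieckTopology C}
  {D : Type u'} [Category.{v'} D] [MonoidalCategory D] [SymmetricCategory D] {z : Prop}

/-- The presheaf `U ↦ F(U) ⊗ ⋯ ⊗ F(U)`, with `l` factors. -/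
def tensPresheaf (l : ℕ) (F : Cᵒᵖ ⥤ D) : Cᵒᵖ ⥤ D where
  obj U := tens l (fun _ => F.obj U)
  map f := tensMap l (fun _ => F.map f)
  map_id U := by
    rw [F.map_id]
    exact tensMap_id l _
  map_comp f g := by
    rw [F.map_comp]
    exact tensMap_comp l _ _

/-- The presheaf `U ↦ P(U)(l)`. -/
abbrev operations (P : Sheaf J (Operad D z)) (l : Arity z) : Cᵒᵖ ⥤ D :=
  P.obj ⋙ Operad.arityFunctor D z l

/-- A sheaf of `P`-algebras, for a sheaf of operads `P`: a sheaf `A` with morphisms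
`P(U)(l) ⊗ A(U) ⊗ ⋯ ⊗ A(U) ⟶ A(U)`, natural in `U`, making every `A(U)` a `P(U)`-algebra. -/
structure SheafAlgebra (P : Sheaf J (Operad D z)) where
  /-- the underlying sheaf -/
  sheaf : Sheaf J D
  /-- the structure morphisms -/
  act (l : Arity z) : operations P l ⊗ tensPresheaf l.1 sheaf.obj ⟶ sheaf.obj
  isAlgebra (U : Cᵒᵖ) : (P.obj.obj U).IsAlgebra (sheaf.obj.obj U) (fun l => (act l).app U)

namespace SheafAlgebra

variable {P : Sheaf J (Operad D z)}

/-- A morphism of sheaves is a morphism of `P`-algebras if it commutes with the structure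
morphisms. -/
def IsHom (A B : SheafAlgebra P) (f : A.sheaf ⟶ B.sheaf) : Prop :=
  ∀ (l : Arity z) (U : Cᵒᵖ), (A.act l).app U ≫ f.hom.app U =
    ((P.obj.obj U).obj l ◁ tensMap l.1 (fun _ => f.hom.app U)) ≫ (B.act l).app U

/-- Morphisms of sheaves of `P`-algebras. -/
@[ext]
structure Hom (A B : SheafAlgebra P) where
  /-- the underlying morphism of sheaves -/
  hom : A.sheaf ⟶ B.sheaf
  isHom : IsHom A B hom

instance : Category (SheafAlgebra P) where
  Hom := Hom
  id A :=
    { hom := 𝟙 A.sheaf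
      isHom := fun l U => by
        change (A.act l).app U ≫ 𝟙 _ = (_ ◁ tensMap l.1 (fun _ => 𝟙 _)) ≫ (A.act l).app U
        rw [tensMap_id, whiskerLeft_id]
        exact (Category.comp_id _).trans (Category.id_comp _).symm }
  comp {A B E} f g :=
    { hom := f.hom ≫ g.hom
      isHom := fun l U => by
        have hf := f.isHom l U
        have hg := g.isHom l U
        change (A.act l).app U ≫ f.hom.hom.app U ≫ g.hom.hom.app U =
          (_ ◁ tensMap l.1 (fun _ => f.hom.hom.app U ≫ g.hom.hom.app U)) ≫ (E.act l).app U
        rw [tensMap_comp, MonoidalCategory.whiskerLeft_comp]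
        refine Eq.trans ?_ (Category.assoc _ _ _).symm
        refine Eq.trans ?_ (congrArg _ hg)
        refine (Category.assoc _ _ _).symm.trans ((congrArg (· ≫ _) hf).trans ?_)
        exact Category.assoc _ _ _ }

variable (P) in
/-- The functor forgetting the algebra structure. -/
@[simps]
def forget : SheafAlgebra P ⥤ Sheaf J D where
  obj A := A.sheaf
  map f := Hom.hom f

end SheafAlgebra

end Algebras

/-! ## Equivalences of sheaves, compatible pairs -/

section Sheaves

variable {C : Type u} [Category.{v} C] {J : GrothendieckTopology C}
  {D : Type u'} [Category.{v'} D]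

/-- Global equivalences: the morphisms of sheaves `f` with `f(U)` in `E` for all objects `U`. -/
def globalEquivalences (J : GrothendieckTopology C) (E : MorphismProperty D) :
    MorphismProperty (Sheaf J D) :=
  fun _ _ f => ∀ U : Cᵒᵖ, E (f.hom.app U)

variable [LocallySmall.{w} C] {X : Type w} (pt : X → GrothendieckTopology.Point.{w} J)
  [HasFilteredColimitsOfSize.{w, w} D]

/-- Local equivalences: the morphisms of sheaves `f` with `f_x` in `E` for all `x ∈ X`. -/
def localEquivalences (E : MorphismProperty D) : MorphismProperty (Sheaf J D) :=
  fun _ _ f => ∀ x : X, E ((stalk (pt x)).map f.hom)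

variable [HasProducts.{w} D] [HasFiniteProducts D]

/-- The hypercohomology presheaf of every sheaf is a sheaf. -/
def HypercohomologyIsSheaf (s : (SimplexCategory ⥤ D) ⥤ D) : Prop :=
  ∀ F : Sheaf J D, Presheaf.IsSheaf J ((hyper pt s).obj F.obj)

/-- The hypercohomology sheaf `H_X F`. -/
noncomputable def hyperSheaf {s : (SimplexCategory ⥤ D) ⥤ D} (h : HypercohomologyIsSheaf pt s)
    (F : Sheaf J D) : Sheaf J D :=
  ⟨(hyper pt s).obj F.obj, h F⟩

/-- The morphism of sheaves `ρ_F : F ⟶ H_X F`. -/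
noncomputable def sheafRho (M : DescentStructure D) (h : HypercohomologyIsSheaf pt M.s)
    (F : Sheaf J D) : F ⟶ hyperSheaf pt h F :=
  ⟨rho pt M.s M.lam F.obj⟩

/-- The site (with its set of points) and the descent category `D` are compatible: the sheaves with
values in `D`, with global and local equivalences, form a right Cartan-Eilenberg category and every
`ρ_F : F ⟶ H_X F` is a CE-fibrant model. -/
structure IsCompatible (M : DescentStructure D) (h : HypercohomologyIsSheaf pt M.s) : Prop where
  isRightCartanEilenberg :
    IsRightCartanEilenberg (globalEquivalences J M.E) (localEquivalences pt M.E)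
  isCEFibrantModel (F : Sheaf J D) :
    IsCEFibrantModel (globalEquivalences J M.E) (localEquivalences pt M.E)
      ((globalEquivalences J M.E).Q.map (sheafRho pt M h F))

end Sheaves

/-! ## The hypercohomology of a sheaf of algebras -/

section HyperAlgebra

variable {C : Type u} [Category.{v} C] [LocallySmall.{w} C] {J : GrothendieckTopology C}
  {X : Type w} (pt : X → GrothendieckTopology.Point.{w} J)
  {D : Type u'} [Category.{v'} D] [MonoidalCategory D] [SymmetricCategory D]
  [HasFiniteProducts D] [HasFilteredColimitsOfSize.{w, w} D] [HasProducts.{w} D]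
  [∀ A : D, PreservesFilteredColimitsOfSize.{w, w} (tensorLeft A)]
  (M : MonoidalDescentStructure D)

/-- The Künneth morphism `H_X F ⊗ ⋯ ⊗ H_X F ⟶ H_X (F ⊗ ⋯ ⊗ F)`, with `l` factors. -/
noncomputable def hyperTensPower (F : Cᵒᵖ ⥤ D) :
    ∀ l : ℕ, tensPresheaf l ((hyper pt M.s).obj F) ⟶ (hyper pt M.s).obj (tensPresheaf l F)
  | 0 => rho pt M.s M.lam (𝟙_ (Cᵒᵖ ⥤ D))
  | l + 1 => hyperTensPower F l ▷ (hyper pt M.s).obj F ≫ hyperTensor pt M.s (tensPresheaf l F) F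

variable {z : Prop} {P : Sheaf J (Operad D z)}

/-- The structure morphisms `P(l) ⊗ H_X A ⊗ ⋯ ⊗ H_X A ⟶ H_X A`, obtained from
`ρ : P(l) ⟶ H_X P(l)`, the Künneth morphisms of `H_X`, and the image under `H_X` of the structure
morphisms of `A`. -/
noncomputable def hyperAct (A : SheafAlgebra P) (l : Arity z) :
    operations P l ⊗ tensPresheaf l.1 ((hyper pt M.s).obj A.sheaf.obj) ⟶
      (hyper pt M.s).obj A.sheaf.obj :=
  (rho pt M.s M.lam (operations P l) ⊗ₘ hyperTensPower pt M A.sheaf.obj l.1) ≫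
    hyperTensor pt M.s (operations P l) (tensPresheaf l.1 A.sheaf.obj) ≫
      (hyper pt M.s).map (A.act l)

/-- The structure morphisms on the hypercohomology of `A` satisfy the axioms of an algebra. -/
def HyperIsAlgebra (A : SheafAlgebra P) : Prop :=
  ∀ U : Cᵒᵖ, (P.obj.obj U).IsAlgebra (((hyper pt M.s).obj A.sheaf.obj).obj U)
    (fun l => (hyperAct pt M A l).app U)

/-- The sheaf of `P`-algebras `H_X A`. -/
noncomputable def hyperAlgebra (h : HypercohomologyIsSheaf pt M.s) (A : SheafAlgebra P)
    (hA : HyperIsAlgebra pt M A) : SheafAlgebra P where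
  sheaf := hyperSheaf pt h A.sheaf
  act l := hyperAct pt M A l
  isAlgebra U := hA U

/-- The morphism `ρ_A` as a morphism of sheaves of `P`-algebras. -/
noncomputable def algebraRho (h : HypercohomologyIsSheaf pt M.s) (A : SheafAlgebra P)
    (hA : HyperIsAlgebra pt M A)
    (hρ : SheafAlgebra.IsHom A (hyperAlgebra pt M h A hA)
      (sheafRho pt M.toDescentStructure h A.sheaf)) :
    A ⟶ hyperAlgebra pt M h A hA :=
  ⟨sheafRho pt M.toDescentStructure h A.sheaf, hρ⟩

end HyperAlgebra

/-- Global equivalences of sheaves of `P`-algebras. -/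
abbrev globalAlgebraEquivalences {C : Type u} [Category.{v} C] {J : GrothendieckTopology C}
    {D : Type u'} [Category.{v'} D] [MonoidalCategory D] [SymmetricCategory D] {z : Prop}
    (P : Sheaf J (Operad D z)) (E : MorphismProperty D) : MorphismProperty (SheafAlgebra P) :=
  (globalEquivalences J E).inverseImage (SheafAlgebra.forget P)

/-- Local equivalences of sheaves of `P`-algebras. -/
abbrev localAlgebraEquivalences {C : Type u} [Category.{v} C] [LocallySmall.{w} C]
    {J : GrothendieckTopology C} {X : Type w} (pt : X → GrothendieckTopology.Point.{w} J)
    {D : Type u'} [Category.{v'} D] [MonoidalCategory D] [SymmetricCategory D]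
    [HasFilteredColimitsOfSize.{w, w} D] {z : Prop}
    (P : Sheaf J (Operad D z)) (E : MorphismProperty D) : MorphismProperty (SheafAlgebra P) :=
  (localEquivalences pt E).inverseImage (SheafAlgebra.forget P)

end GodementOperads

open GodementOperads

universe v₁ u₁ v₂ u₂

/-! The argument has two independent halves, joined only at the end.

Algebra structure. The functor `H_X` on presheaves is lax symmetric monoidal, and `ρ : id ⟶ H_X` is
a monoidal transformation. For the Godement triple this comes from stalks: tensor products commute
with filtered colimits, so stalks are compatible with tensor products (`stalkTensor`), and products
only need their projections. The structure passes to the iterates `T^n`, to the cosimplicial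
resolution, and through the lax symmetric monoidal simple functor. For every `U` one thus has a
monoidal transformation `rhoAt` from evaluation at `U` to `F ↦ (H_X F)(U)`. A monoidal
transformation `τ : E ⟶ H` turns an operation `X ⊗ A ⊗ ⋯ ⊗ A ⟶ Y` into `E X ⊗ H A ⊗ ⋯ ⊗ H A ⟶ H Y`
(`transport`), and this respects permutations, units and composition. The structure morphisms of
`H_X A` are the transports of those of `A` (`transport_rhoAt_internalAct`), so the axioms for `H_X
A` are images of the axioms for `A`. For this the objectwise axioms must first be read as equations
between presheaf morphisms. This is possible because evaluations are strong monoidal and jointly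
faithful (`internalize` and the lemmas on `internalAct`).

Cartan–Eilenberg structure. It suffices to have a resolvent functor: an endofunctor `R` with `id ⟶
R` a weak equivalence, taking weak equivalences to strong ones, and with `R M ⟶ R R M` strong
(`isCEFibrantModel_of_resolvent`). Compatibility makes `H_X` such a functor on sheaves: `ρ` is
invertible in the weak localization, a weak isomorphism of CE-fibrant objects is a strong
isomorphism, and saturation of `E` turns invertibility in a localization back into membership in the
class. These conditions concern single morphisms of sheaves, so they lift to algebras as soon as
`H_X` and `ρ` do. No comparison of the localizations of algebras with those of sheaves is needed. -/

namespace GodementOperads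

/-! ### Lax monoidal functors and finite tensor products -/

section LaxTensor

open Functor.LaxMonoidal

variable {V : Type u₁} [Category.{v₁} V] [MonoidalCategory V]
  {W : Type u₂} [Category.{v₂} W] [MonoidalCategory W]

/-! ### The external product of morphisms to values of a lax monoidal functor -/

section Box

variable (G : V ⥤ W) [G.LaxMonoidal]

/-- The product `x ⊗ y ⟶ G (X ⊗ Y)` of two morphisms `x ⟶ G X` and `y ⟶ G Y`. -/
def box {x y : W} {X Y : V} (f : x ⟶ G.obj X) (g : y ⟶ G.obj Y) : x ⊗ y ⟶ G.obj (X ⊗ Y) :=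
  (f ⊗ₘ g) ≫ μ G X Y

variable {G}

/-- The rules for `box` absorb morphisms on either side into its two arguments and move it past the
coherence isomorphisms. All later inductions on finite tensor products use lax monoidal functors
mainly through these rules, and so avoid explicit diagrams with `μ`. -/
lemma tensorHom_box {x y x' y' : W} {X Y : V} (p : x' ⟶ x) (q : y' ⟶ y) (f : x ⟶ G.obj X)
    (g : y ⟶ G.obj Y) : (p ⊗ₘ q) ≫ box G f g = box G (p ≫ f) (q ≫ g) := by
  rw [box, box, tensorHom_comp_tensorHom_assoc]

lemma tensorHom_box_assoc {x y x' y' z : W} {X Y : V} (p : x' ⟶ x) (q : y' ⟶ y) (f : x ⟶ G.obj X)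
    (g : y ⟶ G.obj Y) (h : G.obj (X ⊗ Y) ⟶ z) :
    (p ⊗ₘ q) ≫ box G f g ≫ h = box G (p ≫ f) (q ≫ g) ≫ h := by
  rw [← tensorHom_box, Category.assoc]

lemma whiskerRight_box {x x' y : W} {X Y : V} (p : x' ⟶ x) (f : x ⟶ G.obj X)
    (g : y ⟶ G.obj Y) : p ▷ y ≫ box G f g = box G (p ≫ f) g := by
  rw [← tensorHom_id, tensorHom_box, Category.id_comp]

lemma whiskerLeft_box {x y y' : W} {X Y : V} (q : y' ⟶ y) (f : x ⟶ G.obj X)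
    (g : y ⟶ G.obj Y) : x ◁ q ≫ box G f g = box G f (q ≫ g) := by
  rw [← id_tensorHom, tensorHom_box, Category.id_comp]

lemma box_map {x y : W} {X Y X' Y' : V} (f : x ⟶ G.obj X) (g : y ⟶ G.obj Y) (a : X ⟶ X')
    (b : Y ⟶ Y') : box G f g ≫ G.map (a ⊗ₘ b) = box G (f ≫ G.map a) (g ≫ G.map b) := by
  rw [box, box, Category.assoc, ← μ_natural, tensorHom_comp_tensorHom_assoc]

lemma box_map_assoc {x y z : W} {X Y X' Y' : V} (f : x ⟶ G.obj X) (g : y ⟶ G.obj Y) (a : X ⟶ X')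
    (b : Y ⟶ Y') (h : G.obj (X' ⊗ Y') ⟶ z) :
    box G f g ≫ G.map (a ⊗ₘ b) ≫ h = box G (f ≫ G.map a) (g ≫ G.map b) ≫ h := by
  rw [← box_map, Category.assoc]

lemma box_map_whiskerRight {x y : W} {X Y X' : V} (f : x ⟶ G.obj X) (g : y ⟶ G.obj Y)
    (a : X ⟶ X') : box G f g ≫ G.map (a ▷ Y) = box G (f ≫ G.map a) g := by
  rw [← tensorHom_id, box_map, G.map_id, Category.comp_id]

lemma box_map_whiskerRight_assoc {x y z : W} {X Y X' : V} (f : x ⟶ G.obj X) (g : y ⟶ G.obj Y)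
    (a : X ⟶ X') (h : G.obj (X' ⊗ Y) ⟶ z) :
    box G f g ≫ G.map (a ▷ Y) ≫ h = box G (f ≫ G.map a) g ≫ h := by
  rw [← box_map_whiskerRight, Category.assoc]

lemma box_map_whiskerLeft {x y : W} {X Y Y' : V} (f : x ⟶ G.obj X) (g : y ⟶ G.obj Y)
    (b : Y ⟶ Y') : box G f g ≫ G.map (X ◁ b) = box G f (g ≫ G.map b) := by
  rw [← id_tensorHom, box_map, G.map_id, Category.comp_id]

lemma box_map_whiskerLeft_assoc {x y z : W} {X Y Y' : V} (f : x ⟶ G.obj X) (g : y ⟶ G.obj Y)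
    (b : Y ⟶ Y') (h : G.obj (X ⊗ Y') ⟶ z) :
    box G f g ≫ G.map (X ◁ b) ≫ h = box G f (g ≫ G.map b) ≫ h := by
  rw [← box_map_whiskerLeft, Category.assoc]

lemma box_associator {x y z : W} {X Y Z : V} (f : x ⟶ G.obj X) (g : y ⟶ G.obj Y)
    (h : z ⟶ G.obj Z) : box G (box G f g) h ≫ G.map (α_ X Y Z).hom =
      (α_ x y z).hom ≫ box G f (box G g h) := by
  have e : box G f g ⊗ₘ h = ((f ⊗ₘ g) ⊗ₘ h) ≫ μ G X Y ▷ G.obj Z := by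
    rw [← tensorHom_id, tensorHom_comp_tensorHom, Category.comp_id, box]
  have e' : f ⊗ₘ box G g h = (f ⊗ₘ (g ⊗ₘ h)) ≫ G.obj X ◁ μ G Y Z := by
    rw [← id_tensorHom, tensorHom_comp_tensorHom, Category.comp_id, box]
  rw [box, e, box, e', Category.assoc, Category.assoc, associativity,
    associator_naturality_assoc, Category.assoc]

lemma box_associator_assoc {x y z w : W} {X Y Z : V} (f : x ⟶ G.obj X) (g : y ⟶ G.obj Y)
    (h : z ⟶ G.obj Z) (k : G.obj (X ⊗ Y ⊗ Z) ⟶ w) :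
    box G (box G f g) h ≫ G.map (α_ X Y Z).hom ≫ k =
      (α_ x y z).hom ≫ box G f (box G g h) ≫ k := by
  rw [← Category.assoc, box_associator, Category.assoc]

lemma box_associator_inv {x y z : W} {X Y Z : V} (f : x ⟶ G.obj X) (g : y ⟶ G.obj Y)
    (h : z ⟶ G.obj Z) : box G f (box G g h) ≫ G.map (α_ X Y Z).inv =
      (α_ x y z).inv ≫ box G (box G f g) h := by
  rw [Iso.eq_inv_comp, ← box_associator_assoc, ← G.map_comp, Iso.hom_inv_id, G.map_id,
    Category.comp_id]

lemma box_associator_inv_assoc {x y z w : W} {X Y Z : V} (f : x ⟶ G.obj X) (g : y ⟶ G.obj Y)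
    (h : z ⟶ G.obj Z) (k : G.obj ((X ⊗ Y) ⊗ Z) ⟶ w) :
    box G f (box G g h) ≫ G.map (α_ X Y Z).inv ≫ k =
      (α_ x y z).inv ≫ box G (box G f g) h ≫ k := by
  rw [← Category.assoc, box_associator_inv, Category.assoc]

lemma box_ε_leftUnitor {x : W} {X : V} (f : x ⟶ G.obj X) :
    box G (ε G) f ≫ G.map (λ_ X).hom = (λ_ x).hom ≫ f := by
  rw [box, Category.assoc, ← tensorUnit_whiskerLeft_comp_leftUnitor_hom,
    leftUnitor_naturality]

lemma box_ε_rightUnitor_inv {x : W} {X : V} (f : x ⟶ G.obj X) :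
    f ≫ G.map (ρ_ X).inv = (ρ_ x).inv ≫ box G f (ε G) := by
  rw [box, tensorHom_ε_comp_μ, rightUnitor_naturality_assoc, Iso.inv_hom_id_assoc]

lemma box_ε_leftUnitor_inv {x : W} {X : V} (f : x ⟶ G.obj X) :
    f ≫ G.map (λ_ X).inv = (λ_ x).inv ≫ box G (ε G) f := by
  rw [box, ε_tensorHom_comp_μ, leftUnitor_naturality_assoc, Iso.inv_hom_id_assoc]

lemma box_app {H : V ⥤ W} [H.LaxMonoidal] (τ : G ⟶ H) [NatTrans.IsMonoidal τ] {x y : W} {X Y : V}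
    (f : x ⟶ G.obj X) (g : y ⟶ G.obj Y) :
    box G f g ≫ τ.app (X ⊗ Y) = box H (f ≫ τ.app X) (g ≫ τ.app Y) := by
  rw [box, box, Category.assoc, NatTrans.IsMonoidal.tensor, tensorHom_comp_tensorHom_assoc]

lemma box_app_assoc {H : V ⥤ W} [H.LaxMonoidal] (τ : G ⟶ H) [NatTrans.IsMonoidal τ] {x y z : W}
    {X Y : V} (f : x ⟶ G.obj X) (g : y ⟶ G.obj Y) (h : H.obj (X ⊗ Y) ⟶ z) :
    box G f g ≫ τ.app (X ⊗ Y) ≫ h = box H (f ≫ τ.app X) (g ≫ τ.app Y) ≫ h := by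
  rw [← box_app, Category.assoc]

end Box

section BoxBraided

variable [BraidedCategory V] [BraidedCategory W] {G : V ⥤ W} [G.LaxBraided]

lemma box_braiding {x y : W} {X Y : V} (f : x ⟶ G.obj X) (g : y ⟶ G.obj Y) :
    box G f g ≫ G.map (β_ X Y).hom = (β_ x y).hom ≫ box G g f := by
  rw [box, box, Category.assoc, Functor.LaxBraided.braided,
    BraidedCategory.braiding_naturality_assoc]

/-- The interchange is a composite of associators and one braiding, so the rules for those two
suffice. This is the first of the facts needed for the shuffle in the associativity axiom. -/
lemma box_tensorμ {x y x' y' : W} {X Y X' Y' : V} (f : x ⟶ G.obj X) (g : y ⟶ G.obj Y)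
    (f' : x' ⟶ G.obj X') (g' : y' ⟶ G.obj Y') :
    box G (box G f g) (box G f' g') ≫ G.map (tensorμ X Y X' Y') =
      tensorμ x y x' y' ≫ box G (box G f f') (box G g g') := by
  simp only [tensorμ, G.map_comp, box_associator_assoc, box_map_whiskerLeft_assoc,
    box_associator_inv, box_map_whiskerRight, box_braiding, box_associator,
    ← whiskerLeft_box, ← whiskerRight_box, Category.assoc]

end BoxBraided

/-! ### Iterated tensor products -/

/-- The morphism `G (A 0) ⊗ ⋯ ⊗ G (A (n - 1)) ⟶ G (A 0 ⊗ ⋯ ⊗ A (n - 1))` of a lax monoidal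
functor. -/
def laxTens (G : V ⥤ W) [G.LaxMonoidal] :
    (n : ℕ) → (A : Fin n → V) → (tens n (fun i => G.obj (A i)) ⟶ G.obj (tens n A))
  | 0, _ => ε G
  | n + 1, A => box G (laxTens G n (fun i => A i.castSucc)) (𝟙 (G.obj (A (Fin.last n))))

instance isIso_tensMap : ∀ (n : ℕ) {A B : Fin n → V} (f : ∀ i, A i ⟶ B i) [∀ i, IsIso (f i)],
    IsIso (tensMap n f)
  | 0, _, _, _, _ => inferInstanceAs (IsIso (𝟙 (𝟙_ V)))
  | n + 1, _, _, f, _ => by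
    have := isIso_tensMap n (fun i => f i.castSucc)
    exact inferInstanceAs (IsIso (tensMap n (fun i => f i.castSucc) ⊗ₘ f (Fin.last n)))

instance isIso_box (G : V ⥤ W) [G.Monoidal] {x y : W} {X Y : V} (f : x ⟶ G.obj X)
    (g : y ⟶ G.obj Y) [IsIso f] [IsIso g] : IsIso (box G f g) :=
  inferInstanceAs (IsIso ((f ⊗ₘ g) ≫ μ G X Y))

/-- Used for evaluation functors: it identifies objectwise tensor powers with those of the functor
category, and lets the comparison morphism be cancelled when equations are checked objectwise. -/
instance isIso_laxTens (G : V ⥤ W) [G.Monoidal] :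
    ∀ (n : ℕ) (A : Fin n → V), IsIso (laxTens G n A)
  | 0, _ => inferInstanceAs (IsIso (ε G))
  | n + 1, A => by
    have := isIso_laxTens G n (fun i => A i.castSucc)
    exact isIso_box G _ _

section

variable (G : V ⥤ W) [G.LaxMonoidal]

lemma laxTens_natural : ∀ (n : ℕ) {A B : Fin n → V} (f : ∀ i, A i ⟶ B i),
    tensMap n (fun i => G.map (f i)) ≫ laxTens G n B = laxTens G n A ≫ G.map (tensMap n f)
  | 0, _, _, _ => by
    change 𝟙 _ ≫ ε G = ε G ≫ G.map (𝟙 _)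
    simp
  | n + 1, A, B, f => by
    refine (tensorHom_box _ _ _ _).trans (Eq.trans ?_ (box_map _ _ _ _).symm)
    rw [laxTens_natural n]
    simp

lemma laxTens_monoidal {G H : V ⥤ W} [G.LaxMonoidal] [H.LaxMonoidal] (τ : G ⟶ H)
    [NatTrans.IsMonoidal τ] : ∀ (n : ℕ) (A : Fin n → V),
    tensMap n (fun i => τ.app (A i)) ≫ laxTens H n A = laxTens G n A ≫ τ.app (tens n A)
  | 0, _ => by
    change 𝟙 _ ≫ ε H = ε G ≫ τ.app (𝟙_ V)
    simp
  | n + 1, A => by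
    refine (tensorHom_box _ _ _ _).trans (Eq.trans ?_ (box_app _ _ _).symm)
    rw [laxTens_monoidal τ n]
    simp

lemma laxTens_tensCongr (n : ℕ) {A B : Fin n → V} (h : ∀ i, A i = B i)
    (h' : ∀ i, G.obj (A i) = G.obj (B i)) :
    laxTens G n A ≫ G.map (tensCongr n h) = tensCongr n h' ≫ laxTens G n B := by
  rw [tensCongr, ← laxTens_natural]
  simp only [eqToHom_map]
  rfl

lemma laxTens_tensCast {a b : ℕ} (h : a = b) (A : Fin b → V) :
    laxTens G b A ≫ G.map (tensCast h A) =
      tensCast h (fun i => G.obj (A i)) ≫ laxTens G a (fun i => A (Fin.cast h i)) := by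
  subst h
  exact (congrArg _ (G.map_id _)).trans ((Category.comp_id _).trans (Category.id_comp _).symm)

lemma laxTens_tensAppend (a : ℕ) : ∀ (b : ℕ) (A : Fin (a + b) → V),
    laxTens G (a + b) A ≫ G.map (tensAppend a b A) =
      tensAppend a b (fun i => G.obj (A i)) ≫
        box G (laxTens G a (fun i => A (Fin.castAdd b i)))
          (laxTens G b (fun j => A (Fin.natAdd a j)))
  | 0, A => box_ε_rightUnitor_inv _
  | b + 1, A => by
    -- The inductive step is isolated for arbitrary objects and morphisms. The families indexed by
    -- `Fin` then no longer occur, and rewriting meets no dependent types. The later inductions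
    -- proceed in the same way.
    have h : ∀ {x y z u : W} {X Y Z U : V} {T : x ⟶ G.obj X} {p : X ⟶ Y ⊗ Z}
        {q : x ⟶ y ⊗ z} {Ty : y ⟶ G.obj Y} {Tz : z ⟶ G.obj Z} (k : u ⟶ G.obj U),
        T ≫ G.map p = q ≫ box G Ty Tz →
        box G T k ≫ G.map (p ▷ U ≫ (α_ Y Z U).hom) =
          (q ▷ u ≫ (α_ y z u).hom) ≫ box G Ty (box G Tz k) := by
      intro x y z u X Y Z U T p q Ty Tz k h
      rw [G.map_comp, box_map_whiskerRight_assoc, h, ← whiskerRight_box, Category.assoc,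
        box_associator, Category.assoc]
    exact h _ (laxTens_tensAppend a b _)

/-- Collecting all factors at once agrees with collecting each block and then the blocks. The
induction on the number of blocks peels off the last one, using compatibility with casts, with
`tensAppend` and with reindexing. -/
lemma laxTens_tensSplit : ∀ (n : ℕ) (m : Fin n → ℕ) (A : Fin (∑ i, m i) → V),
    laxTens G (∑ i, m i) A ≫ G.map (tensSplit n m A) =
      tensSplit n m (fun i => G.obj (A i)) ≫
        tensMap n (fun i => laxTens G (m i) (fun j => A (finSigmaFinEquiv ⟨i, j⟩))) ≫
          laxTens G n (fun i => tens (m i) (fun j => A (finSigmaFinEquiv ⟨i, j⟩)))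
  | 0, m, A => (laxTens_tensCast G _ A).trans (congrArg _ (Category.id_comp _).symm)
  | n + 1, m, A => by
    have h : ∀ {x x₁ y z y₁ y₂ z₁ : W} {X X₁ Y Z Y₁ Z₁ : V} {T : x ⟶ G.obj X} {c : X ⟶ X₁}
        {c' : x ⟶ x₁} {T₁ : x₁ ⟶ G.obj X₁} {p : X₁ ⟶ Y ⊗ Z} {p' : x₁ ⟶ y ⊗ z} {Ty : y ⟶ G.obj Y}
        {Tz : z ⟶ G.obj Z} {f : Y ⟶ Y₁} {f' : y ⟶ y₁} {t : y₁ ⟶ y₂} {Ty' : y₂ ⟶ G.obj Y₁}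
        {g : Z ⟶ Z₁} {g' : z ⟶ z₁} {Tz' : z₁ ⟶ G.obj Z₁},
        T ≫ G.map c = c' ≫ T₁ → T₁ ≫ G.map p = p' ≫ box G Ty Tz →
        Ty ≫ G.map f = f' ≫ t ≫ Ty' → Tz ≫ G.map g = g' ≫ Tz' →
        T ≫ G.map (c ≫ p ≫ (f ⊗ₘ g)) = (c' ≫ p' ≫ (f' ⊗ₘ g')) ≫ (t ⊗ₘ Tz') ≫
          box G Ty' (𝟙 _) := by
      intro x x₁ y z y₁ y₂ z₁ X X₁ Y Z Y₁ Z₁ T c c' T₁ p p' Ty Tz f f' t Ty' g g' Tz' h₁ h₂ h₃ h₄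
      rw [G.map_comp, G.map_comp, reassoc_of% h₁, reassoc_of% h₂, box_map, h₃, h₄,
        tensorHom_box, Category.comp_id, Category.assoc, Category.assoc, tensorHom_box]
    refine h (laxTens_tensCast G _ A) (laxTens_tensAppend G _ _ _) ?_
      (laxTens_tensCongr G _ _ _)
    rw [G.map_comp, ← Category.assoc, laxTens_tensSplit n, Category.assoc, Category.assoc,
      ← laxTens_natural, Category.assoc, ← Category.assoc (tensMap _ _), ← tensMap_comp,
      ← Category.assoc (tensMap _ _) (tensMap _ _), ← tensMap_comp]
    -- The recursive call indexes block `i` among the first `n` blocks; `tensCongr` renames it to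
    -- block `i.castSucc` among `n + 1`. The two positions in the total sum have the same value as
    -- natural numbers.
    have e (i : Fin n) := laxTens_tensCongr G (m i.castSucc) (A := fun j =>
      A (Fin.cast (Fin.sum_univ_castSucc m).symm (Fin.castAdd (m (Fin.last n))
        (finSigmaFinEquiv ⟨i, j⟩)))) (B := fun j => A (finSigmaFinEquiv ⟨i.castSucc, j⟩))
      (fun j => congrArg A (by
        apply Fin.ext
        simp [finSigmaFinEquiv_apply])) (fun j => congrArg (fun t => G.obj (A t)) (by
        apply Fin.ext
        simp [finSigmaFinEquiv_apply]))
    exact congrArg (fun t => _ ≫ tensMap n t ≫ _) (funext e)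

end

section

variable [BraidedCategory V] [BraidedCategory W] (G : V ⥤ W) [G.LaxBraided]

lemma laxTens_tensZip : ∀ (n : ℕ) (A B : Fin n → V),
    box G (laxTens G n A) (laxTens G n B) ≫ G.map (tensZip n A B) =
      tensZip n (fun i => G.obj (A i)) (fun i => G.obj (B i)) ≫
        tensMap n (fun i => μ G (A i) (B i)) ≫ laxTens G n (fun i => A i ⊗ B i)
  | 0, A, B => (box_ε_leftUnitor _).trans (congrArg _ (Category.id_comp _).symm)
  | n + 1, A, B => by
    have h : ∀ {x y z z' : W} {X Y Z X' Y' : V} {f : x ⟶ G.obj X} {g : y ⟶ G.obj Y}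
        {p : X ⊗ Y ⟶ Z} {p' : x ⊗ y ⟶ z} {t : z ⟶ z'} {k : z' ⟶ G.obj Z},
        box G f g ≫ G.map p = p' ≫ t ≫ k →
        box G (box G f (𝟙 (G.obj X'))) (box G g (𝟙 (G.obj Y'))) ≫
            G.map (tensorμ X X' Y Y' ≫ p ▷ (X' ⊗ Y')) =
          (tensorμ x (G.obj X') y (G.obj Y') ≫ p' ▷ (G.obj X' ⊗ G.obj Y')) ≫
            (t ⊗ₘ μ G X' Y') ≫ box G k (𝟙 _) := by
      intro x y z z' X Y Z X' Y' f g p p' t k h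
      have e : box G (𝟙 (G.obj X')) (𝟙 (G.obj Y')) = μ G X' Y' := by simp [box]
      rw [G.map_comp, ← Category.assoc, box_tensorμ, Category.assoc, box_map_whiskerRight, h,
        tensorHom_box, Category.comp_id, Category.assoc, whiskerRight_box, e]
    exact h (laxTens_tensZip n _ _)

lemma tensZip_natural : ∀ (n : ℕ) {A A' B B' : Fin n → V} (f : ∀ i, A i ⟶ A' i)
    (g : ∀ i, B i ⟶ B' i), (tensMap n f ⊗ₘ tensMap n g) ≫ tensZip n A' B' =
      tensZip n A B ≫ tensMap n (fun i => f i ⊗ₘ g i)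
  | 0, _, _, _, _, _, _ => by
    change (𝟙 (𝟙_ V) ⊗ₘ 𝟙 (𝟙_ V)) ≫ (λ_ (𝟙_ V)).hom = (λ_ (𝟙_ V)).hom ≫ 𝟙 (𝟙_ V)
    simp
  | n + 1, A, A', B, B', f, g => by
    have h : ∀ {X X' Y Y' Z Z' X₁ X₁' Y₁ Y₁' : V} {a : X ⟶ X'} {b : Y ⟶ Y'} {p : X ⊗ Y ⟶ Z}
        {p' : X' ⊗ Y' ⟶ Z'} {t : Z ⟶ Z'} {f : X₁ ⟶ X₁'} {g : Y₁ ⟶ Y₁'},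
        (a ⊗ₘ b) ≫ p' = p ≫ t →
        ((a ⊗ₘ f) ⊗ₘ (b ⊗ₘ g)) ≫ tensorμ X' X₁' Y' Y₁' ≫ p' ▷ (X₁' ⊗ Y₁') =
          (tensorμ X X₁ Y Y₁ ≫ p ▷ (X₁ ⊗ Y₁)) ≫ (t ⊗ₘ (f ⊗ₘ g)) := by
      intro X X' Y Y' Z Z' X₁ X₁' Y₁ Y₁' a b p p' t f g h
      rw [← Category.assoc, tensorμ_natural, Category.assoc, Category.assoc, ← tensorHom_id,
        ← tensorHom_id, tensorHom_comp_tensorHom, tensorHom_comp_tensorHom, h, Category.comp_id,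
        Category.id_comp]
    exact h (tensZip_natural n _ _)

/-- Only naturality in the operad factors is needed here. The algebra factors are handled blockwise
by `laxTens_tensShuffle`. -/
lemma tensShuffle_natural {X X' : V} (x : X ⟶ X') (n : ℕ) {B B' : Fin n → V}
    (f : ∀ i, B i ⟶ B' i) (m : Fin n → ℕ) (A : Fin (∑ i, m i) → V) :
    ((x ⊗ₘ tensMap n f) ▷ tens (∑ i, m i) A) ≫ tensShuffle X' n B' m A =
      tensShuffle X n B m A ≫ (x ⊗ₘ tensMap n (fun i => f i ▷ _)) := by
  have h := tensZip_natural n f (fun i => 𝟙 (tens (m i) (fun j => A (finSigmaFinEquiv ⟨i, j⟩))))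
  simp only [tensMap_id, tensorHom_id] at h
  rw [tensShuffle, tensShuffle, ← tensorHom_id, associator_naturality_assoc, Category.assoc,
    ← id_tensorHom, ← id_tensorHom X, tensorHom_comp_tensorHom, tensorHom_comp_tensorHom,
    Category.comp_id, Category.id_comp, tensorHom_id, ← whisker_exchange_assoc, h,
    Category.assoc]

/-- This is the compatibility behind associativity of transported algebras. The shuffle is an
associator, a splitting into blocks and a zip, and each is treated by its own lemma. Naturality of
the zip then merges the block comparisons with the morphisms `μ`. -/
lemma laxTens_tensShuffle {x : W} {X : V} (f : x ⟶ G.obj X) (n : ℕ) (B : Fin n → V)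
    (m : Fin n → ℕ) (A : Fin (∑ i, m i) → V) :
    box G (box G f (laxTens G n B)) (laxTens G (∑ i, m i) A) ≫ G.map (tensShuffle X n B m A) =
      tensShuffle x n (fun i => G.obj (B i)) m (fun i => G.obj (A i)) ≫
        box G f (tensMap n (fun i => box G (𝟙 (G.obj (B i)))
          (laxTens G (m i) (fun j => A (finSigmaFinEquiv ⟨i, j⟩)))) ≫ laxTens G n _) := by
  have h := tensZip_natural n (fun i => 𝟙 (G.obj (B i)))
    (fun i => laxTens G (m i) (fun j => A (finSigmaFinEquiv ⟨i, j⟩)))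
  rw [tensMap_id, id_tensorHom] at h
  have key : box G (laxTens G n B) (laxTens G (∑ i, m i) A ≫ G.map (tensSplit n m A)) ≫
      G.map (tensZip n B (fun i => tens (m i) (fun j => A (finSigmaFinEquiv ⟨i, j⟩)))) =
      tens n (fun i => G.obj (B i)) ◁ tensSplit n m (fun i => G.obj (A i)) ≫
        tensZip n (fun i => G.obj (B i))
          (fun i => tens (m i) (fun j => G.obj (A (finSigmaFinEquiv ⟨i, j⟩)))) ≫
        tensMap n (fun i => box G (𝟙 (G.obj (B i)))
          (laxTens G (m i) (fun j => A (finSigmaFinEquiv ⟨i, j⟩)))) ≫ laxTens G n _ := by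
    rw [laxTens_tensSplit, ← whiskerLeft_box, ← whiskerLeft_box, Category.assoc, Category.assoc,
      laxTens_tensZip, reassoc_of% h, ← Category.assoc (tensMap _ _), ← tensMap_comp]
    rfl
  rw [tensShuffle, tensShuffle, G.map_comp, box_associator_assoc, box_map_whiskerLeft,
    G.map_comp, ← Category.assoc (box _ _ _), box_map_whiskerLeft, key, Category.assoc,
    whiskerLeft_box, Category.assoc]

lemma tensExtract_of_eq_last (n : ℕ) (A : Fin (n + 2) → V) (k : Fin (n + 2))
    (h : k = Fin.last (n + 1)) : tensExtract (n + 1) A k =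
      (tensCongr (n + 1) (fun j => congrArg A (by rw [h, Fin.succAbove_last])) ⊗ₘ
        eqToHom (congrArg A h.symm)) :=
  dif_pos h

lemma tensExtract_of_ne_last (n : ℕ) (A : Fin (n + 2) → V) (k : Fin (n + 2))
    (h : ¬ k = Fin.last (n + 1)) : tensExtract (n + 1) A k =
      tensExtract n (fun j => A j.castSucc) (k.castPred h) ▷ A (Fin.last (n + 1)) ≫
        (α_ _ _ _).hom ≫ _ ◁ (β_ _ _).hom ≫ (α_ _ _ _).inv ≫
          ((tensCongr n (fun j => congrArg A (by
              rw [← Fin.castSucc_succAbove_castSucc, Fin.castSucc_castPred])) ⊗ₘ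
            eqToHom (congrArg A (by
              apply Fin.ext
              have hk : k.1 < n + 1 := Fin.val_lt_last h
              simp [Fin.succAbove, Fin.lt_def, Nat.not_lt.2 (Nat.lt_succ_iff.1 hk)]))) ⊗ₘ
            eqToHom (congrArg A (Fin.castSucc_castPred k h))) :=
  dif_neg h

/-- If the extracted factor is the last one, only identifications of objects occur. Otherwise it is
extracted from the initial part and then exchanged with the last factor by one braiding, which a lax
braided functor respects. -/
lemma laxTens_tensExtract : ∀ (n : ℕ) (A : Fin (n + 1) → V) (k : Fin (n + 1)),
    laxTens G (n + 1) A ≫ G.map (tensExtract n A k) =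
      tensExtract n (fun i => G.obj (A i)) k ≫
        box G (laxTens G n (fun j => A (k.succAbove j))) (𝟙 (G.obj (A k)))
  | 0, A, k => by
    -- With both ends of the equality of objects replaced by variables, `subst` removes the
    -- `eqToHom`; this is impossible for the expressions `A k` themselves.
    have h : ∀ {x : W} {X Y Y' : V} {f : x ⟶ G.obj X} (h : Y = Y') (h' : G.obj Y = G.obj Y'),
        box G f (𝟙 (G.obj Y)) ≫ G.map (X ◁ eqToHom h) =
          x ◁ eqToHom h' ≫ box G f (𝟙 (G.obj Y')) := by
      intro x X Y Y' f h h'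
      subst h
      simp
    exact h _ _
  | n + 1, A, k => by
    by_cases hk : k = Fin.last (n + 1)
    · have h : ∀ {x x' : W} {X X' Y Y' : V} {f : x ⟶ G.obj X} {p : X ⟶ X'} {p' : x ⟶ x'}
          {f' : x' ⟶ G.obj X'}
          (h : Y = Y') (h' : G.obj Y = G.obj Y'), f ≫ G.map p = p' ≫ f' →
          box G f (𝟙 (G.obj Y)) ≫ G.map (p ⊗ₘ eqToHom h) =
            (p' ⊗ₘ eqToHom h') ≫ box G f' (𝟙 (G.obj Y')) := by
        intro x x' X X' Y Y' f p p' f' h h' e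
        subst h
        rw [box_map, tensorHom_box, e]
        simp
      rw [tensExtract_of_eq_last n _ k hk, tensExtract_of_eq_last n _ k hk]
      exact h _ _ (laxTens_tensCongr G (n + 1) _ _)
    · have h : ∀ {x y y' : W} {X Y Y' U U' Z Z' : V} {T : x ⟶ G.obj X} {p : X ⟶ Y ⊗ U}
          {q : x ⟶ y ⊗ G.obj U} {Ty : y ⟶ G.obj Y} {f : Y ⟶ Y'} {f' : y ⟶ y'} {T' : y' ⟶ G.obj Y'}
          (h₁ : Z = Z') (h₁' : G.obj Z = G.obj Z') (h₂ : U = U') (h₂' : G.obj U = G.obj U'),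
          T ≫ G.map p = q ≫ box G Ty (𝟙 _) → Ty ≫ G.map f = f' ≫ T' →
          box G T (𝟙 (G.obj Z)) ≫ G.map (p ▷ Z ≫ (α_ _ _ _).hom ≫ _ ◁ (β_ _ _).hom ≫
              (α_ _ _ _).inv ≫ ((f ⊗ₘ eqToHom h₁) ⊗ₘ eqToHom h₂)) =
            (q ▷ G.obj Z ≫ (α_ _ _ _).hom ≫ _ ◁ (β_ _ _).hom ≫
              (α_ _ _ _).inv ≫ ((f' ⊗ₘ eqToHom h₁') ⊗ₘ eqToHom h₂')) ≫
                box G (box G T' (𝟙 _)) (𝟙 _) := by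
        intro x y y' X Y Y' U U' Z Z' T p q Ty f f' T' h₁ h₁' h₂ h₂' e e'
        subst h₁ h₂
        simp only [G.map_comp, box_map_whiskerRight_assoc, e, box_associator_assoc,
          box_map_whiskerLeft_assoc, box_braiding, box_associator_inv_assoc, box_map, e',
          Category.assoc, ← whiskerRight_box, ← whiskerLeft_box]
        simp [whiskerRight_box]
      rw [tensExtract_of_ne_last n _ k hk, tensExtract_of_ne_last n _ k hk]
      exact h _ _ _ _ (laxTens_tensExtract n _ _) (laxTens_tensCongr G n _ _)

/-- A permutation is built by repeatedly extracting the image of the last index, so the case of one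
extraction gives the induction. It yields equivariance of transported operations. -/
lemma laxTens_tensPerm : ∀ {a b : ℕ} (e : Fin a ≃ Fin b) (A : Fin b → V),
    laxTens G b A ≫ G.map (tensPerm e A) =
      tensPerm e (fun i => G.obj (A i)) ≫ laxTens G a (fun i => A (e i))
  | 0, 0, _, _ => by
    exact (congrArg _ (G.map_id _)).trans ((Category.comp_id _).trans (Category.id_comp _).symm)
  | 0, _ + 1, e, _ => (e.symm 0).elim0
  | _ + 1, 0, e, _ => (e 0).elim0
  | a + 1, b + 1, e, A => by
    have h : ∀ {x y y' : W} {X Y Y' U : V} {T : x ⟶ G.obj X} {p : X ⟶ Y ⊗ U}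
        {q : x ⟶ y ⊗ G.obj U} {Ty : y ⟶ G.obj Y} {f : Y ⟶ Y'} {f' : y ⟶ y'} {T' : y' ⟶ G.obj Y'},
        T ≫ G.map p = q ≫ box G Ty (𝟙 _) → Ty ≫ G.map f = f' ≫ T' →
        T ≫ G.map (p ≫ f ▷ U) = (q ≫ f' ▷ G.obj U) ≫ box G T' (𝟙 _) := by
      intro x y y' X Y Y' U T p q Ty f f' T' e e'
      rw [G.map_comp, reassoc_of% e, box_map_whiskerRight, e', ← whiskerRight_box, Category.assoc]
    refine h (laxTens_tensExtract G b A (e (Fin.last a))) ?_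
    rw [G.map_comp, reassoc_of% (laxTens_tensPerm (removeLast e)), Category.assoc]
    exact congrArg _ (laxTens_tensCongr G a _ _)

end

end LaxTensor
end GodementOperads

namespace GodementOperads

/-! ### Localizations, saturation and resolvent functors -/

section Localization

variable {C : Type u} [Category.{v} C]

lemma isIso_map_of_isIso_Q_map {W : MorphismProperty C} {D : Type u'} [Category.{v'} D]
    (F : C ⥤ D) (hF : W.IsInvertedBy F) {X Y : C} (f : X ⟶ Y) [IsIso (W.Q.map f)] :
    IsIso (F.map f) := by
  have h : IsIso ((Localization.Construction.lift F hF).map (W.Q.map f)) := inferInstance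
  rw [← Functor.comp_map] at h
  rwa [← NatIso.isIso_map_iff (eqToIso (Localization.Construction.fac F hF)) f]

/-- The composite of `F` with the localization at `E` inverts `W`, hence inverts every morphism that
becomes invertible in `C[W⁻¹]`; saturation of `E` finishes. With `F` an evaluation or a stalk
functor this yields saturation of the global and local equivalences. -/
lemma IsSaturated.of_isIso_Q_map {D : Type u'} [Category.{v'} D] {E : MorphismProperty D}
    (hE : IsSaturated E) {W : MorphismProperty C} (F : C ⥤ D)
    (hF : ∀ ⦃X Y : C⦄ (f : X ⟶ Y), W f → E (F.map f)) {X Y : C} (f : X ⟶ Y)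
    [IsIso (W.Q.map f)] : E (F.map f) :=
  hE _ (isIso_map_of_isIso_Q_map (F ⋙ E.Q)
    (fun _ _ g hg => Localization.inverts E.Q E _ (hF g hg)) f)

variable {S W : MorphismProperty C}

/-- CE-fibrancy says that the functor represented by `M` on `C[S⁻¹]`, pulled back to `C`, inverts
`W`. It therefore factors through `C[W⁻¹]` and inverts everything that becomes invertible there. -/
lemma IsCEFibrant.bijective_of_isIso {M : C} (hM : IsCEFibrant S W M) {X Y : C} (f : X ⟶ Y)
    [IsIso (W.Q.map f)] :
    Function.Bijective (fun g : S.Q.obj Y ⟶ S.Q.obj M => S.Q.map f ≫ g) := by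
  have h := isIso_map_of_isIso_Q_map (W := W) (S.Q ⋙ (yoneda.obj (S.Q.obj M)).rightOp)
    (fun X Y w hw => by
      have : IsIso ((yoneda.obj (S.Q.obj M)).map (S.Q.map w).op) :=
        (isIso_iff_bijective _).2 (hM w hw)
      exact inferInstanceAs (IsIso ((yoneda.obj (S.Q.obj M)).map (S.Q.map w).op).op)) f
  have h' : IsIso ((yoneda.obj (S.Q.obj M)).map (S.Q.map f).op) :=
    (isIso_op_iff _).1 h
  exact (isIso_iff_bijective _).1 h'

/-- A morphism of CE-fibrant objects which is a weak isomorphism is a strong isomorphism. -/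
lemma isIso_Q_map_of_isCEFibrant {M N : C} (hM : IsCEFibrant S W M) (hN : IsCEFibrant S W N)
    (f : M ⟶ N) [IsIso (W.Q.map f)] : IsIso (S.Q.map f) := by
  obtain ⟨g, hg⟩ := (hM.bijective_of_isIso f).2 (𝟙 _)
  have hg : S.Q.map f ≫ g = 𝟙 _ := hg
  -- Fibrancy of `M` has produced `g` with `f ≫ g = 𝟙`. Fibrancy of `N` makes precomposition with
  -- `f` injective on morphisms to `N`, so the other identity may be tested after `f`.
  refine ⟨g, hg, (hN.bijective_of_isIso f).1 ?_⟩
  change S.Q.map f ≫ g ≫ S.Q.map f = S.Q.map f ≫ 𝟙 _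
  rw [reassoc_of% hg, Category.comp_id]

/-- A resolvent functor sends every object to a CE-fibrant one. -/
lemma isCEFibrant_of_resolvent (hSW : S ≤ W) (R : C ⥤ C) (ρ : 𝟭 C ⟶ R)
    (hR : ∀ ⦃X Y : C⦄ (f : X ⟶ Y), W f → S (R.map f)) (hρ : ∀ X, S (ρ.app (R.obj X))) (M : C) :
    IsCEFibrant S W (R.obj M) := by
  -- `R` sends weak equivalences, hence also strong ones, to strong ones, so it descends to an
  -- endofunctor `R'` of `C[S⁻¹]`.
  have hS : S.IsInvertedBy (R ⋙ S.Q) := fun _ _ f hf =>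
    Localization.inverts S.Q S _ (hR f (hSW _ hf))
  obtain ⟨R', e⟩ : ∃ R' : S.Localization ⥤ S.Localization, Nonempty (S.Q ⋙ R' ≅ R ⋙ S.Q) :=
    ⟨Localization.lift _ hS S.Q, ⟨Localization.fac _ hS S.Q⟩⟩
  obtain ⟨e⟩ := e
  -- The extension of `ρ` to a transformation `id ⟶ R'`. Naturality now holds for all morphisms of
  -- `C[S⁻¹]`, not only for those coming from `C`.
  obtain ⟨t, n, ht⟩ : ∃ t : ∀ X, S.Q.obj X ⟶ R'.obj (S.Q.obj X),
      (∀ ⦃X Y⦄ (g : S.Q.obj X ⟶ S.Q.obj Y), g ≫ t Y = t X ≫ R'.map g) ∧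
        ∀ X, t X = S.Q.map (ρ.app X) ≫ e.inv.app X := by
    let τ : 𝟭 _ ⟶ R' := Localization.Construction.natTransExtension
      (W := S) (F₁ := 𝟭 _) (F₂ := R') ((Functor.rightUnitor _).hom ≫ (Functor.leftUnitor _).inv ≫
        Functor.whiskerRight ρ S.Q ≫ e.inv)
    refine ⟨fun X => τ.app (S.Q.obj X), fun X Y g => τ.naturality g, fun X => ?_⟩
    refine (Localization.Construction.natTransExtension_app _ _).trans ?_
    simp
  have hM : IsIso (t (R.obj M)) := by
    have := Localization.inverts S.Q S _ (hρ M)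
    rw [ht]
    infer_instance
  intro Y Z w hw
  have hw' : IsIso (R'.map (S.Q.map w)) := by
    have := Localization.inverts S.Q S _ (hR w hw)
    exact (NatIso.isIso_map_iff e w).2 this
  -- Injectivity: `R'` inverts `w`, so `R' g = R' g'`. Naturality of `t` and its invertibility at `R
  -- M` recover `g` from `R' g`.
  refine ⟨fun g g' h => ?_, fun h => ?_⟩
  · have h : S.Q.map w ≫ g = S.Q.map w ≫ g' := h
    have h' := congrArg R'.map h
    rw [R'.map_comp, R'.map_comp, cancel_epi] at h'
    rw [← cancel_mono (t _), n, n, h']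
  -- The extension of `h` along `w` is formed after applying `R'`, where `w` is invertible, and is
  -- brought back by `t` at both ends.
  · refine ⟨t _ ≫ inv (R'.map (S.Q.map w)) ≫ R'.map h ≫ inv (t _), ?_⟩
    change S.Q.map w ≫ _ = h
    rw [reassoc_of% (n (S.Q.map w)), IsIso.hom_inv_id_assoc, ← Category.assoc, ← n, Category.assoc,
      IsIso.hom_inv_id, Category.comp_id]

lemma isCEFibrantModel_of_resolvent (hSW : S ≤ W) (R : C ⥤ C) (ρ : 𝟭 C ⟶ R)
    (hR : ∀ ⦃X Y : C⦄ (f : X ⟶ Y), W f → S (R.map f)) (hρ : ∀ X, S (ρ.app (R.obj X)))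
    (hW : ∀ X, W (ρ.app X)) (X : C) : IsCEFibrantModel S W (S.Q.map (ρ.app X)) := by
  have h : S.IsInvertedBy W.Q := fun _ _ f hf => Localization.inverts W.Q W _ (hSW _ hf)
  refine ⟨isCEFibrant_of_resolvent hSW R ρ hR hρ X, h, ?_⟩
  rw [← Functor.comp_map]
  refine (NatIso.isIso_map_iff (eqToIso (Localization.Construction.fac W.Q h)) _).2 ?_
  exact Localization.inverts W.Q W _ (hW X)

lemma IsCEFibrantModel.isIso_Q_map {X M : C} {f : X ⟶ M}
    (h : IsCEFibrantModel S W (S.Q.map f)) : IsIso (W.Q.map f) := by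
  obtain ⟨_, h, hf⟩ := h
  rw [← Functor.comp_map] at hf
  exact (NatIso.isIso_map_iff (eqToIso (Localization.Construction.fac W.Q h)) _).1 hf

end Localization

/-! ### Transport of operations along a monoidal transformation -/

section Transport

open Functor.LaxMonoidal

variable {V : Type u₁} [Category.{v₁} V] [MonoidalCategory V] [BraidedCategory V]
  {W : Type u₂} [Category.{v₂} W] [MonoidalCategory W] [BraidedCategory W]
  {E H : V ⥤ W} [E.LaxBraided] [H.LaxBraided] (τ : E ⟶ H) [NatTrans.IsMonoidal τ]

/-- The operation `E X ⊗ H (A 0) ⊗ ⋯ ⊗ H (A (n - 1)) ⟶ H Y` induced by an operation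
`X ⊗ A 0 ⊗ ⋯ ⊗ A (n - 1) ⟶ Y` and a monoidal transformation `E ⟶ H`. -/
def transport {X Y : V} {n : ℕ} {A : Fin n → V} (a : X ⊗ tens n A ⟶ Y) :
    E.obj X ⊗ tens n (fun i => H.obj (A i)) ⟶ H.obj Y :=
  box H (τ.app X) (laxTens H n A) ≫ H.map a

lemma map_transport {X X' Y : V} {n n' : ℕ} (e : Fin n ≃ Fin n') (p : X' ⟶ X) (A : Fin n' → V)
    (a : X ⊗ tens n (fun i => A (e i)) ⟶ Y) :
    (E.map p ⊗ₘ tensPerm e (fun i => H.obj (A i))) ≫ transport τ a =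
      transport τ ((p ⊗ₘ tensPerm e A) ≫ a) := by
  rw [transport, tensorHom_box_assoc, transport, H.map_comp, box_map_assoc, τ.naturality,
    laxTens_tensPerm]

/-- The operad unit on the side of `E` is the image of `p` preceded by the unit constraint of `E`;
monoidality of `τ` exchanges that constraint for the one of `H`. -/
lemma one_transport {X Y A : V} (p : 𝟙_ V ⟶ X) (a : X ⊗ tens 1 (fun _ => A) ⟶ Y) :
    (λ_ (H.obj A)).inv ≫ ((ε E ≫ E.map p) ⊗ₘ tensOne (H.obj A)) ≫ transport τ a =
      H.map ((λ_ A).inv ≫ (p ⊗ₘ tensOne A) ≫ a) := by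
  have h : tensOne (H.obj A) ≫ laxTens H 1 (fun _ => A) = H.map (tensOne A) :=
    (box_ε_leftUnitor_inv (𝟙 (H.obj A))).symm.trans (Category.id_comp _)
  have h' : (ε E ≫ E.map p) ≫ τ.app X = ε H ≫ H.map p := by
    rw [Category.assoc, τ.naturality, NatTrans.IsMonoidal.unit_assoc]
  have k := box_ε_leftUnitor_inv (G := H) (𝟙 (H.obj A))
  rw [transport, tensorHom_box_assoc, h, h', H.map_comp, H.map_comp, ← Category.id_comp (H.map _),
    reassoc_of% k, box_map_assoc]
  simp only [Category.id_comp]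

section

/-- The morphism `E X ⊗ ⨂ᵢ E (B i) ⊗ ⨂ₖ H (A k) ⟶ H (X ⊗ ⨂ᵢ B i ⊗ ⨂ₖ A k)`. -/
def transportSource (X : V) {n : ℕ} (B : Fin n → V) {k : ℕ} (A : Fin k → V) :
    (E.obj X ⊗ tens n (fun i => E.obj (B i))) ⊗ tens k (fun i => H.obj (A i)) ⟶
      H.obj ((X ⊗ tens n B) ⊗ tens k A) :=
  box H (box H (τ.app X) (tensMap n (fun i => τ.app (B i)) ≫ laxTens H n B)) (laxTens H k A)

/-- One side of the associativity axiom. The operad composition stays on the side of `E`, hence its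
transport along the identity. Both sides of the axiom are brought to the form `transportSource`
followed by the image of a morphism of `V`, so that associativity in `V` transfers. -/
lemma comp_transport {X X' Y : V} {n : ℕ} {B : Fin n → V} {k : ℕ} {A : Fin k → V}
    (c : X ⊗ tens n B ⟶ X') (a : X' ⊗ tens k A ⟶ Y) :
    transport (𝟙 E) c ▷ tens k (fun i => H.obj (A i)) ≫ transport τ a =
      transportSource τ X B A ≫ H.map (c ▷ tens k A ≫ a) := by
  have h : transport (𝟙 E) c ≫ τ.app X' =
      box H (τ.app X) (tensMap n (fun i => τ.app (B i)) ≫ laxTens H n B) ≫ H.map c := by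
    rw [transport, Category.assoc, τ.naturality, box_app_assoc, laxTens_monoidal,
      NatTrans.id_app, Category.id_comp]
  change _ ≫ box H (τ.app X') (laxTens H k A) ≫ H.map a = _
  rw [← Category.assoc, whiskerRight_box, h, transportSource, H.map_comp,
    box_map_whiskerRight_assoc]

/-- The other side of the associativity axiom. `transportSource` is `τ` on the operad factors
followed by the comparison for `H`; the former passes the shuffle by `tensShuffle_natural`, the
latter by `laxTens_tensShuffle`. -/
lemma shuffle_transport {X Y : V} {n : ℕ} {B Z : Fin n → V} {m : Fin n → ℕ}
    {A : Fin (∑ i, m i) → V}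
    (b : ∀ i, B i ⊗ tens (m i) (fun j => A (finSigmaFinEquiv ⟨i, j⟩)) ⟶ Z i)
    (a : X ⊗ tens n Z ⟶ Y) :
    tensShuffle (E.obj X) n (fun i => E.obj (B i)) m (fun k => H.obj (A k)) ≫
        E.obj X ◁ tensMap n (fun i => transport τ (b i)) ≫ transport τ a =
      transportSource τ X B A ≫
        H.map (tensShuffle X n B m A ≫ X ◁ tensMap n b ≫ a) := by
  have h := laxTens_tensShuffle H (𝟙 (H.obj X)) n B m A
  have k : transportSource τ X B A = (τ.app X ⊗ₘ tensMap n (fun i => τ.app (B i))) ▷ _ ≫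
      box H (box H (𝟙 (H.obj X)) (laxTens H n B)) (laxTens H _ A) := by
    rw [whiskerRight_box, tensorHom_box, Category.comp_id, transportSource]
  have t := tensShuffle_natural (τ.app X) n (fun i => τ.app (B i)) m (fun k => H.obj (A k))
  rw [k, H.map_comp, H.map_comp, Category.assoc, reassoc_of% h, reassoc_of% t,
    tensorHom_box_assoc, box_map_whiskerLeft_assoc, Category.comp_id, Category.assoc,
    Category.assoc, ← laxTens_natural, ← Category.assoc (tensMap _ _), ← tensMap_comp,
    ← Category.assoc (tensMap _ _), ← tensMap_comp]
  simp only [whiskerRight_box, Category.comp_id]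
  rw [← whiskerLeft_box, Category.assoc]
  rfl

end

/-- For `τ = ρ` this says that `ρ` commutes with the structure morphisms. -/
lemma transport_hom {X Y : V} {n : ℕ} {A : Fin n → V} (a : X ⊗ tens n A ⟶ Y) :
    transport (𝟙 E) a ≫ τ.app Y =
      (E.obj X ◁ tensMap n (fun i => τ.app (A i))) ≫ transport τ a := by
  rw [transport, Category.assoc, τ.naturality, box_app_assoc, transport, ← Category.assoc (_ ◁ _),
    whiskerLeft_box, laxTens_monoidal, NatTrans.id_app, Category.id_comp]

/-- With `τ` the identity of an evaluation it compares morphisms of algebras objectwise and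
internally; with `τ = ρ` it makes `H_X` a functor on algebras. -/
lemma transport_natural {X Y Y' : V} {n : ℕ} {A A' : Fin n → V} (a : X ⊗ tens n A ⟶ Y)
    (a' : X ⊗ tens n A' ⟶ Y') (f : ∀ i, A i ⟶ A' i) (g : Y ⟶ Y')
    (h : a ≫ g = X ◁ tensMap n f ≫ a') :
    transport τ a ≫ H.map g =
      (E.obj X ◁ tensMap n (fun i => H.map (f i))) ≫ transport τ a' := by
  rw [transport, Category.assoc, ← H.map_comp, h, H.map_comp, box_map_whiskerLeft_assoc,
    transport, ← Category.assoc (_ ◁ _), whiskerLeft_box, laxTens_natural]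

end Transport
end GodementOperads

namespace GodementOperads

/-! ### Calculus of `pair` in functor categories -/

section PairLemmas

variable {C : Type u} [Category.{v} C] {D : Type u'} [Category.{v'} D] [MonoidalCategory D]

lemma whiskerRight_app_pair_assoc {F F' G : C ⥤ D} (φ : F ⟶ F') {U : C} {A B T : D}
    (a : F'.obj U ⟶ A) (b : G.obj U ⟶ B) (h : A ⊗ B ⟶ T) :
    (φ ▷ G).app U ≫ pair a b ≫ h = pair (φ.app U ≫ a) b ≫ h := by
  rw [← tensorHom_id, app_pair_assoc, NatTrans.id_app, Category.id_comp]

lemma whiskerLeft_app_pair_assoc {F G G' : C ⥤ D} (ψ : G ⟶ G') {U : C} {A B T : D}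
    (a : F.obj U ⟶ A) (b : G'.obj U ⟶ B) (h : A ⊗ B ⟶ T) :
    (F ◁ ψ).app U ≫ pair a b ≫ h = pair a (ψ.app U ≫ b) ≫ h := by
  rw [← id_tensorHom, app_pair_assoc, NatTrans.id_app, Category.id_comp]

lemma pair_whiskerRight_assoc {F G : C ⥤ D} {U : C} {A B A' T : D} (a : F.obj U ⟶ A)
    (b : G.obj U ⟶ B) (c : A ⟶ A') (h : A' ⊗ B ⟶ T) :
    pair a b ≫ c ▷ B ≫ h = pair (a ≫ c) b ≫ h := by
  rw [← tensorHom_id, pair_comp_assoc, Category.comp_id]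

lemma pair_whiskerLeft_assoc {F G : C ⥤ D} {U : C} {A B B' T : D} (a : F.obj U ⟶ A)
    (b : G.obj U ⟶ B) (d : B ⟶ B') (h : A ⊗ B' ⟶ T) :
    pair a b ≫ A ◁ d ≫ h = pair a (b ≫ d) ≫ h := by
  rw [← id_tensorHom, pair_comp_assoc, Category.comp_id]

lemma associator_app_pair_assoc {F G K : C ⥤ D} {U : C} {A B B' T : D} (a : F.obj U ⟶ A)
    (b : G.obj U ⟶ B) (c : K.obj U ⟶ B') (h : A ⊗ B ⊗ B' ⟶ T) :
    (α_ F G K).hom.app U ≫ pair a (pair b c) ≫ h =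
      pair (F := F ⊗ G) (pair a b) c ≫ (α_ A B B').hom ≫ h :=
  (associator_naturality_assoc a b c h).symm

lemma braiding_app_pair_assoc [BraidedCategory D] {F G : C ⥤ D} {U : C} {A B T : D}
    (a : F.obj U ⟶ A) (b : G.obj U ⟶ B) (h : B ⊗ A ⟶ T) :
    (β_ F G).hom.app U ≫ pair b a ≫ h = pair a b ≫ (β_ A B).hom ≫ h :=
  (BraidedCategory.braiding_naturality_assoc a b h).symm

end PairLemmas

/-! ### Coherence of the Künneth morphisms of stalks -/

section Stalk

variable {C : Type u} [Category.{v} C] [LocallySmall.{w} C] {J : GrothendieckTopology C}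
  (Φ : GrothendieckTopology.Point.{w} J)
  {D : Type u'} [Category.{v'} D] [HasFilteredColimitsOfSize.{w, w} D]
  [MonoidalCategory D] [SymmetricCategory D]
  [∀ A : D, PreservesFilteredColimitsOfSize.{w, w} (tensorLeft A)]

/-- Source and target are both colimits of `F(U) ⊗ G(U)` over the neighbourhoods, the source because
tensoring preserves filtered colimits. Invertibility is what lets a threefold tensor product of
stalks be tested on germs over one common neighbourhood. -/
instance (F G : Cᵒᵖ ⥤ D) : IsIso (stalkTensor Φ F G) :=
  ((stalkTensorIsColimit Φ F G).coconePointUniqueUpToIso (colimit.isColimit _)).isIso_hom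

lemma stalkTensor_associator (F G K : Cᵒᵖ ⥤ D) :
    stalkTensor Φ F G ▷ (stalk Φ).obj K ≫ stalkTensor Φ (F ⊗ G) K ≫ (stalk Φ).map (α_ F G K).hom =
      (α_ _ _ _).hom ≫ (stalk Φ).obj F ◁ stalkTensor Φ G K ≫ stalkTensor Φ F (G ⊗ K) := by
  rw [← cancel_epi (inv (stalkTensor Φ F G) ▷ (stalk Φ).obj K), ← comp_whiskerRight_assoc,
    IsIso.inv_hom_id, id_whiskerRight, Category.id_comp]
  refine stalk_tensor_hom_ext fun U u => ?_
  have e : germ Φ (F ⊗ G) U u ≫ inv (stalkTensor Φ F G) = pair (germ Φ F U u) (germ Φ G U u) := by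
    rw [← germ_stalkTensor, Category.assoc, IsIso.hom_inv_id, Category.comp_id]
  rw [germ_stalkTensor_assoc, germ_stalk_map, pair_whiskerRight_assoc, e,
    ← associator_app_pair_assoc, pair_whiskerLeft_assoc, germ_stalkTensor, germ_stalkTensor]

lemma stalkTensor_braiding (F G : Cᵒᵖ ⥤ D) :
    stalkTensor Φ F G ≫ (stalk Φ).map (β_ F G).hom = (β_ _ _).hom ≫ stalkTensor Φ G F := by
  refine stalk_tensor_hom_ext fun U u => ?_
  rw [germ_stalkTensor_assoc, germ_stalk_map, ← braiding_app_pair_assoc, germ_stalkTensor]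

/-- The germ of the unit is taken at `(U, u)`, the germ of `F` at an arbitrary `(U', u')`. A common
refinement exists because neighbourhoods are cofiltered, and there the defining property of
`stalkTensor` applies. -/
lemma stalkTensor_leftUnitor (F : Cᵒᵖ ⥤ D) (U : Cᵒᵖ) (u : Φ.fiber.obj U.unop) :
    germ Φ (𝟙_ (Cᵒᵖ ⥤ D)) U u ▷ (stalk Φ).obj F ≫ stalkTensor Φ (𝟙_ (Cᵒᵖ ⥤ D)) F ≫
      (stalk Φ).map (λ_ F).hom = (λ_ ((stalk Φ).obj F)).hom := by
  rw [← cancel_epi (λ_ ((stalk Φ).obj F)).inv, Iso.inv_hom_id]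
  refine stalk_hom_ext fun U' u' => ?_
  obtain ⟨W, f, g, -⟩ := IsCofilteredOrEmpty.cone_objs (C := Φ.fiber.Elements) ⟨U.unop, u⟩ ⟨U'.unop, u'⟩
  have hf := germ_res Φ (𝟙_ (Cᵒᵖ ⥤ D)) f.1.op W.2
  have hg := germ_res Φ F g.1.op W.2
  have ef : Φ.fiber.map f.1 W.2 = u := f.2
  have eg : Φ.fiber.map g.1 W.2 = u' := g.2
  have hg' : germ Φ F U' u' = F.map g.1.op ≫ germ Φ F (op W.1) W.2 := by
    rw [hg]
    exact congrArg _ eg.symm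
  -- The unit presheaf has identities as restrictions, so its germ does not change under refinement.
  have hf' : germ Φ (𝟙_ (Cᵒᵖ ⥤ D)) U u = germ Φ (𝟙_ (Cᵒᵖ ⥤ D)) (op W.1) W.2 := by
    have h' := hf.trans (congrArg (germ Φ (𝟙_ (Cᵒᵖ ⥤ D)) U) ef)
    exact h'.symm.trans (Category.id_comp _)
  rw [hg', Category.assoc, Category.assoc, Category.comp_id]
  refine congrArg _ ?_
  rw [hf']
  have h := germ_stalkTensor_assoc Φ (𝟙_ (Cᵒᵖ ⥤ D)) F (op W.1) W.2 ((stalk Φ).map (λ_ F).hom)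
  rw [germ_stalk_map] at h
  have k : germ Φ F (op W.1) W.2 ≫ (λ_ ((stalk Φ).obj F)).inv ≫
      germ Φ (𝟙_ (Cᵒᵖ ⥤ D)) (op W.1) W.2 ▷ (stalk Φ).obj F =
        (λ_ F).inv.app (op W.1) ≫ pair (germ Φ _ _ W.2) (germ Φ F _ W.2) := by
    rw [leftUnitor_inv_naturality_assoc]
    change _ = (λ_ _).inv ≫ (_ ⊗ₘ _)
    rw [tensorHom_def']
  rw [reassoc_of% k, h, ← Category.assoc, ← NatTrans.comp_app, Iso.inv_hom_id, NatTrans.id_app,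
    Category.id_comp]

end Stalk

/-! ### The Godement triple is lax symmetric monoidal -/

section Godement

variable {C : Type u} [Category.{v} C] [LocallySmall.{w} C] {J : GrothendieckTopology C}
  {X : Type w} (pt : X → GrothendieckTopology.Point.{w} J)
  {D : Type u'} [Category.{v'} D] [HasFilteredColimitsOfSize.{w, w} D] [HasProducts.{w} D]
  [MonoidalCategory D] [SymmetricCategory D]
  [∀ A : D, PreservesFilteredColimitsOfSize.{w, w} (tensorLeft A)]

/-- A morphism into the product is determined by its projections, which reduces each coherence law
of `T` to the corresponding law for stalks. -/
lemma godementTensor_associator (F G K : Cᵒᵖ ⥤ D) :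
    godementTensor pt F G ▷ godementObj pt K ≫ godementTensor pt (F ⊗ G) K ≫
        godementMap pt (α_ F G K).hom =
      (α_ _ _ _).hom ≫ godementObj pt F ◁ godementTensor pt G K ≫
        godementTensor pt F (G ⊗ K) := by
  refine NatTrans.ext (funext fun U => proj_hom_ext fun x u => ?_)
  simp only [NatTrans.comp_app, Category.assoc]
  rw [godementMap_proj, godementTensor_proj_assoc, whiskerRight_app_pair_assoc,
    godementTensor_proj, godementTensor_proj, whiskerLeft_app_pair_assoc, godementTensor_proj,
    ← pair_whiskerRight_assoc, ← pair_whiskerLeft_assoc, associator_app_pair_assoc,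
    stalkTensor_associator]

lemma godementTensor_braiding (F G : Cᵒᵖ ⥤ D) :
    godementTensor pt F G ≫ godementMap pt (β_ F G).hom =
      (β_ _ _).hom ≫ godementTensor pt G F := by
  refine NatTrans.ext (funext fun U => proj_hom_ext fun x u => ?_)
  simp only [NatTrans.comp_app, Category.assoc]
  rw [godementMap_proj, godementTensor_proj_assoc, godementTensor_proj, braiding_app_pair_assoc,
    stalkTensor_braiding]

lemma godementTensor_leftUnitor (F : Cᵒᵖ ⥤ D) :
    godementUnit pt (𝟙_ (Cᵒᵖ ⥤ D)) ▷ godementObj pt F ≫ godementTensor pt (𝟙_ (Cᵒᵖ ⥤ D)) F ≫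
      godementMap pt (λ_ F).hom = (λ_ (godementObj pt F)).hom := by
  refine NatTrans.ext (funext fun U => proj_hom_ext fun x u => ?_)
  simp only [NatTrans.comp_app, Category.assoc]
  rw [godementMap_proj, godementTensor_proj_assoc, whiskerRight_app_pair_assoc,
    godementUnit_proj]
  have h := stalkTensor_leftUnitor (pt x) F U u
  have k : pair (germ (pt x) (𝟙_ (Cᵒᵖ ⥤ D)) U u) (proj pt F U x u) =
      𝟙_ D ◁ proj pt F U x u ≫ germ (pt x) (𝟙_ (Cᵒᵖ ⥤ D)) U u ▷ _ := tensorHom_def' _ _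
  rw [k]
  exact (Category.assoc _ _ _).trans ((congrArg _ h).trans (leftUnitor_naturality _))

/-- Deduced from the left unit law by symmetry. -/
lemma godementTensor_rightUnitor (F : Cᵒᵖ ⥤ D) :
    godementObj pt F ◁ godementUnit pt (𝟙_ (Cᵒᵖ ⥤ D)) ≫ godementTensor pt F (𝟙_ (Cᵒᵖ ⥤ D)) ≫
      godementMap pt (ρ_ F).hom = (ρ_ (godementObj pt F)).hom := by
  have h := godementTensor_leftUnitor pt F
  have e : (ρ_ F).hom = (β_ F (𝟙_ _)).hom ≫ (λ_ F).hom := (braiding_leftUnitor F).symm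
  have m : godementMap pt (ρ_ F).hom =
    godementMap pt (β_ F (𝟙_ _)).hom ≫ godementMap pt (λ_ F).hom := by
      rw [e]
      exact (godementMonad pt).map_comp _ _
  rw [m, reassoc_of% (godementTensor_braiding pt F (𝟙_ (Cᵒᵖ ⥤ D))),
    BraidedCategory.braiding_naturality_right_assoc, h, braiding_leftUnitor]

noncomputable instance godementLaxBraided : (godementMonad (D := D) pt).toFunctor.LaxBraided where
  ε := godementUnit pt (𝟙_ (Cᵒᵖ ⥤ D))
  μ F G := godementTensor pt F G
  μ_natural_left f K := by
    have h := godementTensor_natural pt f (𝟙 K)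
    have e : godementMap pt (𝟙 K) = 𝟙 (godementObj pt K) := (godementMonad pt).map_id K
    rwa [e, tensorHom_id, tensorHom_id] at h
  μ_natural_right K f := by
    have h := godementTensor_natural pt (𝟙 K) f
    have e : godementMap pt (𝟙 K) = 𝟙 (godementObj pt K) := (godementMonad pt).map_id K
    rwa [e, id_tensorHom, id_tensorHom] at h
  associativity F G K := godementTensor_associator pt F G K
  left_unitality F := (godementTensor_leftUnitor pt F).symm
  right_unitality F := (godementTensor_rightUnitor pt F).symm
  braided F G := godementTensor_braiding pt F G

end Godement

end GodementOperads

namespace GodementOperads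

/-! ### Lax symmetric monoidal structure on the iterates and the resolution -/

section Iterates

open Functor.LaxMonoidal

variable {E : Type u} [Category.{v} E] [MonoidalCategory E] (T : CategoryTheory.Monad E)

/-- The augmentation `Z ⟶ T^n Z`. -/
def iterUnit (n : ℕ) : 𝟭 E ⟶ iter T n := iterMap T n 0 ⟨Fin.elim0, fun i => i.elim0⟩

lemma iterUnit_succ (n : ℕ) (Z : E) :
    (iterUnit T (n + 1)).app Z = (iterUnit T n).app Z ≫ T.η.app ((iter T n).obj Z) := by
  refine (iterMap_pred T _ (fun i => i.elim0) Z).trans ?_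
  have e : monoPred (b := n) (⟨Fin.elim0, fun i => i.elim0⟩ : Fin 0 →o Fin (n + 1))
      (fun i => i.elim0) = ⟨Fin.elim0, fun i => i.elim0⟩ := by
    ext i
    exact i.elim0
  rw [e]
  rfl

variable [BraidedCategory E] [T.toFunctor.LaxBraided]

/-- The iterates of a lax braided triple are lax braided. -/
@[reducible]
def iterLaxBraidedAux : ∀ n, (iter T n).LaxBraided
  | 0 => inferInstanceAs (𝟭 E).LaxBraided
  | n + 1 =>
    letI := iterLaxBraidedAux n
    inferInstanceAs (iter T n ⋙ T.toFunctor).LaxBraided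

lemma iterLaxBraidedAux_μ : ∀ (n : ℕ) (F G : E),
    iterTensor T (μ T.toFunctor) n F G = (iterLaxBraidedAux T n).μ F G
  | 0, _, _ => rfl
  | n + 1, F, G => by
    change μ T.toFunctor _ _ ≫ T.map (iterTensor T (μ T.toFunctor) n F G) =
      μ T.toFunctor _ _ ≫ T.map ((iterLaxBraidedAux T n).μ F G)
    rw [iterLaxBraidedAux_μ n]

lemma iterLaxBraidedAux_ε (h : ε T.toFunctor = T.η.app (𝟙_ E)) : ∀ n : ℕ,
    (iterUnit T n).app (𝟙_ E) = (iterLaxBraidedAux T n).ε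
  | 0 => rfl
  | n + 1 => by
    change _ = ε T.toFunctor ≫ T.map (iterLaxBraidedAux T n).ε
    rw [h, iterUnit_succ, iterLaxBraidedAux_ε h n]
    exact T.η.naturality _

/-- The lax braided structure on the iterates of a triple given by the Künneth morphisms
`iterTensor` and the units `iterUnit`. -/
@[reducible]
def iterLaxBraided (h : ε T.toFunctor = T.η.app (𝟙_ E)) (n : ℕ) : (iter T n).LaxBraided :=
  -- The structure of the composite functor is replaced by an equal one whose constraints are
  -- `iterUnit` and `iterTensor` themselves. The axioms for the resolution can then be read off
  -- componentwise, without rewriting.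
  (iterLaxBraidedAux T n).copy ((iterUnit T n).app (𝟙_ E)) (iterTensor T (μ T.toFunctor) n)
    (iterLaxBraidedAux_ε T h n)
    (funext fun F => funext fun G => iterLaxBraidedAux_μ T n F G)

end Iterates

section Hypercohomology

variable {C : Type u} [Category.{v} C] [LocallySmall.{w} C] {J : GrothendieckTopology C}
  {X : Type w} (pt : X → GrothendieckTopology.Point.{w} J)
  {D : Type u'} [Category.{v'} D] [HasFilteredColimitsOfSize.{w, w} D] [HasProducts.{w} D]
  [MonoidalCategory D] [SymmetricCategory D]
  [∀ A : D, PreservesFilteredColimitsOfSize.{w, w} (tensorLeft A)]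

/-- The lax braided structure on the iterates of the Godement triple. -/
@[reducible]
noncomputable def godementIterLaxBraided (n : ℕ) :
    (iter (godementMonad (D := D) pt) n).LaxBraided :=
  iterLaxBraided (godementMonad pt) rfl n

lemma resolution_hom_ext {F G : Cᵒᵖ ⥤ SimplexCategory ⥤ D} {f g : F ⟶ G}
    (h : ∀ U n, (f.app U).app n = (g.app U).app n) : f = g :=
  NatTrans.ext (funext fun U => NatTrans.ext (funext fun n => h U n))

/-- Equalities may be checked for each object `U` and cosimplicial degree `n`, where they are the
axioms for the iterate `T^{n+1}`. -/
noncomputable instance : (godementResolution (D := D) pt).LaxBraided where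
  ε := godementCoaugmentation pt (𝟙_ (Cᵒᵖ ⥤ D))
  μ F G := resolutionTensor pt F G
  μ_natural_left f K := resolution_hom_ext fun U n => congrArg (fun t => t.app U)
    ((godementIterLaxBraided pt (n.len + 1)).μ_natural_left f K)
  μ_natural_right K f := resolution_hom_ext fun U n => congrArg (fun t => t.app U)
    ((godementIterLaxBraided pt (n.len + 1)).μ_natural_right K f)
  associativity F G K := resolution_hom_ext fun U n => congrArg (fun t => t.app U)
    ((godementIterLaxBraided pt (n.len + 1)).associativity F G K)
  left_unitality F := resolution_hom_ext fun U n => congrArg (fun t => t.app U)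
    ((godementIterLaxBraided pt (n.len + 1)).left_unitality F)
  right_unitality F := resolution_hom_ext fun U n => congrArg (fun t => t.app U)
    ((godementIterLaxBraided pt (n.len + 1)).right_unitality F)
  braided F G := resolution_hom_ext fun U n => congrArg (fun t => t.app U)
    ((godementIterLaxBraided pt (n.len + 1)).braided F G)

end Hypercohomology

end GodementOperads

namespace GodementOperads

/-! ### Whiskering and evaluation as monoidal functors -/

section Whiskering

variable {C : Type u} [Category.{v} C] {V : Type u₁} [Category.{v₁} V] [MonoidalCategory V]
  [BraidedCategory V] {W : Type u₂} [Category.{v₂} W] [MonoidalCategory W] [BraidedCategory W]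

instance whiskeringRightLaxBraided (G : V ⥤ W) [G.LaxBraided] :
    ((Functor.whiskeringRight C V W).obj G).LaxBraided where
  braided _ _ := NatTrans.ext (funext fun _ => Functor.LaxBraided.braided (F := G) _ _)

/-- The evaluation of functors at an object is a braided monoidal functor. -/
instance evaluationBraided (U : C) : ((evaluation C V).obj U).Braided where
  ε := 𝟙 (𝟙_ V)
  μ F K := 𝟙 (F.obj U ⊗ K.obj U)
  η := 𝟙 (𝟙_ V)
  δ F K := 𝟙 (F.obj U ⊗ K.obj U)
  μ_natural_left _ _ := (Category.comp_id _).trans (Category.id_comp _).symm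
  μ_natural_right _ _ := (Category.comp_id _).trans (Category.id_comp _).symm
  associativity F K L := by
    change 𝟙 (F.obj U ⊗ K.obj U) ▷ L.obj U ≫ 𝟙 _ ≫ (α_ _ _ _).hom =
      (α_ _ _ _).hom ≫ F.obj U ◁ 𝟙 (K.obj U ⊗ L.obj U) ≫ 𝟙 _
    simp
  left_unitality F := by
    change (λ_ (F.obj U)).hom = 𝟙 (𝟙_ V) ▷ F.obj U ≫ 𝟙 _ ≫ (λ_ (F.obj U)).hom
    simp
  right_unitality F := by
    change (ρ_ (F.obj U)).hom = F.obj U ◁ 𝟙 (𝟙_ V) ≫ 𝟙 _ ≫ (ρ_ (F.obj U)).hom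
    simp
  δ_natural_left _ _ := (Category.id_comp _).trans (Category.comp_id _).symm
  δ_natural_right _ _ := (Category.id_comp _).trans (Category.comp_id _).symm
  oplax_associativity F K L := by
    change 𝟙 _ ≫ 𝟙 (F.obj U ⊗ K.obj U) ▷ L.obj U ≫ (α_ _ _ _).hom =
      (α_ _ _ _).hom ≫ 𝟙 _ ≫ F.obj U ◁ 𝟙 (K.obj U ⊗ L.obj U)
    simp
  oplax_left_unitality F := by
    change (λ_ (F.obj U)).inv = (λ_ (F.obj U)).inv ≫ 𝟙 _ ≫ 𝟙 (𝟙_ V) ▷ F.obj U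
    simp
  oplax_right_unitality F := by
    change (ρ_ (F.obj U)).inv = (ρ_ (F.obj U)).inv ≫ 𝟙 _ ≫ F.obj U ◁ 𝟙 (𝟙_ V)
    simp
  ε_η := Category.comp_id _
  η_ε := Category.comp_id _
  μ_δ _ _ := Category.comp_id _
  δ_μ _ _ := Category.comp_id _
  braided F K := (Category.id_comp _).trans (Category.comp_id _).symm

instance evaluationMap_isMonoidal {U U' : C} (f : U ⟶ U') :
    NatTrans.IsMonoidal ((evaluation C V).map f) where
  unit := Category.comp_id _
  tensor _ _ := (Category.id_comp _).trans (Category.comp_id _).symm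

end Whiskering

/-! ### Hypercohomology is lax symmetric monoidal and `ρ` is monoidal -/

section Hypercohomology

open Functor.LaxMonoidal

variable {C : Type u} [Category.{v} C] [LocallySmall.{w} C] {J : GrothendieckTopology C}
  {X : Type w} (pt : X → GrothendieckTopology.Point.{w} J)
  {D : Type u'} [Category.{v'} D] [HasFilteredColimitsOfSize.{w, w} D] [HasProducts.{w} D]

lemma godementCoaugmentation_natural {F G : Cᵒᵖ ⥤ D} (φ : F ⟶ G) (U : Cᵒᵖ) :
    (godementCoaugmentation pt F).app U ≫ ((godementResolution pt).map φ).app U =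
      const.map (φ.app U) ≫ (godementCoaugmentation pt G).app U :=
  NatTrans.ext (funext fun n => congrArg (fun t => t.app U)
    ((iterUnit (godementMonad pt) (n.len + 1)).naturality φ).symm)

/-- The morphisms `ρ_F` form a natural transformation. -/
noncomputable def rhoTrans (s : (SimplexCategory ⥤ D) ⥤ D) (lam : 𝟭 D ⟶ const ⋙ s) :
    𝟭 (Cᵒᵖ ⥤ D) ⟶ hyper pt s where
  app F := rho pt s lam F
  naturality F G φ := by
    refine NatTrans.ext (funext fun U => ?_)
    have n : φ.app U ≫ lam.app (G.obj U) = lam.app (F.obj U) ≫ s.map (const.map (φ.app U)) :=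
      lam.naturality (φ.app U)
    change φ.app U ≫ lam.app (G.obj U) ≫ s.map ((godementCoaugmentation pt G).app U) =
      (lam.app (F.obj U) ≫ s.map ((godementCoaugmentation pt F).app U)) ≫
        s.map (((godementResolution pt).map φ).app U)
    rw [reassoc_of% n, Category.assoc, ← s.map_comp, ← s.map_comp, godementCoaugmentation_natural]

variable [MonoidalCategory D] [SymmetricCategory D]
  [∀ A : D, PreservesFilteredColimitsOfSize.{w, w} (tensorLeft A)]

/-- The coaugmentation in degree `n` is the transformation attached to the empty map into `Fin (n +
1)`, so this is `iterMap_tensor` with source `T^0`. -/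
lemma godementCoaugmentation_tensor (F G : Cᵒᵖ ⥤ D) (U : Cᵒᵖ) :
    ((godementCoaugmentation pt F).app U ⊗ₘ (godementCoaugmentation pt G).app U) ≫
        (resolutionTensor pt F G).app U =
      μ const (F.obj U) (G.obj U) ≫ (godementCoaugmentation pt (F ⊗ G)).app U :=
  NatTrans.ext (funext fun n => congrArg (fun t => t.app U)
    (iterMap_tensor (godement_isTensorCompatible pt) (n.len + 1) 0
      ⟨Fin.elim0, fun i => i.elim0⟩ F G))

variable (s : (SimplexCategory ⥤ D) ⥤ D) [s.LaxBraided] (lam : 𝟭 D ⟶ const ⋙ s)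
  [NatTrans.IsMonoidal lam]

/-- The functor `H_X` is lax braided, with the Künneth morphisms `hyperTensor` and the unit
`ρ`. -/
@[reducible]
noncomputable def hyperLaxBraided : (hyper (C := C) pt s).LaxBraided :=
  Functor.LaxBraided.copy
    (inferInstanceAs (godementResolution pt ⋙ (Functor.whiskeringRight _ _ _).obj s).LaxBraided)
    (rho pt s lam (𝟙_ (Cᵒᵖ ⥤ D))) (hyperTensor pt s)
    (by
      refine NatTrans.ext (funext fun U => ?_)
      change lam.app (𝟙_ D) ≫ s.map _ = ε s ≫ s.map _
      -- Constant cosimplicial objects have an identity as unit constraint, so monoidality of `λ`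
      -- says that `λ` at the unit is the unit constraint of `s`. Hence `ρ` at the unit is the unit
      -- constraint of the composite functor.
      have h : 𝟙 _ ≫ lam.app (𝟙_ D) = ε s ≫ s.map (ε const) := NatTrans.IsMonoidal.unit (τ := lam)
      have h' : lam.app (𝟙_ D) = ε s :=
        (Category.id_comp _).symm.trans (h.trans ((congrArg _ (s.map_id _)).trans
          (Category.comp_id _)))
      rw [h']
      rfl)
    rfl

/-- The objectwise form of monoidality of `ρ`: monoidality of `λ` combined with compatibility `h` of
coaugmentations with Künneth morphisms. The leading identity is the tensor constraint of the
identity functor. -/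
lemma lam_tensor_comp {A B : D} {Y Z T : SimplexCategory ⥤ D} (a : const.obj A ⟶ Y)
    (b : const.obj B ⟶ Z) (c : Y ⊗ Z ⟶ T) (d : const.obj (A ⊗ B) ⟶ T)
    (h : (a ⊗ₘ b) ≫ c = μ const A B ≫ d) :
    𝟙 (A ⊗ B) ≫ lam.app (A ⊗ B) ≫ s.map d =
      ((lam.app A ≫ s.map a) ⊗ₘ (lam.app B ≫ s.map b)) ≫ μ s Y Z ≫ s.map c := by
  have t : 𝟙 _ ≫ lam.app (A ⊗ B) = (lam.app A ⊗ₘ lam.app B) ≫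
      μ s _ _ ≫ s.map (μ const _ _) := NatTrans.IsMonoidal.tensor (τ := lam) A B
  have t' := congrArg (· ≫ s.map d) t
  simp only [Category.assoc] at t'
  rw [← tensorHom_comp_tensorHom, Category.assoc, μ_natural_assoc, ← s.map_comp, h, s.map_comp]
  exact t'

lemma rhoTrans_isMonoidal :
    let _ := hyperLaxBraided pt s lam
    NatTrans.IsMonoidal (rhoTrans pt s lam) := by
  let _ := hyperLaxBraided pt s lam
  exact ⟨Category.id_comp _, fun F G => NatTrans.ext (funext fun U =>
    lam_tensor_comp s lam _ _ _ _ (godementCoaugmentation_tensor pt F G U))⟩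

end Hypercohomology

end GodementOperads

namespace GodementOperads

/-! ### Objectwise operations as operations in the functor category -/

section Objectwise

open Functor.LaxMonoidal

variable {C : Type u} [Category.{v} C] {D : Type u'} [Category.{v'} D] [MonoidalCategory D]

/-- The objectwise tensor product of a finite family of functors. -/
def objectwiseTens (n : ℕ) (F : Fin n → C ⥤ D) : C ⥤ D where
  obj U := tens n (fun i => (F i).obj U)
  map f := tensMap n (fun i => (F i).map f)
  map_id U := by simp only [CategoryTheory.Functor.map_id, tensMap_id]
  map_comp f g := by simp only [CategoryTheory.Functor.map_comp, tensMap_comp]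

variable [BraidedCategory D]

/-- The objectwise tensor product is the tensor product in the category of functors. -/
noncomputable def objectwiseTensIso (n : ℕ) (F : Fin n → C ⥤ D) :
    objectwiseTens n F ≅ tens n F :=
  NatIso.ofComponents (fun U => @asIso _ _ _ _ (laxTens ((evaluation C D).obj U) n F) (isIso_laxTens _ n F))
    (fun f => laxTens_monoidal ((evaluation C D).map f) n F)

/-- An operation on objectwise tensor products as an operation in the category of functors. -/
noncomputable def internalize {X Y : C ⥤ D} {n : ℕ} {A : Fin n → C ⥤ D}
    (a : X ⊗ objectwiseTens n A ⟶ Y) : X ⊗ tens n A ⟶ Y :=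
  X ◁ (objectwiseTensIso n A).inv ≫ a

lemma transport_internalize {H : (C ⥤ D) ⥤ D} [H.LaxBraided] (U : C)
    (τ : (evaluation C D).obj U ⟶ H) {X Y : C ⥤ D} {n : ℕ} {A : Fin n → C ⥤ D}
    (a : X ⊗ objectwiseTens n A ⟶ Y) :
    transport τ (internalize a) = box H (τ.app X) (laxTens H n A ≫
      H.map (objectwiseTensIso n A).inv) ≫ H.map a := by
  rw [transport, internalize, H.map_comp, box_map_whiskerLeft_assoc]

/-- Transport along the identity of an evaluation undoes `internalize`. This is the dictionary that
turns objectwise axioms into equations of presheaf morphisms. -/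
lemma transport_id_internalize (U : C) {X Y : C ⥤ D} {n : ℕ} {A : Fin n → C ⥤ D}
    (a : X ⊗ objectwiseTens n A ⟶ Y) :
    transport (𝟙 ((evaluation C D).obj U)) (internalize a) = a.app U := by
  have h : laxTens ((evaluation C D).obj U) n A ≫
      ((evaluation C D).obj U).map (objectwiseTensIso n A).inv = 𝟙 _ :=
    (objectwiseTensIso n A).hom_inv_id_app U
  have e : box ((evaluation C D).obj U) (𝟙 (X.obj U)) (𝟙 ((objectwiseTens n A).obj U)) = 𝟙 _ := by
    refine (Category.comp_id _).trans ?_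
    exact id_tensorHom_id _ _
  rw [transport_internalize, h]
  exact (congrArg (· ≫ a.app U) e).trans (Category.id_comp _)

end Objectwise

/-! ### The algebra axioms in the category of presheaves -/

section Algebra

open Functor.LaxMonoidal

variable {C : Type u} [Category.{v} C] {J : GrothendieckTopology C}
  {D : Type u'} [Category.{v'} D] [MonoidalCategory D] [SymmetricCategory D] {z : Prop}
  {P : Sheaf J (Operad D z)}

/-- The composition morphisms of a sheaf of operads. -/
def operationsComp (P : Sheaf J (Operad D z)) (l : Arity z) (m : Fin l.1 → Arity z) :
    operations P l ⊗ objectwiseTens l.1 (fun i => operations P (m i)) ⟶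
      operations P (Arity.sum l m) where
  app U := (P.obj.obj U).comp l m
  naturality _ _ f := ((P.obj.map f).comp_app l m).symm

/-- The action of a bijection on a sheaf of operads. -/
def operationsMap (P : Sheaf J (Operad D z)) {a b : Arity z} (e : Fin a.1 ≃ Fin b.1) :
    operations P b ⟶ operations P a where
  app U := (P.obj.obj U).map e
  naturality _ _ f := ((P.obj.map f).map_app e).symm

/-- The unit of a sheaf of operads. -/
def operationsOne (P : Sheaf J (Operad D z)) : 𝟙_ (Cᵒᵖ ⥤ D) ⟶ operations P (Arity.one z) where
  app U := (P.obj.obj U).one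
  naturality _ _ f := (Category.id_comp _).trans ((P.obj.map f).one_app).symm

namespace SheafAlgebra

variable (A : SheafAlgebra P)

/-- The structure morphisms of a sheaf of algebras in the category of presheaves. -/
noncomputable def internalAct (l : Arity z) :
    operations P l ⊗ tens l.1 (fun _ => A.sheaf.obj) ⟶ A.sheaf.obj :=
  internalize (A := fun _ => A.sheaf.obj) (A.act l)

lemma transport_id_internalAct (U : Cᵒᵖ) (l : Arity z) :
    transport (𝟙 ((evaluation Cᵒᵖ D).obj U)) (A.internalAct l) = (A.act l).app U :=
  transport_id_internalize U (A := fun _ => A.sheaf.obj) (A.act l)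

/-- The general transport rule for the identity of an evaluation identifies the objectwise axiom
with the desired equation evaluated at `U`, preceded by a comparison morphism. The unit and
associativity axioms are obtained in the same manner. -/
lemma internalAct_equivariant {a b : Arity z} (e : Fin a.1 ≃ Fin b.1) :
    (operationsMap P e ⊗ₘ tensPerm e (fun _ => A.sheaf.obj)) ≫ A.internalAct a =
      A.internalAct b := by
  refine NatTrans.ext (funext fun U => ?_)
  have h := map_transport (𝟙 ((evaluation Cᵒᵖ D).obj U)) e (operationsMap P e)
    (fun _ => A.sheaf.obj) (A.internalAct a)
  have h' := (A.isAlgebra U).equivariant e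
  rw [← transport_id_internalAct, ← transport_id_internalAct] at h'
  have k := h.symm.trans h'
  rw [transport, transport] at k
  -- The comparison morphism is invertible, since evaluation is strong monoidal.
  exact (cancel_epi _).1 k

lemma internalAct_unit :
    (λ_ A.sheaf.obj).inv ≫ (operationsOne P ⊗ₘ tensOne A.sheaf.obj) ≫
      A.internalAct (Arity.one z) = 𝟙 A.sheaf.obj := by
  refine NatTrans.ext (funext fun U => ?_)
  have h := one_transport (𝟙 ((evaluation Cᵒᵖ D).obj U)) (operationsOne P)
    (A.internalAct (Arity.one z))
  have h' := (A.isAlgebra U).unit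
  have e : ε ((evaluation Cᵒᵖ D).obj U) ≫ ((evaluation Cᵒᵖ D).obj U).map (operationsOne P) =
    (P.obj.obj U).one := Category.id_comp _
  rw [← transport_id_internalAct, ← e] at h'
  exact h.symm.trans h'

lemma internalAct_assoc (l : Arity z) (m : Fin l.1 → Arity z) :
    internalize (operationsComp P l m) ▷ tens (Arity.sum l m).1 (fun _ => A.sheaf.obj) ≫
        A.internalAct (Arity.sum l m) =
      tensShuffle (operations P l) l.1 (fun i => operations P (m i)) (fun i => (m i).1)
          (fun _ => A.sheaf.obj) ≫
        operations P l ◁ tensMap l.1 (fun i => A.internalAct (m i)) ≫ A.internalAct l := by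
  refine NatTrans.ext (funext fun U => ?_)
  have h := comp_transport (𝟙 ((evaluation Cᵒᵖ D).obj U)) (internalize (operationsComp P l m))
    (A.internalAct (Arity.sum l m))
  have k := shuffle_transport (𝟙 ((evaluation Cᵒᵖ D).obj U)) (X := operations P l)
    (B := fun i => operations P (m i)) (m := fun i => (m i).1) (A := fun _ => A.sheaf.obj)
    (fun i => A.internalAct (m i)) (A.internalAct l)
  have h' := (A.isAlgebra U).assoc l m
  have e : transport (𝟙 ((evaluation Cᵒᵖ D).obj U)) (internalize (operationsComp P l m)) =
    (P.obj.obj U).comp l m := transport_id_internalize U _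
  simp only [← transport_id_internalAct, ← e] at h'
  have q := h.symm.trans (h'.trans k)
  rw [transportSource] at q
  exact (cancel_epi _).1 q

lemma internalAct_hom {A B : SheafAlgebra P} (f : A ⟶ B) (l : Arity z) :
    A.internalAct l ≫ f.hom.hom =
      operations P l ◁ tensMap l.1 (fun _ => f.hom.hom) ≫ B.internalAct l := by
  refine NatTrans.ext (funext fun U => ?_)
  have h := f.isHom l U
  have k := transport_natural (𝟙 ((evaluation Cᵒᵖ D).obj U))
    (operations P l ◁ tensMap l.1 (fun _ => f.hom.hom) ≫ B.internalAct l) (B.internalAct l)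
    (fun _ => f.hom.hom) (𝟙 _) (Category.comp_id _)
  rw [← transport_id_internalAct, ← transport_id_internalAct] at h
  rw [CategoryTheory.Functor.map_id, Category.comp_id] at k
  have e : transport (𝟙 ((evaluation Cᵒᵖ D).obj U)) (A.internalAct l ≫ f.hom.hom) =
      transport (𝟙 ((evaluation Cᵒᵖ D).obj U)) (A.internalAct l) ≫
        ((evaluation Cᵒᵖ D).obj U).map f.hom.hom := by
    rw [transport, transport, CategoryTheory.Functor.map_comp, Category.assoc]
  have q := e.trans (h.trans k.symm)
  rw [transport, transport] at q
  exact (cancel_epi _).1 q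

end SheafAlgebra

end Algebra

end GodementOperads

namespace GodementOperads

/-! ### The algebra structure on hypercohomology -/

section HyperAlgebra

open Functor.LaxMonoidal

variable {C : Type u} [Category.{v} C] [LocallySmall.{w} C] {J : GrothendieckTopology C}
  {X : Type w} (pt : X → GrothendieckTopology.Point.{w} J)
  {D : Type u'} [Category.{v'} D] [MonoidalCategory D] [SymmetricCategory D]
  [HasFiniteProducts D] [HasFilteredColimitsOfSize.{w, w} D] [HasProducts.{w} D]
  [∀ A : D, PreservesFilteredColimitsOfSize.{w, w} (tensorLeft A)]
  (M : MonoidalDescentStructure D)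

/-- The functor `F ↦ (H_X F)(U)`. -/
noncomputable abbrev hyperAt (U : Cᵒᵖ) : (Cᵒᵖ ⥤ D) ⥤ D :=
  hyper pt M.s ⋙ (evaluation Cᵒᵖ D).obj U

noncomputable instance hyperAtLaxBraided (U : Cᵒᵖ) : (hyperAt pt M U).LaxBraided :=
  letI := hyperLaxBraided (C := C) pt M.s M.lam
  inferInstanceAs (hyper pt M.s ⋙ (evaluation Cᵒᵖ D).obj U).LaxBraided

/-- The transformation `F(U) ⟶ (H_X F)(U)` given by `ρ`. -/
noncomputable def rhoAt (U : Cᵒᵖ) : (evaluation Cᵒᵖ D).obj U ⟶ hyperAt pt M U :=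
  Functor.whiskerRight (rhoTrans pt M.s M.lam) ((evaluation Cᵒᵖ D).obj U)

instance (U : Cᵒᵖ) : NatTrans.IsMonoidal (rhoAt pt M U) where
  unit := rfl
  tensor F G := by
    have h := (rhoTrans_isMonoidal pt M.s M.lam).tensor F G
    refine (congrArg (fun t => t.app U) h).trans ?_
    exact congrArg (_ ≫ ·) (Category.id_comp _).symm

lemma hyperAt_μ (U : Cᵒᵖ) (F G : Cᵒᵖ ⥤ D) :
    μ (hyperAt pt M U) F G = (hyperTensor pt M.s F G).app U :=
  Category.id_comp _

lemma box_hyperAt (U : Cᵒᵖ) {x y : D} {F G : Cᵒᵖ ⥤ D} (f : x ⟶ (hyperAt pt M U).obj F)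
    (g : y ⟶ (hyperAt pt M U).obj G) :
    box (hyperAt pt M U) f g = (f ⊗ₘ g) ≫ (hyperTensor pt M.s F G).app U := by
  rw [box, hyperAt_μ]

/-- The constraint `laxTens` ends in the tensor power of the functor category, `hyperTensPower` in
the objectwise one. They correspond under the canonical isomorphism, which on `l + 1` factors is the
one on `l` factors whiskered with `F`. -/
lemma laxTens_hyperAt (U : Cᵒᵖ) (F : Cᵒᵖ ⥤ D) : ∀ l : ℕ,
    laxTens (hyperAt pt M U) l (fun _ => F) = (hyperTensPower pt M F l).app U ≫
      (hyperAt pt M U).map (objectwiseTensIso l (fun _ => F)).hom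
  | 0 => by
    have h : (objectwiseTensIso 0 (fun _ => F)).hom = 𝟙 (𝟙_ (Cᵒᵖ ⥤ D)) :=
      NatTrans.ext (funext fun U => rfl)
    refine Eq.trans ?_ (congrArg (fun t => _ ≫ (hyperAt pt M U).map t) h.symm)
    refine Eq.trans ?_ (congrArg _ ((hyperAt pt M U).map_id _).symm)
    exact (Category.id_comp _).trans (Category.comp_id _).symm
  | l + 1 => by
    have h : (objectwiseTensIso (l + 1) (fun _ => F)).hom =
        (objectwiseTensIso l (fun _ => F)).hom ▷ F :=
      NatTrans.ext (funext fun U => (Category.comp_id _).trans (tensorHom_id _ _))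
    have k : laxTens (hyperAt pt M U) (l + 1) (fun _ => F) =
        box (hyperAt pt M U) (laxTens (hyperAt pt M U) l (fun _ => F)) (𝟙 _) := rfl
    have k' : (hyperTensPower pt M F (l + 1)).app U =
        box (hyperAt pt M U) ((hyperTensPower pt M F l).app U) (𝟙 _) :=
      ((box_hyperAt pt M U _ _).trans (congrArg (· ≫ _) (tensorHom_id _ _))).symm
    rw [k, laxTens_hyperAt U F l, k']
    refine Eq.trans ?_ (congrArg (fun t => _ ≫ (hyperAt pt M U).map t) h.symm)
    exact (box_map_whiskerRight _ _ _).symm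

lemma laxTens_hyperAt_inv (U : Cᵒᵖ) (F : Cᵒᵖ ⥤ D) (l : ℕ) :
    laxTens (hyperAt pt M U) l (fun _ => F) ≫
      (hyperAt pt M U).map (objectwiseTensIso l (fun _ => F)).inv =
        (hyperTensPower pt M F l).app U := by
  refine (congrArg (· ≫ _) (laxTens_hyperAt pt M U F l)).trans ((Category.assoc _ _ _).trans ?_)
  exact (congrArg _ ((hyperAt pt M U).mapIso (objectwiseTensIso l (fun _ => F))).hom_inv_id).trans
    (Category.comp_id _)

variable {z : Prop} {P : Sheaf J (Operad D z)} (A : SheafAlgebra P)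

/-- The link between the explicit structure morphisms and the formalism of transport; from here on
no Künneth morphism is handled directly. -/
lemma transport_rhoAt_internalAct (U : Cᵒᵖ) (l : Arity z) :
    transport (rhoAt pt M U) (A.internalAct l) = (hyperAct pt M A l).app U := by
  refine (transport_internalize U (rhoAt pt M U) (A := fun _ : Fin l.1 => A.sheaf.obj)
    (A.act l)).trans ?_
  refine (congrArg (fun t => box (hyperAt pt M U) _ t ≫ _)
    (laxTens_hyperAt_inv pt M U A.sheaf.obj l.1)).trans ?_
  exact (congrArg (· ≫ _) (box_hyperAt pt M U _ _)).trans (Category.assoc _ _ _)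

theorem hyperIsAlgebra : HyperIsAlgebra pt M A := by
  intro U
  constructor
  · intro a b e
    have h := map_transport (rhoAt pt M U) e (operationsMap P e) (fun _ => A.sheaf.obj)
      (A.internalAct a)
    rw [A.internalAct_equivariant, transport_rhoAt_internalAct, transport_rhoAt_internalAct] at h
    exact h
  · have h := one_transport (rhoAt pt M U) (operationsOne P) (A.internalAct (Arity.one z))
    have e : ε ((evaluation Cᵒᵖ D).obj U) ≫ ((evaluation Cᵒᵖ D).obj U).map (operationsOne P) =
      (P.obj.obj U).one := Category.id_comp _
    rw [← transport_rhoAt_internalAct, ← e]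
    exact h.trans ((congrArg _ A.internalAct_unit).trans
      ((hyperAt pt M U).map_id A.sheaf.obj))
  · intro l m
    have h := comp_transport (rhoAt pt M U) (internalize (operationsComp P l m))
      (A.internalAct (Arity.sum l m))
    have k := shuffle_transport (rhoAt pt M U) (X := operations P l)
      (B := fun i => operations P (m i)) (m := fun i => (m i).1) (A := fun _ => A.sheaf.obj)
      (fun i => A.internalAct (m i)) (A.internalAct l)
    have e : transport (𝟙 ((evaluation Cᵒᵖ D).obj U)) (internalize (operationsComp P l m)) =
      (P.obj.obj U).comp l m := transport_id_internalize U _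
    simp only [transport_rhoAt_internalAct, e] at h k
    -- Both composites now start with the same `transportSource`, and associativity of `A` among
    -- presheaves matches what follows.
    rw [A.internalAct_assoc] at h
    exact h.trans k.symm

theorem isHom_sheafRho (h : HypercohomologyIsSheaf pt M.s) :
    SheafAlgebra.IsHom A (hyperAlgebra pt M h A (hyperIsAlgebra pt M A))
      (sheafRho pt M.toDescentStructure h A.sheaf) := by
  intro l U
  have k := transport_hom (rhoAt pt M U) (A.internalAct l)
  rw [SheafAlgebra.transport_id_internalAct, transport_rhoAt_internalAct] at k
  exact k

/-- The functor `A ↦ H_X A` on sheaves of algebras. -/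
noncomputable def hyperAlgebraFunctor (h : HypercohomologyIsSheaf pt M.s) :
    SheafAlgebra P ⥤ SheafAlgebra P where
  obj A := hyperAlgebra pt M h A (hyperIsAlgebra pt M A)
  map {A B} f := ⟨⟨(hyper pt M.s).map f.hom.hom⟩, by
    intro l U
    have k := transport_natural (rhoAt pt M U) (A.internalAct l) (B.internalAct l)
      (fun _ => f.hom.hom) f.hom.hom (SheafAlgebra.internalAct_hom f l)
    rw [transport_rhoAt_internalAct, transport_rhoAt_internalAct] at k
    exact k⟩
  map_id A := SheafAlgebra.Hom.ext (Sheaf.hom_ext ((hyper pt M.s).map_id _))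
  map_comp f g := SheafAlgebra.Hom.ext (Sheaf.hom_ext ((hyper pt M.s).map_comp _ _))

/-- The morphisms `ρ_A` of sheaves of algebras. -/
noncomputable def algebraRhoTrans (h : HypercohomologyIsSheaf pt M.s) :
    𝟭 (SheafAlgebra P) ⟶ hyperAlgebraFunctor pt M h where
  app A := algebraRho pt M h A (hyperIsAlgebra pt M A) (isHom_sheafRho pt M A h)
  naturality _ _ f :=
    SheafAlgebra.Hom.ext (Sheaf.hom_ext ((rhoTrans pt M.s M.lam).naturality f.hom.hom))

end HyperAlgebra

/-! ### Hypercohomology as a resolvent functor on sheaves -/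

section Equivalences

variable {C : Type u} [Category.{v} C] {J : GrothendieckTopology C} {D : Type u'} [Category.{v'} D]

lemma globalEquivalences_of_isIso {E : MorphismProperty D} (hE : IsSaturated E) {F G : Sheaf J D}
    (f : F ⟶ G) [IsIso ((globalEquivalences J E).Q.map f)] : globalEquivalences J E f :=
  fun U => hE.of_isIso_Q_map (W := globalEquivalences J E)
    (sheafToPresheaf J D ⋙ (evaluation _ _).obj U) (fun _ _ _ hg => hg U) f

variable [LocallySmall.{w} C] {X : Type w} (pt : X → GrothendieckTopology.Point.{w} J)
  [HasFilteredColimitsOfSize.{w, w} D]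

lemma localEquivalences_of_isIso {E : MorphismProperty D} (hE : IsSaturated E) {F G : Sheaf J D}
    (f : F ⟶ G) [IsIso ((localEquivalences pt E).Q.map f)] : localEquivalences pt E f :=
  fun x => hE.of_isIso_Q_map (W := localEquivalences pt E)
    (sheafToPresheaf J D ⋙ stalk (pt x)) (fun _ _ _ hg => hg x) f

variable [HasFiniteProducts D] [HasProducts.{w} D]
  {M : DescentStructure D} {h : HypercohomologyIsSheaf pt M.s}

/-- The functor `H_X` on sheaves. -/
noncomputable def hyperSheafMap (h : HypercohomologyIsSheaf pt M.s) {F G : Sheaf J D} (f : F ⟶ G) :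
    hyperSheaf pt h F ⟶ hyperSheaf pt h G :=
  ⟨(hyper pt M.s).map f.hom⟩

lemma sheafRho_naturality {F G : Sheaf J D} (f : F ⟶ G) :
    f ≫ sheafRho pt M h G = sheafRho pt M h F ≫ hyperSheafMap pt h f :=
  Sheaf.hom_ext ((rhoTrans pt M.s M.lam).naturality f.hom)

namespace IsCompatible

lemma isIso_Q_map_sheafRho (hc : IsCompatible pt M h) (F : Sheaf J D) :
    IsIso ((localEquivalences pt M.E).Q.map (sheafRho pt M h F)) :=
  (hc.isCEFibrantModel F).isIso_Q_map

lemma localEquivalences_sheafRho (hc : IsCompatible pt M h) (F : Sheaf J D) :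
    localEquivalences pt M.E (sheafRho pt M h F) :=
  have := hc.isIso_Q_map_sheafRho pt F
  localEquivalences_of_isIso pt M.saturated _

/-- Hypercohomology sheaves are CE-fibrant, so a weak isomorphism between them is a strong
isomorphism, and saturation makes it a global equivalence. -/
lemma globalEquivalences_of_isIso_Q_map (hc : IsCompatible pt M h) {F G : Sheaf J D}
    (f : hyperSheaf pt h F ⟶ hyperSheaf pt h G) [IsIso ((localEquivalences pt M.E).Q.map f)] :
    globalEquivalences J M.E f :=
  have := isIso_Q_map_of_isCEFibrant (hc.isCEFibrantModel F).1 (hc.isCEFibrantModel G).1 f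
  globalEquivalences_of_isIso M.saturated f

/-- In the naturality square of `ρ` for `f`, three sides are invertible in the weak localization,
hence so is the fourth, a morphism of hypercohomology sheaves. -/
lemma globalEquivalences_hyperSheafMap (hc : IsCompatible pt M h) {F G : Sheaf J D} (f : F ⟶ G)
    (hf : localEquivalences pt M.E f) : globalEquivalences J M.E (hyperSheafMap pt h f) := by
  have hF := hc.isIso_Q_map_sheafRho pt F
  have hG := hc.isIso_Q_map_sheafRho pt G
  have hf' := Localization.inverts (localEquivalences pt M.E).Q _ f hf
  have e := congrArg (localEquivalences pt M.E).Q.map (sheafRho_naturality pt (h := h) f)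
  rw [CategoryTheory.Functor.map_comp, CategoryTheory.Functor.map_comp] at e
  have : IsIso ((localEquivalences pt M.E).Q.map (hyperSheafMap pt h f)) := by
    have := IsIso.comp_isIso' hf' hG
    rw [e] at this
    exact IsIso.of_isIso_comp_left ((localEquivalences pt M.E).Q.map (sheafRho pt M h F)) _
  exact hc.globalEquivalences_of_isIso_Q_map pt _

/-- `ρ` at a hypercohomology sheaf is a weak isomorphism between two such sheaves. -/
lemma globalEquivalences_sheafRho (hc : IsCompatible pt M h) (F : Sheaf J D) :
    globalEquivalences J M.E (sheafRho pt M h (hyperSheaf pt h F)) :=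
  have := hc.isIso_Q_map_sheafRho pt (hyperSheaf pt h F)
  hc.globalEquivalences_of_isIso_Q_map pt _

end IsCompatible

end Equivalences

end GodementOperads

open GodementOperads

theorem theorem3p2p5 {C : Type u} [Category.{v} C] [LocallySmall.{w} C]
    (J : GrothendieckTopology C)
    {X : Type w} (pt : X → GrothendieckTopology.Point.{w} J)
    (hpt : (ObjectProperty.ofObj pt).IsConservativeFamilyOfPoints)
    {D : Type u'} [Category.{v'} D] [MonoidalCategory D] [SymmetricCategory D]
    [HasFiniteProducts D] [HasFilteredColimitsOfSize.{w, w} D] [HasProducts.{w} D]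
    [∀ A : D, PreservesFilteredColimitsOfSize.{w, w} (tensorLeft A)]
    (M : MonoidalDescentStructure D) (hE : IsExact.{w} M.E)
    (hH : HypercohomologyIsSheaf pt M.s)
    (hcomp : IsCompatible pt M.toDescentStructure hH)
    (z : Prop) (P : Sheaf J (Operad D z)) :
    ∃ (hA : ∀ A : SheafAlgebra P, HyperIsAlgebra pt M A)
      (hρ : ∀ A : SheafAlgebra P, SheafAlgebra.IsHom A (hyperAlgebra pt M hH A (hA A))
        (sheafRho pt M.toDescentStructure hH A.sheaf)),
      IsRightCartanEilenberg (globalAlgebraEquivalences P M.E)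
        (localAlgebraEquivalences pt P M.E) ∧
      ∀ A : SheafAlgebra P, IsCEFibrantModel (globalAlgebraEquivalences P M.E)
        (localAlgebraEquivalences pt P M.E)
        ((globalAlgebraEquivalences P M.E).Q.map
          (algebraRho pt M hH A (hA A) (hρ A))) := by
  have hSW : globalAlgebraEquivalences P M.E ≤ localAlgebraEquivalences pt P M.E :=
    fun _ _ f hf => hcomp.isRightCartanEilenberg.strong_le_weak _ hf
  -- Both classes on algebras are inverse images along the forgetful functor, and `H_X` and `ρ` on
  -- algebras lie over those on sheaves. The three conditions on a resolvent functor are therefore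
  -- literally the statements for underlying sheaves.
  have model := isCEFibrantModel_of_resolvent hSW (hyperAlgebraFunctor pt M hH)
    (algebraRhoTrans pt M hH)
    (fun _ _ f hf => hcomp.globalEquivalences_hyperSheafMap pt f.hom hf)
    (fun A => hcomp.globalEquivalences_sheafRho pt A.sheaf)
    (fun A => hcomp.localEquivalences_sheafRho pt A.sheaf)
  refine ⟨hyperIsAlgebra pt M, fun A => isHom_sheafRho pt M A hH, ?_, model⟩
  have := hcomp.isRightCartanEilenberg.strong_comp
  have := hcomp.isRightCartanEilenberg.weak_comp
  exact {
    isomorphisms_le := fun A B f (hf : IsIso f) =>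
      hcomp.isRightCartanEilenberg.isomorphisms_le _
        (inferInstanceAs (IsIso ((SheafAlgebra.forget P).map f)))
    strong_comp := inferInstance
    weak_comp := inferInstance
    strong_le_weak := hSW
    exists_model := fun A => ⟨_, _, model A⟩ }
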